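/- Let $P\subset\mathbb R^3$ be a plane, $\alpha\in S^2$ a unit vector transversal to $P$, and $n$ the unit normal of $P$ with $n_\alpha=n\cdot\alpha<0$. Let $M\subset P$ be a non-empty (relatively open) convex domain bounded by a polygon $\partial M$, let $\lambda\in\mathbb C$ with $\Im\lambda\ge0$, and put $$A=\frac{i n_\alpha+\lambda}{i n_\alpha-\lambda},\qquad \alpha^*=\alpha-2(\alpha\cdot n)n,\qquad t_0=2(\alpha\cdot n)(n\cdot r)\ \ (r\in M),$$ where $t_0$ does not depend on $r\in M$. Let $S=\{r_0+t\alpha: r_0\in M,\ t>0\}$ be the shadow zone and $R=\{r_0+t\alpha^*: r_0\in M,\ t>0\}$ the reflected zone. Fix $\delta\in(0,1/2)$ and, for $k>1$, let $\eta=\eta(k,\cdot)$ be a real $C^\infty$ function on $M$ that vanishes in the $k^{-\delta}$-neighbourhood of $\partial M$, equals $1$ outside the $2k^{-\delta}$-neighbourhood of $\partial M$, and satisfies $|D^m\eta|\le C_mk^{\delta m}$ for every partial derivative of order $m$, with $C_m$ independent of $k$. Define $$D(r)=\int_M\eta\,e^{ik(\alpha\cdot q)}\frac{e^{ik|r-q|}}{|r-q|}\,dS(q),\qquad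 N(r)=\int_M\eta\,e^{ik(\alpha\cdot q)}\frac{\partial}{\partial n_q}\frac{e^{ik|r-q|}}{|r-q|}\,dS(q),$$ the Kirchhoff approximation $$\Phi=\frac{ik}{4\pi}(A-1)n_\alpha D+\frac{A+1}{4\pi}N,$$ and the eikonal approximation $$\psi^{eik}(r)=\begin{cases}-e^{ik\,\alpha\cdot r}, & r\in S,\\ A\,e^{ik(\alpha^*\cdot r+t_0)}, & r\in R,\\ 0, & r\in\mathbb R^3\setminus(R\cup S).\end{cases}$$ For $k>1$, both functions are differentiable outside $\partial R\cup\partial S$. On $\partial R\cup\partial S$ (in particular on $M$, where the two sides are approached from $R$ and from $S$), values and gradients of $\Phi$ and $\psi^{eik}$ are understood as one-sided limits from any of the open regions $R$, $S$, $\mathbb R^3\setminus\overline{R\cup S}$ that has the point in its closure; these limits exist for all large $k$. Then, as $k\to\infty$: (1) uniformly on every compact subset of $M$ (from either side of $M$), and uniformly on every compact subset of $\mathbb R^3\setminus(\partial R\cup\partial S)$, $$\Phi(r)=\psi^{eik}(r)+O(k^{-1/2}),\qquad |\nabla\Phi(r)-\nabla\psi^{eik}(r)|=O(\sqrt k);$$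 (2) for every $\rho>0$ there are constants $C_1,C_2$ such that, for all sufficiently large $k$ and all $|r|<\rho$, $$|\Phi(r)-\psi^{eik}(r)|\le C_1,\qquad |\nabla\Phi(r)-\nabla\psi^{eik}(r)|\le C_2k.$$ -/

import Mathlib

open Filter Topology MeasureTheory
open scoped ContDiff

noncomputable section

namespace KirchhoffPolygon

/-- The Euclidean plane, used as Cartesian coordinates on the plane of the polygon. -/
abbrev E2 := EuclideanSpace ℝ (Fin 2)

/-- The Euclidean space. -/
abbrev E3 := EuclideanSpace ℝ (Fin 3)

/-- The open convex polygonal domain with vertices among `V`, in Cartesian coordinates. -/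
def polygon (V : Finset E2) : Set E2 := interior (convexHull ℝ (V : Set E2))

/-- `η = η(k, q)` is an admissible cut-off function on the planar domain `M₀`: for `k > 1` it is
smooth on `M₀`, vanishes in the `k^{-δ}`-neighbourhood of the edges, equals one outside the
`2k^{-δ}`-neighbourhood of the edges, and its derivatives of order `m` are `O(k^{δ m})`. -/
structure IsCutoff (δ : ℝ) (M₀ : Set E2) (η : ℝ → E2 → ℝ) : Prop where
  smooth : ∀ k : ℝ, 1 < k → ContDiffOn ℝ ∞ (η k) M₀
  eq_zero : ∀ k : ℝ, 1 < k → ∀ q ∈ M₀,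
    Metric.infDist q (frontier M₀) < k ^ (-δ) → η k q = 0
  eq_one : ∀ k : ℝ, 1 < k → ∀ q ∈ M₀,
    2 * k ^ (-δ) < Metric.infDist q (frontier M₀) → η k q = 1
  deriv_bound : ∀ m : ℕ, ∃ C : ℝ, ∀ k : ℝ, 1 < k → ∀ q ∈ M₀,
    ‖iteratedFDeriv ℝ m (η k) q‖ ≤ C * k ^ (δ * m)

/-- The plane wave `e^{ik (α · r)}`. -/
def planeWave (k : ℝ) (α r : E3) : ℂ :=
  Complex.exp (Complex.I * (k * inner ℝ α r : ℝ))

/-- The outgoing spherical wave `e^{ik|r-q|} / |r-q|`. -/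
def sphericalWave (k : ℝ) (r q : E3) : ℂ :=
  Complex.exp (Complex.I * (k * ‖r - q‖ : ℝ)) / (‖r - q‖ : ℝ)

/-- Single layer potential with density `η e^{ik (α · q)}` on `M = τ(M₀)`. Since `τ` is an
isometry of the coordinate plane onto the plane of `M`, the surface element is `dq`. -/
def singleLayer (τ : E2 →ᵃⁱ[ℝ] E3) (M₀ : Set E2) (η : ℝ → E2 → ℝ) (α : E3)
    (k : ℝ) (r : E3) : ℂ :=
  ∫ q in M₀, (η k q : ℂ) * planeWave k α (τ q) * sphericalWave k r (τ q)

/-- Double layer potential with density `η e^{ik (α · q)}` on `M = τ(M₀)`; the kernel is the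
derivative of the spherical wave in the variable `q` in the direction `n`. -/
def doubleLayer (τ : E2 →ᵃⁱ[ℝ] E3) (M₀ : Set E2) (η : ℝ → E2 → ℝ) (α n : E3)
    (k : ℝ) (r : E3) : ℂ :=
  ∫ q in M₀, (η k q : ℂ) * planeWave k α (τ q) *
    fderiv ℝ (fun p : E3 => sphericalWave k r p) (τ q) n

/-- The reflection coefficient `(i n_α + Λ) / (i n_α - Λ)`, where `Λ` is the impedance. -/
def reflCoeff (α n : E3) (Λ : ℂ) : ℂ :=
  (Complex.I * (inner ℝ n α : ℝ) + Λ) / (Complex.I * (inner ℝ n α : ℝ) - Λ)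

/-- The Kirchhoff approximation for the polygon `M = τ(M₀)`. -/
def kirchhoff (τ : E2 →ᵃⁱ[ℝ] E3) (M₀ : Set E2) (η : ℝ → E2 → ℝ) (α n : E3) (Λ : ℂ)
    (k : ℝ) (r : E3) : ℂ :=
  Complex.I * k / (4 * Real.pi) * (reflCoeff α n Λ - 1) * (inner ℝ n α : ℝ) *
      singleLayer τ M₀ η α k r
    + (reflCoeff α n Λ + 1) / (4 * Real.pi) * doubleLayer τ M₀ η α n k r

/-- The direction `α* = α - 2 (α · n) n` of the reflected rays. -/
def reflDir (α n : E3) : E3 := α - (2 * inner ℝ α n : ℝ) • n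

/-- The region covered by the open rays that start on `M` in the direction `β`. -/
def rayZone (M : Set E3) (β : E3) : Set E3 :=
  {r | ∃ r₀ ∈ M, ∃ t : ℝ, 0 < t ∧ r = r₀ + t • β}

/-- The shadow zone. -/
def shadowZone (M : Set E3) (α : E3) : Set E3 := rayZone M α

/-- The reflected zone. -/
def reflectedZone (M : Set E3) (α n : E3) : Set E3 := rayZone M (reflDir α n)

/-- The region outside of the closure of the shadow and reflected zones. -/
def outerZone (M : Set E3) (α n : E3) : Set E3 :=
  (closure (reflectedZone M α n ∪ shadowZone M α))ᶜ

/-- The constant `t₀ = 2 (α · n) (n · r)`, the same for all points `r` of the plane of `M`. -/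
def phaseShift (τ : E2 →ᵃⁱ[ℝ] E3) (α n : E3) : ℝ := 2 * inner ℝ α n * inner ℝ n (τ 0)

open Classical in
/-- The eikonal approximation of the scattered field. -/
def eikonal (τ : E2 →ᵃⁱ[ℝ] E3) (M₀ : Set E2) (α n : E3) (Λ : ℂ) (k : ℝ) (r : E3) : ℂ :=
  if r ∈ shadowZone (τ '' M₀) α then -planeWave k α r
  else if r ∈ reflectedZone (τ '' M₀) α n then
    reflCoeff α n Λ *
      Complex.exp (Complex.I * (k * (inner ℝ (reflDir α n) r + phaseShift τ α n) : ℝ))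
  else 0

/-- The functions `f`, `g` and their gradients have limits at `r` from within the region `Z`;
the limits of `f`, `g` differ by at most `a` and those of the gradients by at most `b`.
At a point of an open `Z` where the functions are `C¹` the limits are just the values. -/
def OneSidedClose (Z : Set E3) (f g : E3 → ℂ) (r : E3) (a b : ℝ) : Prop :=
  ∃ (u v : ℂ) (U V : E3 →L[ℝ] ℂ),
    Tendsto f (𝓝[Z] r) (𝓝 u) ∧ Tendsto g (𝓝[Z] r) (𝓝 v) ∧
    Tendsto (fderiv ℝ f) (𝓝[Z] r) (𝓝 U) ∧ Tendsto (fderiv ℝ g) (𝓝[Z] r) (𝓝 V) ∧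
    ‖u - v‖ ≤ a ∧ ‖U - V‖ ≤ b

end KirchhoffPolygon

end

/-!
After translating the foot of the field point to the origin, a Lorentz boost whose velocity is the
tangential part of the wave direction `d` turns the phase `d · q + |r - q|` into a slant distance,
up to a phase that is linear in `r`. In polar coordinates around the base point of the ray through
`r` the layer potential then becomes a one-dimensional oscillatory integral of the circular means of
the density. These means are even in the radius `w`, so each integration by parts only involves
derivatives along the ray and `w⁻¹ ∂/∂w`; these cost at most `k ^ (2 * δ)` and the step gains `k⁻¹`.
Since `δ < 1 / 2`, repetition leaves an error of arbitrarily high order. If the ray starts where the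
cut-off function is locally constant, all boundary terms but the first vanish, and this one is the
eikonal wave times the value of the cut-off function. Tangential derivatives of the potential fall
on the density, normal ones are derivatives of the one-dimensional integral in the height.
-/
noncomputable section

namespace KirchhoffPolygon

universe u

section UniformRates

variable {ι ι' F G : Type*} [NormedAddCommGroup F] [NormedAddCommGroup G]
  {I : ℝ → Set ι} {s t : ℝ} {f g : ℝ → ι → F}

/-- `f k = O(k ^ s)` for `k > 1`, uniformly on the sets `I k`. -/
def IsUnifBigO (I : ℝ → Set ι) (s : ℝ) (f : ℝ → ι → F) : Prop :=
  (fun v : ℝ × ι => f v.1 v.2) =O[𝓟 {v | 1 < v.1 ∧ v.2 ∈ I v.1}] fun v => v.1 ^ s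

namespace IsUnifBigO

theorem of_bound (C : ℝ) (h : ∀ k, 1 < k → ∀ i ∈ I k, ‖f k i‖ ≤ C * k ^ s) :
    IsUnifBigO I s f := by
  refine Asymptotics.isBigO_principal.2 ⟨C, fun v hv => (h v.1 hv.1 v.2 hv.2).trans_eq ?_⟩
  have : 0 < v.1 := one_pos.trans hv.1
  rw [Real.norm_of_nonneg (by positivity)]

theorem exists_bound (h : IsUnifBigO I s f) :
    ∃ C, 0 ≤ C ∧ ∀ k, 1 < k → ∀ i ∈ I k, ‖f k i‖ ≤ C * k ^ s := by
  obtain ⟨C, hC⟩ := Asymptotics.isBigO_principal.1 h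
  refine ⟨|C|, abs_nonneg C, fun k hk i hi => (hC (k, i) ⟨hk, hi⟩).trans ?_⟩
  have : 0 < k := one_pos.trans hk
  rw [Real.norm_of_nonneg (by positivity)]
  gcongr
  exact le_abs_self C

theorem of_norm_le (hg : IsUnifBigO I s g) {f : ℝ → ι → G}
    (h : ∀ k, 1 < k → ∀ i ∈ I k, ‖f k i‖ ≤ ‖g k i‖) : IsUnifBigO I s f :=
  (Asymptotics.IsBigO.of_bound' (eventually_principal.2 fun v hv => h v.1 hv.1 v.2 hv.2)).trans hg

theorem congr (hg : IsUnifBigO I s g) (h : ∀ k, 1 < k → ∀ i ∈ I k, f k i = g k i) :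
    IsUnifBigO I s f :=
  hg.of_norm_le fun k hk i hi => (congrArg norm (h k hk i hi)).le

theorem comp (hf : IsUnifBigO I s f) (φ : ℝ → ι' → ι) {J : ℝ → Set ι'}
    (h : ∀ k, 1 < k → ∀ j ∈ J k, φ k j ∈ I k) : IsUnifBigO J s fun k j => f k (φ k j) := by
  obtain ⟨C, -, hC⟩ := hf.exists_bound
  exact of_bound C fun k hk j hj => hC k hk _ (h k hk j hj)

theorem mono_set (hf : IsUnifBigO I s f) {J : ℝ → Set ι} (h : ∀ k, 1 < k → J k ⊆ I k) :
    IsUnifBigO J s f :=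
  hf.comp (fun _ => id) h

theorem union (hf : IsUnifBigO I s f) {J : ℝ → Set ι} (hf' : IsUnifBigO J s f) :
    IsUnifBigO (fun k => I k ∪ J k) s f := by
  have hsplit : {v : ℝ × ι | 1 < v.1 ∧ v.2 ∈ I v.1 ∪ J v.1} =
      {v | 1 < v.1 ∧ v.2 ∈ I v.1} ∪ {v | 1 < v.1 ∧ v.2 ∈ J v.1} := by
    ext v
    exact and_or_left
  rw [IsUnifBigO, hsplit, ← sup_principal]
  exact Asymptotics.IsBigO.sup hf hf'

theorem mono_exponent (hf : IsUnifBigO I s f) (hst : s ≤ t) : IsUnifBigO I t f := by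
  obtain ⟨C, hC0, hC⟩ := hf.exists_bound
  refine of_bound C fun k hk i hi => (hC k hk i hi).trans ?_
  have := hk.le
  gcongr

theorem add (hf : IsUnifBigO I s f) (hg : IsUnifBigO I s g) :
    IsUnifBigO I s fun k i => f k i + g k i :=
  Asymptotics.IsBigO.add hf hg

theorem neg (hf : IsUnifBigO I s f) : IsUnifBigO I s fun k i => -f k i :=
  Asymptotics.IsBigO.neg_left hf

theorem sub (hf : IsUnifBigO I s f) (hg : IsUnifBigO I s g) :
    IsUnifBigO I s fun k i => f k i - g k i :=
  Asymptotics.IsBigO.sub hf hg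

theorem sum {κ : Type*} {S : Finset κ} {f : κ → ℝ → ι → F}
    (h : ∀ j ∈ S, IsUnifBigO I s (f j)) : IsUnifBigO I s fun k i => ∑ j ∈ S, f j k i :=
  Asymptotics.IsBigO.fun_sum (A := fun j (v : ℝ × ι) => f j v.1 v.2) h

theorem mul_left {a f : ℝ → ι → ℂ} (ha : IsUnifBigO I t a) (hf : IsUnifBigO I s f) :
    IsUnifBigO I (t + s) fun k i => a k i * f k i := by
  obtain ⟨A, hA0, hA⟩ := ha.exists_bound
  obtain ⟨C, -, hC⟩ := hf.exists_bound
  refine of_bound (A * C) fun k hk i hi => ?_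
  have : 0 < k := one_pos.trans hk
  rw [norm_mul, Real.rpow_add this, mul_mul_mul_comm]
  exact mul_le_mul (hA k hk i hi) (hC k hk i hi) (norm_nonneg _) (by positivity)

end IsUnifBigO

theorem isUnifBigO_const (c : F) : IsUnifBigO I 0 fun _ (_ : ι) => c :=
  .of_bound ‖c‖ fun k _ i _ => by simp

theorem isUnifBigO_ofReal : IsUnifBigO I 1 fun k (_ : ι) => (k : ℂ) :=
  .of_bound 1 fun k hk i _ => by simp [abs_of_pos (one_pos.trans hk)]

end UniformRates

section ParametricIntegrals

variable {E F : Type u} [NormedAddCommGroup E] [NormedSpace ℝ E] [ProperSpace E]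
  [NormedAddCommGroup F] [NormedSpace ℝ F] {f : E × ℝ → F}

theorem hasFDerivAt_integral_of_contDiff (hf : ContDiff ℝ 1 f) (a b : ℝ) (x : E) :
    HasFDerivAt (fun x => ∫ t in a..b, f (x, t))
      (∫ t in a..b, (fderiv ℝ f (x, t)).comp (ContinuousLinearMap.inl ℝ E ℝ)) x := by
  have hf' : Continuous fun v => (fderiv ℝ f v).comp (ContinuousLinearMap.inl ℝ E ℝ) :=
    (hf.continuous_fderiv one_ne_zero).clm_comp continuous_const
  obtain ⟨B, hB⟩ := ((isCompact_closedBall x 1).prod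
    (isCompact_uIcc (a := a) (b := b))).exists_bound_of_continuousOn hf'.continuousOn
  have hfc := hf.continuous
  refine intervalIntegral.hasFDerivAt_integral_of_dominated_of_fderiv_le (s := Metric.ball x 1)
    (F := fun x t => f (x, t)) (bound := fun _ => B) (Metric.ball_mem_nhds x one_pos)
    (.of_forall fun y => (by fun_prop : Continuous fun t => f (y, t)).aestronglyMeasurable)
    ((by fun_prop : Continuous fun t => f (x, t)).intervalIntegrable _ _)
    (hf'.comp (by fun_prop : Continuous fun t : ℝ => (x, t))).aestronglyMeasurable
    (.of_forall fun t ht y hy =>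
      hB (y, t) ⟨Metric.ball_subset_closedBall hy, Set.uIoc_subset_uIcc ht⟩)
    intervalIntegrable_const (.of_forall fun t _ y _ => ?_)
  exact (hf.differentiable one_ne_zero _).hasFDerivAt.comp y (hasFDerivAt_prodMk_left y t)

theorem fderiv_integral_of_contDiff (hf : ContDiff ℝ 1 f) (a b : ℝ) :
    fderiv ℝ (fun x => ∫ t in a..b, f (x, t)) = fun x =>
      ∫ t in a..b, (fderiv ℝ f (x, t)).comp (ContinuousLinearMap.inl ℝ E ℝ) :=
  funext fun x => (hasFDerivAt_integral_of_contDiff hf a b x).fderiv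

theorem contDiff_nat_integral_of_contDiff (n : ℕ) (hf : ContDiff ℝ ∞ f) (a b : ℝ) :
    ContDiff ℝ n (fun x => ∫ t in a..b, f (x, t)) := by
  induction n generalizing F with
  | zero =>
    have hfc := hf.continuous
    exact contDiff_zero.2 (intervalIntegral.continuous_parametric_intervalIntegral_of_continuous'
      (f := fun x t => f (x, t)) hfc a b)
  | succ n ih =>
    have hf1 : ContDiff ℝ 1 f := hf.of_le (by norm_cast)
    push_cast
    rw [contDiff_succ_iff_fderiv, fderiv_integral_of_contDiff hf1]
    refine ⟨fun x => (hasFDerivAt_integral_of_contDiff hf1 a b x).differentiableAt, by simp, ?_⟩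
    exact ih (f := fun v => (fderiv ℝ f v).comp (ContinuousLinearMap.inl ℝ E ℝ))
      ((hf.fderiv_right (m := ∞) (by simp)).clm_comp contDiff_const)

theorem contDiff_integral_of_contDiff (hf : ContDiff ℝ ∞ f) (a b : ℝ) :
    ContDiff ℝ ∞ (fun x => ∫ t in a..b, f (x, t)) :=
  contDiff_infty.2 fun n => contDiff_nat_integral_of_contDiff n hf a b

theorem norm_iteratedFDeriv_integral_le (m : ℕ) (hf : ContDiff ℝ ∞ f) {a b : ℝ} {x : E} {B : ℝ}
    (h : ∀ t ∈ Set.uIoc a b, ‖iteratedFDeriv ℝ m (fun x => f (x, t)) x‖ ≤ B) :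
    ‖iteratedFDeriv ℝ m (fun x => ∫ t in a..b, f (x, t)) x‖ ≤ B * |b - a| := by
  induction m generalizing F with
  | zero =>
    simp only [norm_iteratedFDeriv_zero] at h ⊢
    exact intervalIntegral.norm_integral_le_of_norm_le_const h
  | succ m ih =>
    rw [← norm_iteratedFDeriv_fderiv, fderiv_integral_of_contDiff (hf.of_le (by norm_cast))]
    refine ih (f := fun v => (fderiv ℝ f v).comp (ContinuousLinearMap.inl ℝ E ℝ))
      ((hf.fderiv_right (m := ∞) (by simp)).clm_comp contDiff_const) fun t ht => ?_
    have hpartial : (fun x => (fderiv ℝ f (x, t)).comp (ContinuousLinearMap.inl ℝ E ℝ))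
        = fderiv ℝ (fun x => f (x, t)) := funext fun y =>
      ((hf.differentiable (by simp) _).hasFDerivAt.comp y
        (hasFDerivAt_prodMk_left y t)).fderiv.symm
    rw [hpartial, norm_iteratedFDeriv_fderiv]
    exact h t ht

theorem hasDerivAt_intervalIntegral_of_continuous {f f' : ℝ → ℝ → F} {a b z : ℝ} {s : Set ℝ}
    (hf : ∀ z, Continuous (f z)) (hf' : Continuous fun v : ℝ × ℝ => f' v.1 v.2) (hs : s ∈ 𝓝 z)
    (h : ∀ t ∈ Set.uIoc a b, ∀ z ∈ s, HasDerivAt (fun z => f z t) (f' z t) z) :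
    HasDerivAt (fun z => ∫ t in a..b, f z t) (∫ t in a..b, f' z t) z := by
  obtain ⟨B, hB⟩ := ((isCompact_closedBall z 1).prod
    (isCompact_uIcc (a := a) (b := b))).exists_bound_of_continuousOn hf'.continuousOn
  exact (intervalIntegral.hasDerivAt_integral_of_dominated_loc_of_deriv_le (bound := fun _ => B)
    (inter_mem hs (Metric.closedBall_mem_nhds z one_pos))
    (.of_forall fun y => (hf y).aestronglyMeasurable) ((hf z).intervalIntegrable _ _)
    (hf'.comp (by fun_prop : Continuous fun t : ℝ => (z, t))).aestronglyMeasurable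
    (.of_forall fun t ht y hy => hB (y, t) ⟨hy.2, Set.uIoc_subset_uIcc ht⟩)
    intervalIntegrable_const (.of_forall fun t ht y hy => h t ht y hy.1)).2

end ParametricIntegrals

section Symbols

variable {E E' F : Type*} [NormedAddCommGroup E] [NormedSpace ℝ E]
  [NormedAddCommGroup E'] [NormedSpace ℝ E'] [NormedAddCommGroup F] [NormedSpace ℝ F]

/-- The derivative of `p` in the direction `e`. -/
def dirDeriv (e : E) (p : E → F) : E → F := fun v => fderiv ℝ p v e

theorem contDiff_dirDeriv {p : E → F} (hp : ContDiff ℝ ∞ p) (e : E) :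
    ContDiff ℝ ∞ (dirDeriv e p) :=
  (hp.fderiv_right (m := ∞) (by simp)).clm_apply contDiff_const

theorem norm_iteratedFDeriv_dirDeriv_le {p : E → F} (hp : ContDiff ℝ ∞ p) (e : E) (m : ℕ)
    (v : E) : ‖iteratedFDeriv ℝ m (dirDeriv e p) v‖ ≤ ‖e‖ * ‖iteratedFDeriv ℝ (m + 1) p v‖ := by
  rw [← norm_iteratedFDeriv_fderiv]
  exact norm_iteratedFDeriv_clm_apply_const
    (hp.fderiv_right (m := ∞) (by simp)).contDiffAt (by norm_cast; exact le_top)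

theorem norm_iteratedFDeriv_comp_clm_le {p : E → F} (hp : ContDiff ℝ ∞ p)
    (l : E' →L[ℝ] E) (m : ℕ) (v : E') :
    ‖iteratedFDeriv ℝ m (fun v => p (l v)) v‖ ≤ ‖iteratedFDeriv ℝ m p (l v)‖ * ‖l‖ ^ m := by
  have h := l.iteratedFDeriv_comp_right hp v (i := m) (by norm_cast; exact le_top)
  rw [show (fun v => p (l v)) = p ∘ l from rfl, h]
  exact (ContinuousMultilinearMap.norm_compContinuousLinearMap_le _ _).trans_eq (by simp)

theorem exists_bound_iteratedFDeriv_clm (l : E →L[ℝ] F) {Ω : Set E} {S : ℝ}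
    (hl : ∀ v ∈ Ω, ‖l v‖ ≤ S) (j : ℕ) :
    ∃ B, 0 ≤ B ∧ ∀ v ∈ Ω, ‖iteratedFDeriv ℝ j l v‖ ≤ B := by
  match j with
  | 0 => exact ⟨|S|, abs_nonneg _, fun v hv => by simpa using (hl v hv).trans (le_abs_self S)⟩
  | j + 1 =>
    refine ⟨‖iteratedFDeriv ℝ j (fderiv ℝ l) 0‖, norm_nonneg _, fun v _ => ?_⟩
    rw [← norm_iteratedFDeriv_fderiv, show fderiv ℝ l = fun _ => l from funext fun v => l.fderiv]
    match j with
    | 0 => simp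
    | j + 1 => simp [iteratedFDeriv_succ_const]

/-- A family `p k`, `k > 1`, of smooth functions whose derivatives of order `m` are
`O(k^{δ(N+m)})` on `Ω`. -/
structure IsSymbol (δ : ℝ) (Ω : Set E) (N : ℝ) (p : ℝ → E → F) : Prop where
  smooth : ∀ k, 1 < k → ContDiff ℝ ∞ (p k)
  bound : ∀ m : ℕ, IsUnifBigO (fun _ => Ω) (δ * (N + m)) fun k => iteratedFDeriv ℝ m (p k)

namespace IsSymbol

variable {δ N : ℝ} {Ω : Set E} {p q : ℝ → E → F}

theorem isUnifBigO (hp : IsSymbol δ Ω N p) : IsUnifBigO (fun _ => Ω) (δ * N) p := by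
  simpa using (hp.bound 0).of_norm_le (f := p) fun k _ v _ => by simp

theorem add (hp : IsSymbol δ Ω N p) (hq : IsSymbol δ Ω N q) :
    IsSymbol δ Ω N (fun k v => p k v + q k v) where
  smooth k hk := (hp.smooth k hk).add (hq.smooth k hk)
  bound m := ((hp.bound m).add (hq.bound m)).congr fun k hk v _ => iteratedFDeriv_add_apply
    ((hp.smooth k hk).of_le (by norm_cast; exact le_top)).contDiffAt
    ((hq.smooth k hk).of_le (by norm_cast; exact le_top)).contDiffAt

theorem mono_order (hp : IsSymbol δ Ω N p) (hδ : 0 ≤ δ) {N' : ℝ} (h : N ≤ N') :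
    IsSymbol δ Ω N' p where
  smooth := hp.smooth
  bound m := (hp.bound m).mono_exponent (by gcongr)

theorem dirDeriv (hp : IsSymbol δ Ω N p) (e : E) :
    IsSymbol δ Ω (N + 1) (fun k => dirDeriv e (p k)) where
  smooth k hk := contDiff_dirDeriv (hp.smooth k hk) e
  bound m := by
    obtain ⟨C, -, hC⟩ := (hp.bound (m + 1)).exists_bound
    refine .of_bound (‖e‖ * C) fun k hk v hv => ?_
    refine (norm_iteratedFDeriv_dirDeriv_le (hp.smooth k hk) e m v).trans ?_
    rw [mul_assoc]
    refine mul_le_mul_of_nonneg_left ((hC k hk v hv).trans_eq ?_) (norm_nonneg _)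
    push_cast
    ring_nf

theorem clm_smul (hp : IsSymbol δ Ω N p) (hδ : 0 ≤ δ) (l : E →L[ℝ] ℝ) {S : ℝ}
    (hl : ∀ v ∈ Ω, |l v| ≤ S) : IsSymbol δ Ω N (fun k v => l v • p k v) where
  smooth k hk := l.contDiff.smul (hp.smooth k hk)
  bound m := by
    choose C hC0 hC using fun m => (hp.bound m).exists_bound
    choose B hB0 hB using exists_bound_iteratedFDeriv_clm l hl
    refine .of_bound (∑ i ∈ Finset.range (m + 1), m.choose i * B i * C (m - i))
      fun k hk v hv => ?_
    refine (norm_iteratedFDeriv_smul_le (N := ∞) l.contDiff (hp.smooth k hk) v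
      (by norm_cast; exact le_top)).trans ?_
    rw [Finset.sum_mul]
    refine Finset.sum_le_sum fun i _ => ?_
    have hpi : ‖iteratedFDeriv ℝ (m - i) (p k) v‖ ≤ C (m - i) * k ^ (δ * (N + m)) := by
      refine (hC (m - i) k hk v hv).trans ?_
      have := hC0 (m - i)
      have := hk.le
      have : ((m - i : ℕ) : ℝ) ≤ m := by exact_mod_cast Nat.sub_le m i
      gcongr
    rw [mul_assoc (_ * B i)]
    have := hB0 i
    have := hB i v hv
    gcongr

end IsSymbol

theorem IsSymbol.integral_comp {E E' F : Type u} [NormedAddCommGroup E] [NormedSpace ℝ E]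
    [NormedAddCommGroup E'] [NormedSpace ℝ E'] [ProperSpace E'] [NormedAddCommGroup F]
    [NormedSpace ℝ F] {δ N : ℝ} {Ω : Set E} {p : ℝ → E → F} (hp : IsSymbol δ Ω N p)
    {Ω' : Set E'} (l : ℝ → E' →L[ℝ] E) (hl : ContDiff ℝ ∞ fun v : E' × ℝ => l v.2 v.1)
    {a b B : ℝ} (hB : ∀ t ∈ Set.uIoc a b, ‖l t‖ ≤ B)
    (hΩ : ∀ v ∈ Ω', ∀ t ∈ Set.uIoc a b, l t v ∈ Ω) :
    IsSymbol δ Ω' N (fun k v => ∫ t in a..b, p k (l t v)) where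
  smooth k hk := contDiff_integral_of_contDiff (f := fun v : E' × ℝ => p k (l v.2 v.1))
    ((hp.smooth k hk).comp hl) a b
  bound m := by
    obtain ⟨C, hC0, hC⟩ := (hp.bound m).exists_bound
    refine .of_bound (C * B ^ m * |b - a|) fun k hk v hv => ?_
    refine (norm_iteratedFDeriv_integral_le m (f := fun v : E' × ℝ => p k (l v.2 v.1))
      (B := C * k ^ (δ * (N + m)) * B ^ m) ((hp.smooth k hk).comp hl) fun t ht => ?_).trans_eq
        (by ring)
    refine (norm_iteratedFDeriv_comp_clm_le (hp.smooth k hk) (l t) m v).trans ?_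
    have := hB t ht
    have := (norm_nonneg _).trans this
    have := hC k hk _ (hΩ v hv t ht)
    gcongr

end Symbols

section EvenFunctions

variable {G F : Type u} [NormedAddCommGroup G] [NormedSpace ℝ G] [NormedAddCommGroup F]
  [NormedSpace ℝ F] {p : G × ℝ → F}

/-- The unit vector of the last coordinate, which plays the role of a radius. -/
def radial : G × ℝ := (0, 1)

/-- The scaling of the radius by `t`. -/
def scaleRadius (t : ℝ) : G × ℝ →L[ℝ] G × ℝ :=
  (ContinuousLinearMap.fst ℝ G ℝ).prod (t • ContinuousLinearMap.snd ℝ G ℝ)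

/-- Evenness in the radius. -/
def IsEven (p : G × ℝ → F) : Prop := ∀ v : G × ℝ, p (scaleRadius (-1) v) = p v

/-- For a function `p` that is even in the radius `w` this is `w⁻¹ ∂p/∂w`; the integral formula
makes it smooth up to `w = 0`. -/
def radialQuot (p : G × ℝ → F) : G × ℝ → F :=
  fun v => ∫ t in (0 : ℝ)..1, dirDeriv radial (dirDeriv radial p) (scaleRadius t v)

theorem scaleRadius_apply (t : ℝ) (v : G × ℝ) : scaleRadius t v = (v.1, t * v.2) := rfl

theorem scaleRadius_radial (t : ℝ) : scaleRadius t (radial : G × ℝ) = t • radial := by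
  simp [scaleRadius_apply, radial]

theorem norm_scaleRadius_le {t : ℝ} (ht : |t| ≤ 1) : ‖(scaleRadius t : G × ℝ →L[ℝ] G × ℝ)‖ ≤ 1 := by
  refine ContinuousLinearMap.opNorm_le_bound _ zero_le_one fun v => ?_
  rw [scaleRadius_apply, one_mul, Prod.norm_def, Prod.norm_def]
  refine max_le_max le_rfl ?_
  rw [norm_mul]
  exact mul_le_of_le_one_left (norm_nonneg _) ht

theorem contDiff_scaleRadius : ContDiff ℝ ∞ fun v : (G × ℝ) × ℝ => scaleRadius v.2 v.1 := by
  simp only [scaleRadius_apply]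
  fun_prop

theorem contDiff_radialQuot [ProperSpace G] (hp : ContDiff ℝ ∞ p) :
    ContDiff ℝ ∞ (radialQuot p) :=
  contDiff_integral_of_contDiff
    (f := fun v : (G × ℝ) × ℝ => dirDeriv radial (dirDeriv radial p) (scaleRadius v.2 v.1))
    ((contDiff_dirDeriv (contDiff_dirDeriv hp _) _).comp contDiff_scaleRadius) 0 1

theorem dirDeriv_smul (t : ℝ) (e : G) (p : G → F) (v : G) :
    dirDeriv (t • e) p v = t • dirDeriv e p v := by simp [dirDeriv]

theorem dirDeriv_comp_clm {G' : Type*} [NormedAddCommGroup G'] [NormedSpace ℝ G'] {p : G → F}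
    (hp : Differentiable ℝ p) (l : G' →L[ℝ] G) (e v : G') :
    dirDeriv e (fun v => p (l v)) v = dirDeriv (l e) p (l v) := by
  have h := (hp (l v)).hasFDerivAt.comp v l.hasFDerivAt
  rw [dirDeriv, show (fun v => p (l v)) = p ∘ l from rfl, h.fderiv]
  rfl

theorem dirDeriv_radial_scaleRadius_neg_one (hp : Differentiable ℝ p) {ε : ℝ}
    (h : ∀ v, p (scaleRadius (-1) v) = ε • p v) (v : G × ℝ) :
    dirDeriv radial p (scaleRadius (-1) v) = (-ε) • dirDeriv radial p v := by
  have hε : dirDeriv radial (fun v => ε • p v) v = ε • dirDeriv radial p v := by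
    simp [dirDeriv, fderiv_fun_const_smul (hp v)]
  have hd := dirDeriv_comp_clm hp (scaleRadius (-1)) radial v
  rw [funext h, hε, scaleRadius_radial, dirDeriv_smul] at hd
  rw [neg_smul, hd, neg_one_smul, neg_neg]

namespace IsEven

theorem dirDeriv_radial_neg (hp : ContDiff ℝ ∞ p) (he : IsEven p) (v : G × ℝ) :
    dirDeriv radial p (scaleRadius (-1) v) = -dirDeriv radial p v := by
  simpa using dirDeriv_radial_scaleRadius_neg_one (ε := 1) (hp.differentiable (by simp))
    (fun v => (he v).trans (one_smul ℝ _).symm) v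

theorem dirDeriv_radial_radial (hp : ContDiff ℝ ∞ p) (he : IsEven p) :
    IsEven (dirDeriv radial (dirDeriv radial p)) := fun v => by
  simpa using dirDeriv_radial_scaleRadius_neg_one (ε := -1)
    ((contDiff_dirDeriv hp radial).differentiable (by simp))
    (by simpa only [neg_one_smul] using he.dirDeriv_radial_neg hp) v

theorem radialQuot (hp : ContDiff ℝ ∞ p) (he : IsEven p) : IsEven (radialQuot p) := fun v =>
  intervalIntegral.integral_congr fun t _ => by
    simpa [scaleRadius_apply] using he.dirDeriv_radial_radial hp (scaleRadius t v)

theorem dirDeriv_radial_eq [CompleteSpace F] (hp : ContDiff ℝ ∞ p) (he : IsEven p) (v : G × ℝ) :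
    dirDeriv radial p v = v.2 • KirchhoffPolygon.radialQuot p v := by
  set q := dirDeriv radial p
  have hqc : ContDiff ℝ ∞ q := contDiff_dirDeriv hp radial
  have hq0 : q (scaleRadius 0 v) = 0 := by
    have : IsAddTorsionFree F := .of_isTorsionFree ℝ F
    have h := he.dirDeriv_radial_neg hp (scaleRadius 0 v)
    simp only [scaleRadius_apply, zero_mul, mul_zero] at h
    exact (congrArg q (by simp [scaleRadius_apply])).trans (self_eq_neg.1 h)
  have hline (t : ℝ) : HasDerivAt (fun t => scaleRadius t v) (v.2 • radial) t := by
    refine ((hasDerivAt_const t v.1).prodMk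
      ((hasDerivAt_id t).mul_const v.2)).congr_deriv ?_
    simp [radial]
  have hderiv (t : ℝ) : HasDerivAt (fun t => q (scaleRadius t v))
      (v.2 • dirDeriv radial q (scaleRadius t v)) t := by
    rw [← dirDeriv_smul]
    exact (hqc.differentiable (by simp) _).hasFDerivAt.comp_hasDerivAt t (hline t)
  have hcont : Continuous fun t : ℝ => v.2 • dirDeriv radial q (scaleRadius t v) :=
    ((contDiff_dirDeriv hqc radial).comp
      (contDiff_scaleRadius.comp (contDiff_prodMk_right v))).continuous.const_smul v.2
  have h := intervalIntegral.integral_eq_sub_of_hasDerivAt (fun t _ => hderiv t)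
    (hcont.intervalIntegrable 0 1)
  rw [intervalIntegral.integral_smul, hq0, sub_zero] at h
  exact (h.trans (by simp [scaleRadius_apply])).symm

end IsEven

end EvenFunctions

section Transport

variable {W F : Type u} [NormedAddCommGroup W] [NormedSpace ℝ W] [NormedAddCommGroup F]
  [NormedSpace ℝ F] {p : (ℝ × W) × ℝ → F}

/-- Coordinates `((s, y), w)`: arc parameter, position and radius. -/
abbrev RaySpace (W : Type*) := (ℝ × W) × ℝ

/-- The direction of the rays with slope `b`. -/
def rayDir (b : W) : RaySpace W := ((1, -b), 0)

/-- The derivative in the parameter `σ` along the curves `ringPoint` below, for functions that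
are even in the radius. -/
def transport (b : W) (p : RaySpace W → F) : RaySpace W → F :=
  fun v => dirDeriv (rayDir b) p v + v.1.1 • radialQuot p v

theorem scaleRadius_rayDir (t : ℝ) (b : W) : scaleRadius t (rayDir b) = rayDir b := by
  simp [scaleRadius_apply, rayDir]

theorem contDiff_transport [ProperSpace W] (hp : ContDiff ℝ ∞ p) (b : W) :
    ContDiff ℝ ∞ (transport b p) :=
  (contDiff_dirDeriv hp _).add (contDiff_fst.fst.smul (contDiff_radialQuot hp))

theorem IsEven.transport (hp : ContDiff ℝ ∞ p) (he : IsEven p) (b : W) :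
    IsEven (transport b p) := fun v => by
  have h := dirDeriv_comp_clm (hp.differentiable (by simp)) (scaleRadius (-1)) (rayDir b) v
  rw [funext he, scaleRadius_rayDir] at h
  simp only [KirchhoffPolygon.transport, he.radialQuot hp v, ← h]
  rfl

end Transport

section Phase

/-- The phase factor `e^{it}`. -/
def expI (t : ℝ) : ℂ := Complex.exp (Complex.I * t)

theorem norm_expI (t : ℝ) : ‖expI t‖ = 1 := by
  rw [expI, mul_comm, Complex.norm_exp_ofReal_mul_I]

theorem expI_add (s t : ℝ) : expI (s + t) = expI s * expI t := by
  rw [expI, expI, expI, ← Complex.exp_add]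
  push_cast
  ring_nf

theorem contDiff_expI : ContDiff ℝ ∞ expI :=
  (contDiff_const.mul Complex.ofRealCLM.contDiff).cexp

@[fun_prop]
theorem continuous_expI : Continuous expI := contDiff_expI.continuous

theorem hasDerivAt_expI_comp {f : ℝ → ℝ} {f' t : ℝ} (hf : HasDerivAt f f' t) :
    HasDerivAt (fun t => expI (f t)) (Complex.I * f' * expI (f t)) t :=
  (hf.ofReal_comp.const_mul Complex.I).cexp.congr_deriv (mul_comm _ _)

end Phase

section RingIntegral

/-- The point with parameter `z + σ` on the curve over `x` at height `z`. -/
def ringPoint {W : Type*} [NormedAddCommGroup W] [NormedSpace ℝ W] (b x : W) (z σ : ℝ) :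
    RaySpace W :=
  ((z + σ, x - (z + σ) • b), √(σ * (σ + 2 * z)))

variable {W : Type} [NormedAddCommGroup W] [NormedSpace ℝ W] {b x : W} {z σ κ S : ℝ}

theorem ringPoint_zero (b x : W) (z : ℝ) : ringPoint b x z 0 = ((z, x - z • b), 0) := by
  simp [ringPoint]

theorem continuous_ringPoint (b : W) :
    Continuous fun v : (W × ℝ) × ℝ => ringPoint b v.1.1 v.1.2 v.2 := by
  unfold ringPoint
  fun_prop

theorem IsEven.hasDerivAt_comp_sqrt {G F : Type u} [NormedAddCommGroup G] [NormedSpace ℝ G]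
    [NormedAddCommGroup F] [NormedSpace ℝ F] [CompleteSpace F] {p : G × ℝ → F}
    (he : IsEven p) (hp : ContDiff ℝ ∞ p) {f : ℝ → ℝ} {f' t : ℝ} (hf : HasDerivAt f f' t)
    (hft : 0 < f t) {y : ℝ → G} {y' : G} (hy : HasDerivAt y y' t) :
    HasDerivAt (fun t => p (y t, √(f t)))
      (dirDeriv (y', 0) p (y t, √(f t)) + (f' / 2) • KirchhoffPolygon.radialQuot p (y t, √(f t)))
      t := by
  refine ((hp.differentiable (by simp) (y t, √(f t))).hasFDerivAt.comp_hasDerivAt t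
    (hy.prodMk (hf.sqrt hft.ne'))).congr_deriv ?_
  have hsplit : ((y', f' / (2 * √(f t))) : G × ℝ) = (y', 0) + (f' / (2 * √(f t))) • radial := by
    simp [radial]
  have hscale : f' / (2 * √(f t)) * √(f t) = f' / 2 := by
    have := Real.sqrt_pos.2 hft
    field_simp
  rw [hsplit, map_add, map_smul]
  change _ + _ • dirDeriv radial p _ = _
  rw [he.dirDeriv_radial_eq hp, smul_smul, hscale]
  rfl

variable {p : RaySpace W → ℂ}

theorem hasDerivAt_ringPoint_param (hp : ContDiff ℝ ∞ p) (he : IsEven p) (b x : W)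
    (hz : 0 ≤ z) (hσ : 0 < σ) :
    HasDerivAt (fun σ => p (ringPoint b x z σ)) (transport b p (ringPoint b x z σ)) σ := by
  have hrad : HasDerivAt (fun σ => σ * (σ + 2 * z)) (2 * (z + σ)) σ := by
    refine ((hasDerivAt_id σ).mul ((hasDerivAt_id σ).add_const (2 * z))).congr_deriv ?_
    simp only [id]
    ring
  have harc : HasDerivAt (fun σ => z + σ) 1 σ := (hasDerivAt_id σ).const_add z
  have hpos : HasDerivAt (fun σ => ((z + σ, x - (z + σ) • b) : ℝ × W)) (1, -b) σ :=
    harc.prodMk (by simpa using (harc.smul_const b).const_sub x)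
  refine (he.hasDerivAt_comp_sqrt hp hrad (by positivity) hpos).congr_deriv ?_
  simp only [transport, ringPoint, rayDir]
  congr 2
  ring

theorem hasDerivAt_ringPoint_height (hp : ContDiff ℝ ∞ p) (he : IsEven p) (b x : W)
    (hz : 0 < z) (hσ : 0 < σ) :
    HasDerivAt (fun z => p (ringPoint b x z σ)) (dirDeriv (rayDir b) p (ringPoint b x z σ) +
      σ • radialQuot p (ringPoint b x z σ)) z := by
  have hrad : HasDerivAt (fun z => σ * (σ + 2 * z)) (2 * σ) z := by
    refine (((hasDerivAt_id z).const_mul 2).const_add σ |>.const_mul σ).congr_deriv ?_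
    ring
  have harc : HasDerivAt (fun z => z + σ) 1 z := (hasDerivAt_id z).add_const σ
  have hpos : HasDerivAt (fun z => ((z + σ, x - (z + σ) • b) : ℝ × W)) (1, -b) z :=
    harc.prodMk (by simpa using (harc.smul_const b).const_sub x)
  refine (he.hasDerivAt_comp_sqrt hp hrad (by positivity) hpos).congr_deriv ?_
  simp only [ringPoint, rayDir]
  congr 2
  ring

/-- The integrand of `ringIntegral`. -/
def ringIntegrand (κ : ℝ) (b : W) (p : RaySpace W → ℂ) (x : W) (z σ : ℝ) : ℂ :=
  expI (κ * (z + σ)) * p (ringPoint b x z σ)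

/-- The oscillatory integral along the curve over `x` at height `z`. -/
def ringIntegral (κ S : ℝ) (b : W) (p : RaySpace W → ℂ) (x : W) (z : ℝ) : ℂ :=
  ∫ σ in (0 : ℝ)..S, ringIntegrand κ b p x z σ

/-- The contribution of the start `σ = 0` of the curve to the oscillatory integral: a wave along
the ray through `(x, z)` whose amplitude is read off at the foot of the ray. -/
def ringStart (κ : ℝ) (b : W) (p : RaySpace W → ℂ) (x : W) (z : ℝ) : ℂ :=
  expI (κ * z) * p ((z, x - z • b), 0)

theorem continuous_ringIntegrand (κ : ℝ) (b : W) (hp : Continuous p) :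
    Continuous fun v : (W × ℝ) × ℝ => ringIntegrand κ b p v.1.1 v.1.2 v.2 := by
  have := continuous_ringPoint b
  unfold ringIntegrand
  fun_prop

theorem continuous_ringIntegrand_right (κ : ℝ) (b : W) (hp : Continuous p) (x : W) (z : ℝ) :
    Continuous (ringIntegrand κ b p x z) :=
  (continuous_ringIntegrand κ b hp).comp (by fun_prop : Continuous fun σ : ℝ => ((x, z), σ))

theorem continuous_ringIntegral (κ S : ℝ) (b : W) (hp : Continuous p) :
    Continuous fun v : W × ℝ => ringIntegral κ S b p v.1 v.2 :=
  intervalIntegral.continuous_parametric_intervalIntegral_of_continuous'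
    (f := fun (v : W × ℝ) (σ : ℝ) => ringIntegrand κ b p v.1 v.2 σ)
    (continuous_ringIntegrand κ b hp) 0 S

theorem continuous_ringStart (κ : ℝ) (b : W) (hp : Continuous p) :
    Continuous fun v : W × ℝ => ringStart κ b p v.1 v.2 := by
  unfold ringStart
  fun_prop

theorem hasDerivAt_ringIntegrand_param (hp : ContDiff ℝ ∞ p) (he : IsEven p) (κ : ℝ) (b x : W)
    (hz : 0 ≤ z) (hσ : 0 < σ) :
    HasDerivAt (ringIntegrand κ b p x z)
      (Complex.I * κ * ringIntegrand κ b p x z σ + ringIntegrand κ b (transport b p) x z σ) σ := by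
  refine ((hasDerivAt_expI_comp (((hasDerivAt_id σ).const_add z).const_mul κ)).mul
    (hasDerivAt_ringPoint_param hp he b x hz hσ)).congr_deriv ?_
  simp only [ringIntegrand, id, mul_one]
  ring

theorem hasDerivAt_ringIntegrand_height (hp : ContDiff ℝ ∞ p) (he : IsEven p) (κ : ℝ) (b x : W)
    (hz : 0 < z) (hσ : 0 < σ) :
    HasDerivAt (fun z => ringIntegrand κ b p x z σ)
      (Complex.I * κ * ringIntegrand κ b p x z σ +
        (ringIntegrand κ b (dirDeriv (rayDir b) p) x z σ +
          σ * ringIntegrand κ b (radialQuot p) x z σ)) z := by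
  refine ((hasDerivAt_expI_comp (((hasDerivAt_id z).add_const σ).const_mul κ)).mul
    (hasDerivAt_ringPoint_height hp he b x hz hσ)).congr_deriv ?_
  simp only [ringIntegrand, id, mul_one, Complex.real_smul]
  ring

variable [ProperSpace W]

theorem ringIntegral_add_ringIntegral_transport (hp : ContDiff ℝ ∞ p) (he : IsEven p)
    (hz : 0 ≤ z) (hS : 0 ≤ S) (hpS : p (ringPoint b x z S) = 0) :
    Complex.I * κ * ringIntegral κ S b p x z + ringIntegral κ S b (transport b p) x z =
      -ringStart κ b p x z := by
  have hc := continuous_ringIntegrand_right κ b hp.continuous x z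
  have hct := continuous_ringIntegrand_right κ b (contDiff_transport hp b).continuous x z
  have h := intervalIntegral.integral_eq_sub_of_hasDerivAt_of_le hS hc.continuousOn
    (fun σ hσ => hasDerivAt_ringIntegrand_param hp he κ b x hz hσ.1)
    (((hc.const_mul _).add hct).intervalIntegrable _ _)
  rw [intervalIntegral.integral_add ((hc.const_mul _).intervalIntegrable _ _)
    (hct.intervalIntegrable _ _), intervalIntegral.integral_const_mul] at h
  rw [ringIntegral, ringIntegral, h]
  simp [ringIntegrand, ringStart, hpS, ringPoint_zero]

theorem ringIntegral_eq_add (hp : ContDiff ℝ ∞ p) (he : IsEven p) (hz : 0 ≤ z) (hS : 0 ≤ S)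
    (hκ : κ ≠ 0) (hpS : p (ringPoint b x z S) = 0) :
    ringIntegral κ S b p x z = Complex.I / κ * ringStart κ b p x z +
      Complex.I / κ * ringIntegral κ S b (transport b p) x z := by
  have h := ringIntegral_add_ringIntegral_transport (κ := κ) hp he hz hS hpS
  have hκ' : (κ : ℂ) ≠ 0 := by exact_mod_cast hκ
  field_simp
  linear_combination (-Complex.I) * h + ringIntegral κ S b p x z * κ * Complex.I_mul_I

theorem hasDerivAt_ringIntegral (hp : ContDiff ℝ ∞ p) (he : IsEven p) (hz : 0 < z) (hS : 0 ≤ S)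
    (hpS : p (ringPoint b x z S) = 0) :
    HasDerivAt (fun z => ringIntegral κ S b p x z)
      (-ringStart κ b p x z - z * ringIntegral κ S b (radialQuot p) x z) z := by
  have hquot := (contDiff_radialQuot hp).continuous
  have hdir := (contDiff_dirDeriv hp (rayDir b)).continuous
  have hc := continuous_ringIntegrand_right κ b hp.continuous x z
  have hct := continuous_ringIntegrand_right κ b (contDiff_transport hp b).continuous x z
  have hcq := continuous_ringIntegrand_right κ b hquot x z
  have hline : Continuous fun v : ℝ × ℝ => ((x, v.1), v.2) := by fun_prop
  refine (hasDerivAt_intervalIntegral_of_continuous (s := Set.Ioi 0)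
    (fun y => continuous_ringIntegrand_right κ b hp.continuous x y)
    ((((continuous_ringIntegrand κ b hp.continuous).comp hline).const_mul _).add
      (((continuous_ringIntegrand κ b hdir).comp hline).add
        ((Complex.continuous_ofReal.comp continuous_snd).mul
          ((continuous_ringIntegrand κ b hquot).comp hline))))
    (Ioi_mem_nhds hz) fun σ hσ y hy => hasDerivAt_ringIntegrand_height hp he κ b x hy
      (by rw [Set.uIoc_of_le hS] at hσ; exact hσ.1)).congr_deriv ?_
  rw [← ringIntegral_add_ringIntegral_transport (κ := κ) hp he hz.le hS hpS, ringIntegral,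
    ringIntegral, ringIntegral, ← intervalIntegral.integral_const_mul,
    ← intervalIntegral.integral_const_mul, ← intervalIntegral.integral_add
      ((hc.const_mul _).intervalIntegrable _ _) (hct.intervalIntegrable _ _),
    ← intervalIntegral.integral_sub (((hc.const_mul _).fun_add hct).intervalIntegrable _ _)
      ((hcq.const_mul _).intervalIntegrable _ _)]
  refine intervalIntegral.integral_congr fun σ _ => ?_
  simp only [ringIntegrand, transport, ringPoint, Complex.real_smul]
  push_cast
  ring

end RingIntegral

section RaySymbols

variable {W : Type} [NormedAddCommGroup W] [NormedSpace ℝ W] {δ T ρ S N c : ℝ} {b : W}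
  {X : Set W}

/-- The strip in which the arc parameter is bounded by `T`. -/
def strip (W : Type*) (T : ℝ) : Set (RaySpace W) := {v | |v.1.1| ≤ T}

/-- A symbol on `RaySpace W` that is even in the radius and that vanishes on the far ends of the
curves over the points of `X` at the heights `z < ρ`. -/
structure IsRaySymbol (δ : ℝ) (b : W) (ρ S : ℝ) (X : Set W) (N : ℝ) (p : ℝ → RaySpace W → ℂ) :
    Prop where
  symbol : IsSymbol δ (strip W (ρ + S + 1)) N p
  even : ∀ k, 1 < k → IsEven (p k)
  vanish : ∀ k, 1 < k → ∀ x ∈ X, ∀ z ∈ Set.Ioo 0 ρ, ∀ σ, S < σ → p k (ringPoint b x z σ) = 0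

theorem transport_ringPoint_eq_zero {p : RaySpace W → ℂ} {x : W} {z σ : ℝ} (hp : ContDiff ℝ ∞ p)
    (he : IsEven p) (hS : 0 ≤ S) (hz : 0 ≤ z) (h : ∀ σ, S < σ → p (ringPoint b x z σ) = 0)
    (hσ : S < σ) : transport b p (ringPoint b x z σ) = 0 := by
  refine (hasDerivAt_ringPoint_param hp he b x hz (hS.trans_lt hσ)).unique
    ((hasDerivAt_const σ (0 : ℂ)).congr_of_eventuallyEq ?_)
  filter_upwards [lt_mem_nhds hσ] with τ hτ using h τ hτ

-- The derivatives in the parameter and in the height differ by `z` times the radial quotient.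
theorem radialQuot_ringPoint_eq_zero {p : RaySpace W → ℂ} {x : W} {z σ : ℝ} (hp : ContDiff ℝ ∞ p)
    (he : IsEven p) (hS : 0 ≤ S) (h : ∀ z ∈ Set.Ioo 0 ρ, ∀ σ, S < σ → p (ringPoint b x z σ) = 0)
    (hz : z ∈ Set.Ioo 0 ρ) (hσ : S < σ) : radialQuot p (ringPoint b x z σ) = 0 := by
  have hheight := (hasDerivAt_ringPoint_height hp he b x hz.1 (hS.trans_lt hσ)).unique
    ((hasDerivAt_const z (0 : ℂ)).congr_of_eventuallyEq (by
      filter_upwards [Ioo_mem_nhds hz.1 hz.2] with y hy using h y hy σ hσ))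
  have hparam : dirDeriv (rayDir b) p (ringPoint b x z σ) +
      (z + σ) • radialQuot p (ringPoint b x z σ) = 0 :=
    transport_ringPoint_eq_zero hp he hS hz.1.le (h z hz) hσ
  have : z • radialQuot p (ringPoint b x z σ) = 0 := by
    rw [add_smul, ← add_assoc, add_right_comm, hheight, zero_add] at hparam
    exact hparam
  exact (smul_eq_zero.1 this).resolve_left hz.1.ne'

variable [ProperSpace W] {p : ℝ → RaySpace W → ℂ}

theorem IsSymbol.radialQuot (hp : IsSymbol δ (strip W T) N p) :
    IsSymbol δ (strip W T) (N + 2) (fun k => radialQuot (p k)) := by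
  have hradius : ∀ t ∈ Set.uIoc (0 : ℝ) 1, |t| ≤ 1 := fun t ht => by
    rw [Set.uIoc_of_le zero_le_one] at ht
    exact abs_le.2 ⟨by linarith [ht.1], ht.2⟩
  rw [show N + 2 = N + 1 + 1 by ring]
  exact ((hp.dirDeriv radial).dirDeriv radial).integral_comp scaleRadius contDiff_scaleRadius
    (fun t ht => norm_scaleRadius_le (hradius t ht)) (fun v hv t _ => hv)

theorem IsSymbol.transport (hp : IsSymbol δ (strip W T) N p) (hδ : 0 ≤ δ) (b : W) :
    IsSymbol δ (strip W T) (N + 2) (fun k => transport b (p k)) :=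
  ((hp.dirDeriv (rayDir b)).mono_order hδ (by linarith)).add (hp.radialQuot.clm_smul hδ
    ((ContinuousLinearMap.fst ℝ ℝ W).comp (ContinuousLinearMap.fst ℝ (ℝ × W) ℝ)) fun _ hv => hv)

namespace IsRaySymbol

theorem transport (hp : IsRaySymbol δ b ρ S X N p) (hδ : 0 ≤ δ) (hS : 0 ≤ S) :
    IsRaySymbol δ b ρ S X (N + 2) (fun k => transport b (p k)) where
  symbol := hp.symbol.transport hδ b
  even k hk := (hp.even k hk).transport (hp.symbol.smooth k hk) b
  vanish k hk x hx z hz _ hσ := transport_ringPoint_eq_zero (hp.symbol.smooth k hk)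
    (hp.even k hk) hS hz.1.le (hp.vanish k hk x hx z hz) hσ

theorem radialQuot (hp : IsRaySymbol δ b ρ S X N p) (hS : 0 ≤ S) :
    IsRaySymbol δ b ρ S X (N + 2) (fun k => radialQuot (p k)) where
  symbol := hp.symbol.radialQuot
  even k hk := (hp.even k hk).radialQuot (hp.symbol.smooth k hk)
  vanish k hk x hx _ hz _ hσ := radialQuot_ringPoint_eq_zero (hp.symbol.smooth k hk)
    (hp.even k hk) hS (hp.vanish k hk x hx) hz hσ

theorem iterate_transport (hp : IsRaySymbol δ b ρ S X N p) (hδ : 0 ≤ δ) (hS : 0 ≤ S) (j : ℕ) :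
    IsRaySymbol δ b ρ S X (N + 2 * j) (fun k => (KirchhoffPolygon.transport b)^[j] (p k)) := by
  induction j with
  | zero => simpa using hp
  | succ j ih =>
    simp only [Function.iterate_succ_apply']
    convert ih.transport hδ hS using 1
    push_cast
    ring

theorem ringIntegral_eq_sum_add (hp : IsRaySymbol δ b ρ S X N p) (hδ : 0 ≤ δ) (hS : 0 ≤ S)
    (hc : 0 < c) {k : ℝ} (hk : 1 < k) {x : W} (hx : x ∈ X) {z : ℝ} (hz : z ∈ Set.Ioo 0 ρ)
    (m : ℕ) :
    ringIntegral (k * c) (S + 1) b (p k) x z =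
      ∑ j ∈ Finset.range m, (Complex.I / (k * c : ℝ)) ^ (j + 1) *
        ringStart (k * c) b ((KirchhoffPolygon.transport b)^[j] (p k)) x z +
      (Complex.I / (k * c : ℝ)) ^ m *
        ringIntegral (k * c) (S + 1) b ((KirchhoffPolygon.transport b)^[m] (p k)) x z := by
  induction m with
  | zero => simp
  | succ m ih =>
    have hm := hp.iterate_transport hδ hS m
    rw [ih, ringIntegral_eq_add (hm.symbol.smooth k hk) (hm.even k hk) hz.1.le (by linarith)
      (by positivity) (hm.vanish k hk x hx z hz (S + 1) (by linarith)), Finset.sum_range_succ,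
      Function.iterate_succ_apply']
    ring

end IsRaySymbol

end RaySymbols

section RaySymbolBounds

variable {W : Type} [NormedAddCommGroup W] [NormedSpace ℝ W] {δ ρ S N c : ℝ} {b : W}
  {X : Set W} {p : ℝ → RaySpace W → ℂ} {ι : Type*} {I : ℝ → Set ι}

theorem isUnifBigO_I_div_pow (hc : 0 < c) (j : ℕ) :
    IsUnifBigO I (-j) fun k _ => (Complex.I / (k * c : ℝ)) ^ j := by
  refine .of_bound (c⁻¹ ^ j) fun k hk _ _ => le_of_eq ?_
  have hk0 : 0 < k := one_pos.trans hk
  rw [norm_pow, norm_div, Complex.norm_I, Complex.norm_real, Real.norm_of_nonneg (by positivity),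
    Real.rpow_neg hk0.le, Real.rpow_natCast, ← inv_pow, ← mul_pow, one_div, mul_inv, mul_comm]

theorem isUnifBigO_I_mul (c : ℝ) :
    IsUnifBigO I 1 fun k _ => Complex.I * (k * c : ℝ) :=
  .of_bound |c| fun k hk _ _ => by simp [abs_of_pos (one_pos.trans hk), mul_comm]

theorem isUnifBigO_height {X : Set ι} :
    IsUnifBigO (fun _ => X ×ˢ Set.Ioo 0 ρ) 0 fun _ v => (v.2 : ℂ) :=
  .of_bound ρ fun k _ v hv => by
    rw [Complex.norm_real, Real.norm_of_nonneg hv.2.1.le, Real.rpow_zero, mul_one]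
    exact hv.2.2.le

theorem IsUnifBigO.height_mul {X : Set ι} {I : ℝ → Set (ι × ℝ)} {s : ℝ} {f : ℝ → ι × ℝ → ℂ}
    (hf : IsUnifBigO I s f) (hI : ∀ k, I k ⊆ X ×ˢ Set.Ioo 0 ρ) :
    IsUnifBigO I s fun k v => v.2 * f k v := by
  simpa using (isUnifBigO_height.mono_set fun k _ => hI k).mul_left hf

/-- The points of `X` and heights below `ρ` whose ray has a foot near which `p k` is constant. -/
def flatRays (b : W) (ρ : ℝ) (X : Set W) (p : ℝ → RaySpace W → ℂ) (k : ℝ) : Set (W × ℝ) :=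
  {v ∈ X ×ˢ Set.Ioo 0 ρ | ∃ a, p k =ᶠ[𝓝 ((v.2, v.1 - v.2 • b), 0)] fun _ => a}

theorem flatRays_subset (k : ℝ) : flatRays b ρ X p k ⊆ X ×ˢ Set.Ioo 0 ρ := Set.sep_subset _ _

theorem dirDeriv_eventuallyEq_zero {E F : Type*} [NormedAddCommGroup E] [NormedSpace ℝ E]
    [NormedAddCommGroup F] [NormedSpace ℝ F] {p : E → F} {v : E} {a : F}
    (h : p =ᶠ[𝓝 v] fun _ => a) (e : E) : dirDeriv e p =ᶠ[𝓝 v] fun _ => 0 := by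
  filter_upwards [h.eventuallyEq_nhds] with u hu
  simp [dirDeriv, hu.fderiv_eq]

theorem radialQuot_eventuallyEq_zero {p : RaySpace W → ℂ} {y : ℝ × W} {a : ℂ}
    (h : p =ᶠ[𝓝 (y, 0)] fun _ => a) : radialQuot p =ᶠ[𝓝 (y, 0)] fun _ => 0 := by
  obtain ⟨ε, hε, hzero⟩ := Metric.eventually_nhds_iff.1
    (dirDeriv_eventuallyEq_zero (dirDeriv_eventuallyEq_zero h radial) radial)
  refine Metric.eventually_nhds_iff.2 ⟨ε, hε, fun v hv => ?_⟩
  rw [radialQuot, intervalIntegral.integral_congr (g := fun _ => 0) fun t ht => hzero ?_,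
    intervalIntegral.integral_zero]
  rw [Set.uIcc_of_le zero_le_one] at ht
  rw [Prod.dist_eq] at hv ⊢
  refine (max_le_max le_rfl ?_).trans_lt hv
  simp only [scaleRadius_apply, dist_zero_right, norm_mul]
  exact mul_le_of_le_one_left (norm_nonneg _) (abs_le.2 ⟨by linarith [ht.1], ht.2⟩)

theorem transport_eventuallyEq_zero {p : RaySpace W → ℂ} {y : ℝ × W} {a : ℂ} (b : W)
    (h : p =ᶠ[𝓝 (y, 0)] fun _ => a) : transport b p =ᶠ[𝓝 (y, 0)] fun _ => 0 := by
  filter_upwards [dirDeriv_eventuallyEq_zero h (rayDir b), radialQuot_eventuallyEq_zero h]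
    with v hdir hquot
  rw [transport, hdir, hquot, smul_zero, add_zero]

theorem iterate_transport_eventuallyEq_zero {p : RaySpace W → ℂ} {y : ℝ × W} {a : ℂ} (b : W)
    (h : p =ᶠ[𝓝 (y, 0)] fun _ => a) (j : ℕ) :
    (transport b)^[j + 1] p =ᶠ[𝓝 (y, 0)] fun _ => 0 := by
  induction j with
  | zero => exact transport_eventuallyEq_zero b h
  | succ j ih =>
    rw [Function.iterate_succ_apply']
    exact transport_eventuallyEq_zero b ih

theorem flatRays_subset_radialQuot (k : ℝ) :
    flatRays b ρ X p k ⊆ flatRays b ρ X (fun k => radialQuot (p k)) k :=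
  fun _ ⟨hv, _, ha⟩ => ⟨hv, 0, radialQuot_eventuallyEq_zero ha⟩

theorem ringStart_radialQuot_eq_zero {k κ : ℝ} {v : W × ℝ} (hv : v ∈ flatRays b ρ X p k) :
    ringStart κ b (radialQuot (p k)) v.1 v.2 = 0 := by
  obtain ⟨-, a, ha⟩ := hv
  rw [ringStart, (radialQuot_eventuallyEq_zero ha).eq_of_nhds, mul_zero]

theorem IsSymbol.isUnifBigO_ringStart (hp : IsSymbol δ (strip W (ρ + S + 1)) N p) (hS : 0 ≤ S)
    (c : ℝ) :
    IsUnifBigO (fun _ => X ×ˢ Set.Ioo 0 ρ) (δ * N)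
      fun k v => ringStart (k * c) b (p k) v.1 v.2 := by
  refine (IsUnifBigO.comp hp.isUnifBigO (fun _ v => ((v.2, v.1 - v.2 • b), 0))
    fun k _ v hv => ?_).of_norm_le fun k _ v _ => by rw [ringStart, norm_mul, norm_expI, one_mul]
  simp only [strip, Set.mem_ofPred_eq, abs_of_pos hv.2.1]
  linarith [hv.2.2]

namespace IsRaySymbol

theorem isUnifBigO_ringIntegral_of_strip (hp : IsRaySymbol δ b ρ S X N p) (hS : 0 ≤ S) (c : ℝ) :
    IsUnifBigO (fun _ => X ×ˢ Set.Ioo 0 ρ) (δ * N)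
      fun k v => ringIntegral (k * c) (S + 1) b (p k) v.1 v.2 := by
  obtain ⟨C, -, hC⟩ := hp.symbol.isUnifBigO.exists_bound
  refine .of_bound (C * (S + 1)) fun k hk v hv => ?_
  refine (intervalIntegral.norm_integral_le_of_norm_le_const (C := C * k ^ (δ * N))
    fun σ hσ => ?_).trans_eq ?_
  · rw [Set.uIoc_of_le (by linarith)] at hσ
    rw [ringIntegrand, norm_mul, norm_expI, one_mul]
    have hpos : 0 ≤ v.2 + σ := by linarith [hv.2.1, hσ.1]
    refine hC k hk _ ?_
    simp only [strip, Set.mem_ofPred_eq, ringPoint, abs_of_nonneg hpos]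
    linarith [hv.2.2, hσ.2]
  · rw [sub_zero, abs_of_nonneg (by linarith)]
    ring

variable [ProperSpace W]

theorem isUnifBigO_ringIntegral_iterate (hp : IsRaySymbol δ b ρ S X N p) (hδ : 0 ≤ δ)
    (hS : 0 ≤ S) (hc : 0 < c) (m : ℕ) :
    IsUnifBigO (fun _ => X ×ˢ Set.Ioo 0 ρ) (δ * N + (2 * δ - 1) * m) fun k v =>
      (Complex.I / (k * c : ℝ)) ^ m *
        ringIntegral (k * c) (S + 1) b ((KirchhoffPolygon.transport b)^[m] (p k)) v.1 v.2 := by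
  convert (isUnifBigO_I_div_pow hc m).mul_left
    ((hp.iterate_transport hδ hS m).isUnifBigO_ringIntegral_of_strip hS c) using 1
  ring

theorem isUnifBigO_ringStart_iterate (hp : IsRaySymbol δ b ρ S X N p) (hδ : 0 ≤ δ)
    (hS : 0 ≤ S) (hc : 0 < c) (j : ℕ) :
    IsUnifBigO (fun _ => X ×ˢ Set.Ioo 0 ρ) (δ * N + (2 * δ - 1) * j - 1) fun k v =>
      (Complex.I / (k * c : ℝ)) ^ (j + 1) *
        ringStart (k * c) b ((KirchhoffPolygon.transport b)^[j] (p k)) v.1 v.2 := by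
  convert (isUnifBigO_I_div_pow hc (j + 1)).mul_left
    ((hp.iterate_transport hδ hS j).symbol.isUnifBigO_ringStart hS c) using 1
  push_cast
  ring

theorem isUnifBigO_ringIntegral (hp : IsRaySymbol δ b ρ S X N p) (hδ : 0 ≤ δ) (hδ₁ : δ < 1 / 2)
    (hS : 0 ≤ S) (hc : 0 < c) :
    IsUnifBigO (fun _ => X ×ˢ Set.Ioo 0 ρ) (δ * N - 1)
      fun k v => ringIntegral (k * c) (S + 1) b (p k) v.1 v.2 := by
  obtain ⟨m, hm⟩ := exists_nat_ge (1 / (1 - 2 * δ))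
  rw [div_le_iff₀ (by linarith)] at hm
  have hstart : ∀ j ∈ Finset.range m, _ := fun j _ =>
    (hp.isUnifBigO_ringStart_iterate hδ hS hc j).mono_exponent (t := δ * N - 1)
      (by nlinarith [j.cast_nonneg (α := ℝ)])
  exact ((IsUnifBigO.sum hstart).add ((hp.isUnifBigO_ringIntegral_iterate hδ hS hc m).mono_exponent
    (by linarith))).congr fun k hk v hv => hp.ringIntegral_eq_sum_add hδ hS hc hk hv.1 hv.2 m

-- Where the symbol is constant the transports vanish, so only the first boundary term survives.
theorem isUnifBigO_ringIntegral_sub_ringStart (hp : IsRaySymbol δ b ρ S X N p) (hδ : 0 ≤ δ)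
    (hδ₁ : δ < 1 / 2) (hS : 0 ≤ S) (hc : 0 < c) (B : ℝ) :
    IsUnifBigO (flatRays b ρ X p) (-B) fun k v => ringIntegral (k * c) (S + 1) b (p k) v.1 v.2 -
      Complex.I / (k * c : ℝ) * ringStart (k * c) b (p k) v.1 v.2 := by
  obtain ⟨m, hm⟩ := exists_nat_ge ((B + δ * N) / (1 - 2 * δ))
  rw [div_le_iff₀ (by linarith)] at hm
  have hrem := hp.isUnifBigO_ringIntegral_iterate hδ hS hc (m + 1)
  refine ((hrem.mono_exponent (t := -B) ?_).mono_set fun k _ => flatRays_subset k).congr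
    fun k hk v ⟨hv, a, ha⟩ => ?_
  · push_cast
    linarith
  have hstart (j : ℕ) :
      ringStart (k * c) b ((KirchhoffPolygon.transport b)^[j + 1] (p k)) v.1 v.2 = 0 := by
    rw [ringStart, (iterate_transport_eventuallyEq_zero b ha j).eq_of_nhds, mul_zero]
  rw [hp.ringIntegral_eq_sum_add hδ hS hc hk hv.1 hv.2 (m + 1), Finset.sum_range_succ']
  simp only [hstart, mul_zero, Finset.sum_const_zero, zero_add, pow_one, Function.iterate_zero, id,
    add_sub_cancel_left]

theorem isUnifBigO_ringIntegral_radialQuot (hp : IsRaySymbol δ b ρ S X N p) (hδ : 0 ≤ δ)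
    (hδ₁ : δ < 1 / 2) (hS : 0 ≤ S) (hc : 0 < c) (B : ℝ) :
    IsUnifBigO (flatRays b ρ X p) (-B)
      fun k v => ringIntegral (k * c) (S + 1) b (KirchhoffPolygon.radialQuot (p k)) v.1 v.2 :=
  (((hp.radialQuot hS).isUnifBigO_ringIntegral_sub_ringStart hδ hδ₁ hS hc B).mono_set
    fun k _ => flatRays_subset_radialQuot k).congr fun k _ v hv => by
      rw [ringStart_radialQuot_eq_zero hv, mul_zero, sub_zero]

end IsRaySymbol

end RaySymbolBounds

section HeightDerivatives

variable {W : Type} [NormedAddCommGroup W] [NormedSpace ℝ W] {b x : W} {κ S z : ℝ}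
  {p : RaySpace W → ℂ}

/-- The derivative of `ringIntegral` in the height. -/
def ringDeriv (κ S : ℝ) (b : W) (p : RaySpace W → ℂ) (x : W) (z : ℝ) : ℂ :=
  -ringStart κ b p x z - z * ringIntegral κ S b (radialQuot p) x z

/-- The second derivative of `ringIntegral` in the height. -/
def ringDeriv₂ (κ S : ℝ) (b : W) (p : RaySpace W → ℂ) (x : W) (z : ℝ) : ℂ :=
  -(Complex.I * κ * ringStart κ b p x z + ringStart κ b (dirDeriv (rayDir b) p) x z) -
    (ringIntegral κ S b (radialQuot p) x z + z * ringDeriv κ S b (radialQuot p) x z)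

theorem hasDerivAt_ringStart (hp : ContDiff ℝ ∞ p) (κ : ℝ) (b x : W) (z : ℝ) :
    HasDerivAt (fun z => ringStart κ b p x z)
      (Complex.I * κ * ringStart κ b p x z + ringStart κ b (dirDeriv (rayDir b) p) x z) z := by
  have hfoot : HasDerivAt (fun z : ℝ => (((z, x - z • b), 0) : RaySpace W)) (rayDir b) z :=
    ((hasDerivAt_id z).prodMk (by simpa using ((hasDerivAt_id z).smul_const b).const_sub x)).prodMk
      (hasDerivAt_const z 0)
  refine ((hasDerivAt_expI_comp ((hasDerivAt_id z).const_mul κ)).mul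
    ((hp.differentiable (by simp) _).hasFDerivAt.comp_hasDerivAt z hfoot)).congr_deriv ?_
  simp only [ringStart, dirDeriv, id, mul_one, Function.comp]
  ring

variable [ProperSpace W]

theorem hasDerivAt_ringDeriv (hp : ContDiff ℝ ∞ p) (he : IsEven p) (hz : 0 < z) (hS : 0 ≤ S)
    (hpS : radialQuot p (ringPoint b x z S) = 0) :
    HasDerivAt (fun z => ringDeriv κ S b p x z) (ringDeriv₂ κ S b p x z) z := by
  refine ((hasDerivAt_ringStart hp κ b x z).neg.sub ((hasDerivAt_id z).ofReal_comp.mul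
    (hasDerivAt_ringIntegral (contDiff_radialQuot hp) (he.radialQuot hp) hz hS hpS))).congr_deriv ?_
  simp only [ringDeriv₂, ringDeriv, id, Complex.ofReal_one, one_mul]

theorem continuous_ringDeriv (κ S : ℝ) (b : W) (hp : ContDiff ℝ ∞ p) :
    Continuous fun v : W × ℝ => ringDeriv κ S b p v.1 v.2 :=
  (continuous_ringStart κ b hp.continuous).neg.sub ((Complex.continuous_ofReal.comp
    continuous_snd).mul (continuous_ringIntegral κ S b (contDiff_radialQuot hp).continuous))

theorem continuous_ringDeriv₂ (κ S : ℝ) (b : W) (hp : ContDiff ℝ ∞ p) :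
    Continuous fun v : W × ℝ => ringDeriv₂ κ S b p v.1 v.2 := by
  have hquot := contDiff_radialQuot hp
  exact ((continuous_const.mul (continuous_ringStart κ b hp.continuous)).add
    (continuous_ringStart κ b (contDiff_dirDeriv hp _).continuous)).neg.sub
    ((continuous_ringIntegral κ S b hquot.continuous).add
      ((Complex.continuous_ofReal.comp continuous_snd).mul (continuous_ringDeriv κ S b hquot)))

namespace IsRaySymbol

variable {δ ρ N c : ℝ} {X : Set W} {p : ℝ → RaySpace W → ℂ}

theorem isUnifBigO_ringDeriv (hp : IsRaySymbol δ b ρ S X N p) (hδ : 0 ≤ δ) (hδ₁ : δ < 1 / 2)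
    (hS : 0 ≤ S) (hc : 0 < c) :
    IsUnifBigO (fun _ => X ×ˢ Set.Ioo 0 ρ) (δ * N)
      fun k v => ringDeriv (k * c) (S + 1) b (p k) v.1 v.2 :=
  (hp.symbol.isUnifBigO_ringStart hS c).neg.sub
    ((((hp.radialQuot hS).isUnifBigO_ringIntegral hδ hδ₁ hS hc).mono_exponent
      (by linarith)).height_mul fun _ => subset_rfl)

theorem isUnifBigO_ringDeriv₂ (hp : IsRaySymbol δ b ρ S X N p) (hδ : 0 ≤ δ) (hδ₁ : δ < 1 / 2)
    (hS : 0 ≤ S) (hc : 0 < c) :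
    IsUnifBigO (fun _ => X ×ˢ Set.Ioo 0 ρ) (δ * N + 1)
      fun k v => ringDeriv₂ (k * c) (S + 1) b (p k) v.1 v.2 := by
  have hquot := hp.radialQuot hS
  have hphase := (isUnifBigO_I_mul c).mul_left
    (hp.symbol.isUnifBigO_ringStart (X := X) (b := b) hS c)
  rw [add_comm] at hphase
  exact (hphase.add (((hp.symbol.dirDeriv (rayDir b)).isUnifBigO_ringStart hS c).mono_exponent
      (by linarith))).neg.sub
    (((hquot.isUnifBigO_ringIntegral hδ hδ₁ hS hc).mono_exponent (by linarith)).add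
      (((hquot.isUnifBigO_ringDeriv hδ hδ₁ hS hc).mono_exponent (by linarith)).height_mul
        fun _ => subset_rfl))

theorem isUnifBigO_ringDeriv_add_ringStart (hp : IsRaySymbol δ b ρ S X N p) (hδ : 0 ≤ δ)
    (hδ₁ : δ < 1 / 2) (hS : 0 ≤ S) (hc : 0 < c) (B : ℝ) :
    IsUnifBigO (flatRays b ρ X p) (-B) fun k v =>
      ringDeriv (k * c) (S + 1) b (p k) v.1 v.2 + ringStart (k * c) b (p k) v.1 v.2 :=
  ((hp.isUnifBigO_ringIntegral_radialQuot hδ hδ₁ hS hc B).height_mul flatRays_subset).neg.congr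
    fun k _ v _ => by rw [ringDeriv, sub_add_eq_add_sub, neg_add_cancel, zero_sub]

theorem isUnifBigO_ringDeriv₂_add_ringStart (hp : IsRaySymbol δ b ρ S X N p) (hδ : 0 ≤ δ)
    (hδ₁ : δ < 1 / 2) (hS : 0 ≤ S) (hc : 0 < c) (B : ℝ) :
    IsUnifBigO (flatRays b ρ X p) (-B) fun k v =>
      ringDeriv₂ (k * c) (S + 1) b (p k) v.1 v.2 +
        Complex.I * (k * c : ℝ) * ringStart (k * c) b (p k) v.1 v.2 := by
  have hquot : IsUnifBigO (flatRays b ρ X p) (-B) fun k v =>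
      ringDeriv (k * c) (S + 1) b (KirchhoffPolygon.radialQuot (p k)) v.1 v.2 :=
    (((hp.radialQuot hS).isUnifBigO_ringDeriv_add_ringStart hδ hδ₁ hS hc B).mono_set
      fun k _ => flatRays_subset_radialQuot k).congr fun k _ v hv => by
        rw [ringStart_radialQuot_eq_zero hv, add_zero]
  refine ((hp.isUnifBigO_ringIntegral_radialQuot hδ hδ₁ hS hc B).add
    (hquot.height_mul flatRays_subset)).neg.congr fun k _ v ⟨_, a, ha⟩ => ?_
  have hdir : ringStart (k * c) b (dirDeriv (rayDir b) (p k)) v.1 v.2 = 0 := by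
    rw [ringStart, (dirDeriv_eventuallyEq_zero ha _).eq_of_nhds, mul_zero]
  rw [ringDeriv₂, hdir]
  ring

end IsRaySymbol

end HeightDerivatives

section Slant

variable {V : Type*} [NormedAddCommGroup V]

/-- The distance from a point at height `z` over the origin of `V` to `y`. -/
def slant (z : ℝ) (y : V) : ℝ := √(‖y‖ ^ 2 + z ^ 2)

theorem slant_sq (z : ℝ) (y : V) : slant z y ^ 2 = ‖y‖ ^ 2 + z ^ 2 :=
  Real.sq_sqrt (by positivity)

theorem slant_pos {z : ℝ} (hz : 0 < z) (y : V) : 0 < slant z y :=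
  Real.sqrt_pos.2 (by positivity)

theorem norm_le_slant (z : ℝ) (y : V) : ‖y‖ ≤ slant z y :=
  Real.le_sqrt_of_sq_le (by nlinarith [sq_nonneg z])

theorem le_slant (z : ℝ) (y : V) : z ≤ slant z y :=
  Real.le_sqrt_of_sq_le (by nlinarith [sq_nonneg ‖y‖])

theorem slant_le {z : ℝ} (hz : 0 ≤ z) (y : V) : slant z y ≤ ‖y‖ + z :=
  (Real.sqrt_le_left (by positivity)).2 (by nlinarith [mul_nonneg (norm_nonneg y) hz])

@[fun_prop]
theorem continuous_slant (z : ℝ) : Continuous (slant z : V → ℝ) := by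
  unfold slant
  fun_prop

end Slant

section Boost

variable {V : Type*} [NormedAddCommGroup V] [InnerProductSpace ℝ V] {a : V} {c z : ℝ}

/-- The linear part of the boost. -/
def stretch (a : V) (c : ℝ) : V →L[ℝ] V :=
  ContinuousLinearMap.id ℝ V + ((1 / (c * (1 + c))) • innerSL ℝ a).smulRight a

/-- The Lorentz boost of the hyperboloid `s² = ‖y‖² + z²`, written in the coordinate `y`, which
takes the phase `s + ⟪a, y⟫` to `c s` when `‖a‖² + c² = 1`. -/
def boost (a : V) (c z : ℝ) (y : V) : V := stretch a c y - (slant z y / c) • a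

/-- The derivative of the boost. -/
def boostDeriv (a : V) (c z : ℝ) (y : V) : V →L[ℝ] V :=
  ContinuousLinearMap.id ℝ V +
    ((1 / (c * (1 + c))) • innerSL ℝ a - (1 / (c * slant z y)) • innerSL ℝ y).smulRight a

theorem stretch_apply (a : V) (c : ℝ) (v : V) :
    stretch a c v = v + (1 / (c * (1 + c)) * inner ℝ a v) • a := by
  simp [stretch]

theorem stretch_neg (a : V) (c : ℝ) : stretch (-a) c = stretch a c := by
  ext1 v
  simp [stretch_apply]

theorem abs_inner_le_slant (ha : ‖a‖ ≤ 1) (z : ℝ) (y : V) : |inner ℝ a y| ≤ slant z y :=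
  calc |inner ℝ a y| ≤ ‖a‖ * ‖y‖ := abs_real_inner_le_norm a y
    _ ≤ ‖y‖ := mul_le_of_le_one_left (norm_nonneg _) ha
    _ ≤ slant z y := norm_le_slant z y

theorem inner_stretch (hc : 0 < c) (hac : ‖a‖ ^ 2 + c ^ 2 = 1) (y : V) :
    inner ℝ a (stretch a c y) = inner ℝ a y / c := by
  rw [stretch_apply, inner_add_right, inner_smul_right, real_inner_self_eq_norm_sq,
    show ‖a‖ ^ 2 = (1 - c) * (1 + c) by linarith]
  field_simp
  ring

theorem inner_boost (hc : 0 < c) (hac : ‖a‖ ^ 2 + c ^ 2 = 1) (z : ℝ) (y : V) :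
    inner ℝ a (boost a c z y) = (inner ℝ a y - (1 - c ^ 2) * slant z y) / c := by
  rw [boost, inner_sub_right, inner_stretch hc hac, inner_smul_right, real_inner_self_eq_norm_sq,
    show ‖a‖ ^ 2 = 1 - c ^ 2 by linarith]
  ring

theorem norm_boost_sq (hac : ‖a‖ ^ 2 + c ^ 2 = 1) (z : ℝ) (y : V) :
    ‖boost a c z y‖ ^ 2 = ‖y‖ ^ 2 +
      2 * ((1 / (c * (1 + c)) * inner ℝ a y - slant z y / c) * inner ℝ a y) +
      (1 / (c * (1 + c)) * inner ℝ a y - slant z y / c) ^ 2 * (1 - c ^ 2) := by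
  rw [boost, stretch_apply, add_sub_assoc, ← sub_smul, norm_add_sq_real, inner_smul_right,
    norm_smul, mul_pow, show ‖a‖ ^ 2 = 1 - c ^ 2 by linarith, Real.norm_eq_abs, sq_abs,
    real_inner_comm]

theorem slant_boost (hc : 0 < c) (hac : ‖a‖ ^ 2 + c ^ 2 = 1) (z : ℝ) (y : V) :
    slant z (boost a c z y) = (slant z y - inner ℝ a y) / c := by
  have ha : ‖a‖ ≤ 1 := by nlinarith [sq_nonneg c, norm_nonneg a]
  have hle := (abs_le.1 (abs_inner_le_slant ha z y)).2
  refine (Real.sqrt_eq_iff_mul_self_eq (by positivity) (div_nonneg (by linarith) hc.le)).2 ?_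
  rw [norm_boost_sq hac, show ‖y‖ ^ 2 = slant z y ^ 2 - z ^ 2 by linarith [slant_sq z y]]
  field_simp
  ring

theorem boost_neg_boost (hc : 0 < c) (hac : ‖a‖ ^ 2 + c ^ 2 = 1) (z : ℝ) (y : V) :
    boost (-a) c z (boost a c z y) = y := by
  rw [boost, stretch_neg, slant_boost hc hac, stretch_apply, inner_boost hc hac, boost,
    stretch_apply]
  match_scalars
  · ring
  · field_simp
    ring

theorem bijective_boost (hc : 0 < c) (hac : ‖a‖ ^ 2 + c ^ 2 = 1) (z : ℝ) :
    Function.Bijective (boost a c z) := by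
  refine Function.bijective_iff_has_inverse.2 ⟨boost (-a) c z, boost_neg_boost hc hac z, ?_⟩
  simpa [Function.RightInverse, Function.LeftInverse] using
    boost_neg_boost hc (a := -a) (by simpa using hac) z

theorem slant_add_inner_boost (hc : 0 < c) (hac : ‖a‖ ^ 2 + c ^ 2 = 1) (z : ℝ) (y : V) :
    slant z (boost a c z y) + inner ℝ a (boost a c z y) = c * slant z y := by
  rw [slant_boost hc hac, inner_boost hc hac]
  field_simp
  ring

theorem hasFDerivAt_slant (hz : 0 < z) (y : V) :
    HasFDerivAt (slant z) ((1 / slant z y) • innerSL ℝ y) y := by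
  have hsq : HasFDerivAt (fun y : V => ‖y‖ ^ 2 + z ^ 2) (2 • innerSL ℝ y) y :=
    (hasStrictFDerivAt_norm_sq y).hasFDerivAt.add_const _
  refine (hsq.sqrt (by positivity)).congr_fderiv ?_
  ext v
  simp [slant]
  ring

theorem hasFDerivAt_boost (a : V) (c : ℝ) (hz : 0 < z) (y : V) :
    HasFDerivAt (boost a c z) (boostDeriv a c z y) y := by
  refine ((stretch a c).hasFDerivAt.sub
    (((hasFDerivAt_slant hz y).mul_const c⁻¹).smul_const a)).congr_fderiv ?_
  ext1 v
  simp only [boostDeriv, stretch, add_apply, sub_apply,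
    ContinuousLinearMap.smulRight_apply, smul_apply, smul_eq_mul,
    ContinuousLinearMap.id_apply, innerSL_apply_apply]
  match_scalars
  · ring
  · field_simp

theorem det_boostDeriv [FiniteDimensional ℝ V] (hc : 0 < c) (hac : ‖a‖ ^ 2 + c ^ 2 = 1)
    (hz : 0 < z) (y : V) : (boostDeriv a c z y).det = slant z (boost a c z y) / slant z y := by
  have hdet : (boostDeriv a c z y).det = _ := LinearMap.transvection.det (R := ℝ) (V := V)
    ((((1 / (c * (1 + c))) • innerSL ℝ a - (1 / (c * slant z y)) • innerSL ℝ y : V →L[ℝ] ℝ) :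
      V →ₗ[ℝ] ℝ)) a
  have hs := slant_pos hz y
  rw [hdet, slant_boost hc hac]
  simp only [ContinuousLinearMap.coe_coe, sub_apply,
    smul_apply, innerSL_apply_apply, smul_eq_mul, real_inner_self_eq_norm_sq,
    real_inner_comm y a]
  rw [show ‖a‖ ^ 2 = (1 - c) * (1 + c) by linarith, real_inner_comm a y]
  field_simp
  ring

theorem integral_slant_inv_smul_boost [FiniteDimensional ℝ V] [MeasurableSpace V] [BorelSpace V]
    {F : Type*} [NormedAddCommGroup F] [NormedSpace ℝ F] (hc : 0 < c)
    (hac : ‖a‖ ^ 2 + c ^ 2 = 1) (hz : 0 < z) (f : V → F) :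
    ∫ y, (slant z y)⁻¹ • f y = ∫ y, (slant z y)⁻¹ • f (boost a c z y) := by
  have hbij := bijective_boost hc hac z
  have h := integral_image_eq_integral_abs_det_fderiv_smul (volume : Measure V)
    MeasurableSet.univ (fun y _ => (hasFDerivAt_boost a c hz y).hasFDerivWithinAt)
    hbij.injective.injOn (fun y => (slant z y)⁻¹ • f y)
  rw [Set.image_univ, hbij.surjective.range_eq, setIntegral_univ, setIntegral_univ] at h
  refine h.trans (integral_congr_ae (.of_forall fun y => ?_))
  have hs := slant_pos hz y
  have hsb := slant_pos hz (boost a c z y)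
  dsimp only
  rw [det_boostDeriv hc hac hz, abs_of_pos (by positivity), smul_smul]
  congr 1
  field_simp

@[fun_prop]
theorem continuous_boost (a : V) (c z : ℝ) : Continuous (boost a c z) := by
  unfold boost
  fun_prop

/-- The length of the curves on which functions supported in the ball of radius `Q` live. -/
def ringLength (c Q ρ : ℝ) : ℝ := (2 * Q + 3 * ρ) / c

theorem ringLength_nonneg {Q ρ : ℝ} (hc : 0 < c) (hQ : 0 ≤ Q) (hρ : 0 ≤ ρ) :
    0 ≤ ringLength c Q ρ := by
  unfold ringLength
  positivity

theorem slant_le_ringLength {Q ρ : ℝ} {x y : V} (hc : 0 < c) (hac : ‖a‖ ^ 2 + c ^ 2 = 1)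
    (hx : ‖x‖ < ρ) (hz : z ∈ Set.Ioo 0 ρ) (hy : ‖x + boost a c z y‖ ≤ Q) :
    slant z y ≤ ringLength c Q ρ := by
  have hphase := slant_add_inner_boost hc hac z y
  set u := boost a c z y
  have hu : ‖u‖ ≤ Q + ρ := by
    have := norm_sub_le (x + u) x
    rw [add_sub_cancel_left] at this
    linarith
  have ha : ‖a‖ ≤ 1 := by nlinarith [sq_nonneg c, norm_nonneg a]
  have hinner : inner ℝ a u ≤ ‖u‖ :=
    (real_inner_le_norm a u).trans (mul_le_of_le_one_left (norm_nonneg _) ha)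
  rw [ringLength, le_div_iff₀ hc]
  linarith [hz.2, slant_le hz.1.le u]

end Boost

section PolarCoordinates

/-- The point of the unit circle with the polar angle `θ`. -/
def circlePt (θ : ℝ) : E2 :=
  Real.cos θ • EuclideanSpace.single 0 (1 : ℝ) + Real.sin θ • EuclideanSpace.single 1 (1 : ℝ)

theorem norm_circlePt (θ : ℝ) : ‖circlePt θ‖ = 1 := by
  rw [EuclideanSpace.norm_eq, Real.sqrt_eq_one]
  simp [circlePt, Fin.sum_univ_two]

theorem circlePt_add_pi (θ : ℝ) : circlePt (θ + Real.pi) = -circlePt θ := by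
  simp only [circlePt, Real.cos_add_pi, Real.sin_add_pi]
  module

theorem contDiff_circlePt : ContDiff ℝ ∞ circlePt := by
  unfold circlePt
  fun_prop

@[fun_prop]
theorem continuous_circlePt : Continuous circlePt := contDiff_circlePt.continuous

theorem norm_smul_circlePt (w θ : ℝ) : ‖w • circlePt θ‖ = |w| := by
  rw [norm_smul, norm_circlePt, mul_one, Real.norm_eq_abs]

theorem slant_smul_circlePt (z w θ : ℝ) : slant z (w • circlePt θ) = slant z w := by
  rw [slant, slant, norm_smul_circlePt, Real.norm_eq_abs]

variable {F : Type*} [NormedAddCommGroup F]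

theorem integrableOn_Ici_of_continuous_of_eq_zero {f : ℝ → F}
    {W : ℝ} (hf : Continuous f) (h : ∀ w, W < w → f w = 0) :
    IntegrableOn f (Set.Ici 0) := by
  refine IntegrableOn.of_forall_sdiff_eq_zero (s := Set.Icc 0 W)
    (hf.continuousOn.integrableOn_compact isCompact_Icc) measurableSet_Ici fun w hw => h w ?_
  by_contra! hle
  exact hw.2 ⟨hw.1, hle⟩

variable [NormedSpace ℝ F]

theorem integral_polar (H : E2 → F) :
    ∫ y, H y = ∫ v in Set.Ioi (0 : ℝ) ×ˢ Set.Ioo (-Real.pi) Real.pi,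
      v.1 • H (v.1 • circlePt v.2) := by
  have h := Complex.orthonormalBasisOneI.repr.measurePreserving.integral_comp
    Complex.orthonormalBasisOneI.repr.toHomeomorph.measurableEmbedding H
  rw [← h, ← Complex.integral_comp_polarCoord_symm]
  refine setIntegral_congr_fun (measurableSet_Ioi.prod measurableSet_Ioo) fun v _ => ?_
  have hrepr :
      Complex.orthonormalBasisOneI.repr (Complex.polarCoord.symm v) = v.1 • circlePt v.2 := by
    rw [Complex.polarCoord_symm_apply]
    ext i
    fin_cases i <;> simp [circlePt, Complex.orthonormalBasisOneI_repr_apply,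
      -Complex.ofReal_cos, -Complex.ofReal_sin]
  simp only [hrepr]

theorem integral_eq_integral_Ioi_integral_circle {H : E2 → F} {S : ℝ} (hH : Continuous H)
    (hS : ∀ y, S < ‖y‖ → H y = 0) :
    ∫ y, H y = ∫ w in Set.Ioi (0 : ℝ), ∫ θ in (-Real.pi)..Real.pi, w • H (w • circlePt θ) := by
  have hcont : Continuous fun v : ℝ × ℝ => v.1 • H (v.1 • circlePt v.2) := by fun_prop
  have hint : IntegrableOn (fun v : ℝ × ℝ => v.1 • H (v.1 • circlePt v.2))
      (Set.Ioi (0 : ℝ) ×ˢ Set.Ioo (-Real.pi) Real.pi) := by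
    refine IntegrableOn.of_forall_sdiff_eq_zero (s := Set.Icc 0 S ×ˢ Set.Icc (-Real.pi) Real.pi)
      (hcont.continuousOn.integrableOn_compact (isCompact_Icc.prod isCompact_Icc))
      (measurableSet_Ioi.prod measurableSet_Ioo) fun v hv => ?_
    rw [hS, smul_zero]
    rw [norm_smul_circlePt, abs_of_pos hv.1.1]
    by_contra! hle
    exact hv.2 ⟨⟨hv.1.1.le, hle⟩, Set.Ioo_subset_Icc_self hv.1.2⟩
  rw [integral_polar, Measure.volume_eq_prod, setIntegral_prod _ hint]
  refine setIntegral_congr_fun measurableSet_Ioi fun w _ => ?_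
  dsimp only
  rw [← integral_Ioc_eq_integral_Ioo,
    ← intervalIntegral.integral_of_le (by linarith [Real.pi_pos])]

theorem hasDerivAt_slant_real {z : ℝ} (hz : 0 < z) (w : ℝ) :
    HasDerivAt (slant z) (w / slant z w) w := by
  refine (hasFDerivAt_slant hz w).hasDerivAt.congr_deriv ?_
  simp
  ring

theorem integral_Ioi_smul_comp_slant_sub {G : ℝ → F} {S z : ℝ} (hG : Continuous G) (hS : 0 ≤ S)
    (hGS : ∀ σ, S < σ → G σ = 0) (hz : 0 < z) :
    ∫ w in Set.Ioi (0 : ℝ), (w / slant z w) • G (slant z w - z) = ∫ σ in 0..S, G σ := by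
  have hcont : Continuous fun w : ℝ => slant z w - z := by fun_prop
  have hbound (w : ℝ) : w ≤ slant z w := (le_abs_self w).trans (norm_le_slant z w)
  have hzero : slant z (0 : ℝ) - z = 0 := by simp [slant, Real.sqrt_sq hz.le]
  have hsubst := integral_deriv_smul_comp_Ioi (f := fun w : ℝ => slant z w - z)
    (f' := fun w => w / slant z w) (g := G) (a := 0) hcont.continuousOn
    (tendsto_atTop_mono (fun w => sub_le_sub_right (hbound w) z)
      (tendsto_atTop_add_const_right _ _ tendsto_id))
    (fun w _ => ((hasDerivAt_slant_real hz w).sub_const z).hasDerivWithinAt) hG.continuousOn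
    ((integrableOn_Ici_of_continuous_of_eq_zero hG hGS).mono_set ?_)
    (integrableOn_Ici_of_continuous_of_eq_zero (W := S + z) ?_ fun w hw => ?_)
  · refine hsubst.trans ?_
    rw [hzero, intervalIntegral.integral_of_le hS]
    refine setIntegral_eq_of_subset_of_forall_sdiff_eq_zero measurableSet_Ioi
      Set.Ioc_subset_Ioi_self fun σ hσ => hGS σ ?_
    by_contra! hle
    exact hσ.2 ⟨hσ.1, hle⟩
  · rintro _ ⟨w, -, rfl⟩
    exact sub_nonneg.2 (le_slant z w)
  · exact (continuous_id.div (continuous_slant z) fun w => (slant_pos hz w).ne').smul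
      (hG.comp hcont)
  · rw [Function.comp_apply, hGS _ (by linarith [hbound w]), smul_zero]

end PolarCoordinates

section RingMean

/-- The map `((s, y), w) ↦ y + w T e(θ)`, where `T` is the linear part of the boost. -/
def ellipsePt (a : E2) (c θ : ℝ) : RaySpace E2 →L[ℝ] E2 :=
  (ContinuousLinearMap.snd ℝ ℝ E2).comp (ContinuousLinearMap.fst ℝ (ℝ × E2) ℝ) +
    (ContinuousLinearMap.snd ℝ (ℝ × E2) ℝ).smulRight (stretch a c (circlePt θ))

/-- The integral of `g` over the ellipse with the centre `y` and the size `w`. -/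
def ringMean (a : E2) (c : ℝ) (g : E2 → ℂ) : RaySpace E2 → ℂ :=
  fun v => ∫ θ in (-Real.pi)..Real.pi, g (ellipsePt a c θ v)

theorem ellipsePt_apply (a : E2) (c θ : ℝ) (v : RaySpace E2) :
    ellipsePt a c θ v = v.1.2 + v.2 • stretch a c (circlePt θ) := rfl

theorem contDiff_ellipsePt (a : E2) (c : ℝ) :
    ContDiff ℝ ∞ fun v : RaySpace E2 × ℝ => ellipsePt a c v.2 v.1 := by
  have := contDiff_circlePt
  simp only [ellipsePt_apply]
  fun_prop

theorem norm_stretch_circlePt_le (a : E2) (c θ : ℝ) :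
    ‖stretch a c (circlePt θ)‖ ≤ ‖stretch a c‖ := by
  simpa [norm_circlePt] using (stretch a c).le_opNorm (circlePt θ)

theorem norm_ellipsePt_le (a : E2) (c θ : ℝ) : ‖ellipsePt a c θ‖ ≤ 1 + ‖stretch a c‖ := by
  refine ContinuousLinearMap.opNorm_le_bound _ (by positivity) fun v => ?_
  calc ‖ellipsePt a c θ v‖ ≤ ‖v.1.2‖ + ‖v.2‖ * ‖stretch a c (circlePt θ)‖ := by
        rw [ellipsePt_apply, ← norm_smul]
        exact norm_add_le _ _
    _ ≤ ‖v‖ + ‖v‖ * ‖stretch a c‖ := by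
        gcongr
        · exact (norm_snd_le v.1).trans (norm_fst_le v)
        · exact norm_snd_le v
        · exact norm_stretch_circlePt_le a c θ
    _ = (1 + ‖stretch a c‖) * ‖v‖ := by ring

theorem IsSymbol.ringMean {δ N : ℝ} {g : ℝ → E2 → ℂ} (hg : IsSymbol δ Set.univ N g) (a : E2)
    (c T : ℝ) : IsSymbol δ (strip E2 T) N (fun k => ringMean a c (g k)) :=
  hg.integral_comp (ellipsePt a c) (contDiff_ellipsePt a c)
    (fun θ _ => norm_ellipsePt_le a c θ) (fun _ _ _ _ => Set.mem_univ _)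

theorem contDiff_ringMean (a : E2) (c : ℝ) {g : E2 → ℂ} (hg : ContDiff ℝ ∞ g) :
    ContDiff ℝ ∞ (ringMean a c g) :=
  contDiff_integral_of_contDiff (hg.comp (contDiff_ellipsePt a c)) _ _

theorem continuous_ringMean (a : E2) (c : ℝ) {g : E2 → ℂ} (hg : Continuous g) :
    Continuous (ringMean a c g) :=
  intervalIntegral.continuous_parametric_intervalIntegral_of_continuous'
    (f := fun (v : RaySpace E2) (θ : ℝ) => g (ellipsePt a c θ v))
    (hg.comp (contDiff_ellipsePt a c).continuous) _ _

theorem isEven_ringMean (a : E2) (c : ℝ) (g : E2 → ℂ) : IsEven (ringMean a c g) := by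
  intro v
  set f : ℝ → ℂ := fun θ => g (ellipsePt a c θ v) with hf
  have hperiodic : Function.Periodic f (2 * Real.pi) := fun θ => by
    simp only [hf, ellipsePt_apply]
    rw [two_mul, ← add_assoc, circlePt_add_pi, circlePt_add_pi, neg_neg]
  have hshift := hperiodic.intervalIntegral_add_eq 0 (-Real.pi)
  rw [zero_add, two_mul, neg_add_cancel_left] at hshift
  calc ringMean a c g (scaleRadius (-1) v)
      = ∫ θ in (-Real.pi)..Real.pi, f (θ + Real.pi) :=
        intervalIntegral.integral_congr fun θ _ => by
          simp [hf, ellipsePt_apply, scaleRadius_apply, circlePt_add_pi]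
    _ = ringMean a c g v := by
        rw [intervalIntegral.integral_comp_add_right, neg_add_cancel, hshift, ringMean]

theorem ringMean_eventuallyEq_const {a : E2} {c : ℝ} {g : E2 → ℂ} {y : ℝ × E2} {u : ℂ}
    (h : g =ᶠ[𝓝 y.2] fun _ => u) :
    ringMean a c g =ᶠ[𝓝 (y, 0)] fun _ => 2 * Real.pi * u := by
  obtain ⟨ε, hε, hball⟩ := Metric.eventually_nhds_iff.1 h
  have hcont : ContinuousAt (fun v : RaySpace E2 => ‖v.1.2 - y.2‖ + |v.2| * ‖stretch a c‖)
      (y, 0) := by fun_prop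
  filter_upwards [hcont.eventually_lt continuousAt_const (g := fun _ => ε) (by simpa using hε)]
    with v hv
  have hconst (θ : ℝ) : g (ellipsePt a c θ v) = u := by
    refine hball ?_
    calc dist (ellipsePt a c θ v) y.2
        ≤ ‖v.1.2 - y.2‖ + |v.2| * ‖stretch a c (circlePt θ)‖ := by
          rw [dist_eq_norm, ellipsePt_apply, add_sub_right_comm, ← Real.norm_eq_abs, ← norm_smul]
          exact norm_add_le _ _
      _ ≤ ‖v.1.2 - y.2‖ + |v.2| * ‖stretch a c‖ := by
          gcongr
          exact norm_stretch_circlePt_le a c θ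
      _ < ε := hv
  simp only [ringMean, hconst, intervalIntegral.integral_const, Complex.real_smul]
  push_cast
  ring

end RingMean

section Formula

variable {a : E2} {c z Q ρ : ℝ} {x : E2} {g : E2 → ℂ}

theorem slant_sqrt_smul_circlePt {σ : ℝ} (hz : 0 ≤ z) (hσ : 0 ≤ σ) (θ : ℝ) :
    slant z (√(σ * (σ + 2 * z)) • circlePt θ) = z + σ := by
  rw [slant_smul_circlePt, slant, Real.norm_eq_abs, sq_abs, Real.sq_sqrt (by positivity),
    show σ * (σ + 2 * z) + z ^ 2 = (z + σ) ^ 2 by ring, Real.sqrt_sq (by positivity)]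

theorem ellipsePt_ringPoint {σ : ℝ} (hz : 0 ≤ z) (hσ : 0 ≤ σ) (a : E2) (c θ : ℝ) (x : E2) :
    ellipsePt a c θ (ringPoint (c⁻¹ • a) x z σ) =
      x + boost a c z (√(σ * (σ + 2 * z)) • circlePt θ) := by
  rw [boost, slant_sqrt_smul_circlePt hz hσ, ellipsePt_apply, ringPoint, map_smul, smul_smul,
    div_eq_mul_inv, sub_add_eq_add_sub, add_sub_assoc]

theorem sqrt_slant_sub_mul (z : ℝ) {w : ℝ} (hw : 0 ≤ w) :
    √((slant z w - z) * (slant z w - z + 2 * z)) = w := by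
  have hsq : (slant z w - z) * (slant z w - z + 2 * z) = w ^ 2 := by
    have := slant_sq z w
    rw [Real.norm_eq_abs, sq_abs] at this
    linarith
  rw [hsq, Real.sqrt_sq hw]

theorem ringMean_ringPoint_eq_zero (hc : 0 < c) (hac : ‖a‖ ^ 2 + c ^ 2 = 1) (hQ₀ : 0 ≤ Q)
    (hQ : ∀ q, Q < ‖q‖ → g q = 0) (hx : ‖x‖ < ρ) (hz : z ∈ Set.Ioo 0 ρ) {σ : ℝ}
    (hσ : ringLength c Q ρ < σ) : ringMean a c g (ringPoint (c⁻¹ • a) x z σ) = 0 := by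
  have hσ₀ : 0 ≤ σ := (ringLength_nonneg hc hQ₀ (hz.1.trans hz.2).le).trans hσ.le
  have hzero (θ : ℝ) : g (ellipsePt a c θ (ringPoint (c⁻¹ • a) x z σ)) = 0 := by
    rw [ellipsePt_ringPoint hz.1.le hσ₀]
    refine hQ _ (not_le.1 fun hle => ?_)
    have := slant_le_ringLength hc hac hx hz hle
    rw [slant_sqrt_smul_circlePt hz.1.le hσ₀] at this
    linarith [hz.1]
  simp only [ringMean, hzero, intervalIntegral.integral_zero]

theorem integral_boosted_eq_ringIntegral (hc : 0 < c) (hac : ‖a‖ ^ 2 + c ^ 2 = 1)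
    (hg : Continuous g) (hQ₀ : 0 ≤ Q) (hQ : ∀ q, Q < ‖q‖ → g q = 0) (κ : ℝ) (hx : ‖x‖ < ρ)
    (hz : z ∈ Set.Ioo 0 ρ) :
    ∫ y, (slant z y)⁻¹ • (expI (κ * slant z y) * g (x + boost a c z y)) =
      ringIntegral κ (ringLength c Q ρ + 1) (c⁻¹ • a) (ringMean a c g) x z := by
  set G : ℝ → ℂ := ringIntegrand κ (c⁻¹ • a) (ringMean a c g) x z
  have hG : Continuous G := continuous_ringIntegrand_right κ _ (continuous_ringMean a c hg) x z
  have hS := ringLength_nonneg hc hQ₀ (hz.1.trans hz.2).le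
  have hcont : Continuous fun y : E2 =>
      (slant z y)⁻¹ • (expI (κ * slant z y) * g (x + boost a c z y)) :=
    ((continuous_slant z).inv₀ fun y => (slant_pos hz.1 y).ne').smul (by fun_prop)
  have hring : ∀ w ∈ Set.Ioi (0 : ℝ), (∫ θ in (-Real.pi)..Real.pi, w •
      (slant z (w • circlePt θ))⁻¹ • (expI (κ * slant z (w • circlePt θ)) *
        g (x + boost a c z (w • circlePt θ)))) = (w / slant z w) • G (slant z w - z) :=
    fun w hw => by
      have hpt (θ : ℝ) := ellipsePt_ringPoint hz.1.le (sub_nonneg.2 (le_slant z w)) a c θ x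
      simp only [sqrt_slant_sub_mul z (le_of_lt hw)] at hpt
      simp only [G, ringIntegrand, ringMean, hpt, slant_smul_circlePt, smul_smul,
        intervalIntegral.integral_smul, intervalIntegral.integral_const_mul, div_eq_mul_inv,
        add_sub_cancel]
  rw [integral_eq_integral_Ioi_integral_circle (S := ringLength c Q ρ) hcont fun y hy => ?_,
    setIntegral_congr_fun measurableSet_Ioi hring,
    integral_Ioi_smul_comp_slant_sub (S := ringLength c Q ρ + 1) hG (by linarith)
      (fun σ hσ => ?_) hz.1, ringIntegral]
  · simp only [G, ringIntegrand]
    rw [ringMean_ringPoint_eq_zero hc hac hQ₀ hQ hx hz (by linarith), mul_zero]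
  · rw [hQ, mul_zero, smul_zero]
    exact not_le.1 fun hle => (hy.trans_le (norm_le_slant z y)).not_ge
      (slant_le_ringLength hc hac hx hz hle)

theorem integral_wave_eq_ringIntegral (hc : 0 < c) (hac : ‖a‖ ^ 2 + c ^ 2 = 1)
    (hg : Continuous g) (hQ₀ : 0 ≤ Q) (hQ : ∀ q, Q < ‖q‖ → g q = 0) (k : ℝ) (hx : ‖x‖ < ρ)
    (hz : z ∈ Set.Ioo 0 ρ) :
    ∫ q, g q * expI (k * inner ℝ a q) * (expI (k * slant z (x - q)) / (slant z (x - q) : ℝ)) =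
      expI (k * inner ℝ a x) *
        ringIntegral (k * c) (ringLength c Q ρ + 1) (c⁻¹ • a) (ringMean a c g) x z := by
  rw [← integral_boosted_eq_ringIntegral hc hac hg hQ₀ hQ (k * c) hx hz, ← integral_const_mul,
    ← integral_add_left_eq_self _ x]
  have hphase (y : E2) : expI (k * inner ℝ a (x + boost a c z y)) *
      expI (k * slant z (boost a c z y)) = expI (k * inner ℝ a x) * expI (k * c * slant z y) := by
    rw [← expI_add, ← expI_add, inner_add_right]
    congr 1
    linear_combination k * slant_add_inner_boost hc hac z y
  calc _ = ∫ y, (slant z y)⁻¹ • (g (x + y) * (expI (k * inner ℝ a (x + y)) *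
        expI (k * slant z y))) := by
        refine integral_congr_ae (.of_forall fun y => ?_)
        have : slant z (x - (x + y)) = slant z y := by simp [slant]
        simp only [this, Complex.real_smul, Complex.ofReal_inv]
        ring
    _ = _ := by
        rw [integral_slant_inv_smul_boost hc hac hz.1
          fun y => g (x + y) * (expI (k * inner ℝ a (x + y)) * expI (k * slant z y))]
        refine integral_congr_ae (.of_forall fun y => ?_)
        simp only [hphase, Complex.real_smul]
        ring

end Formula

section PuncturedKernels

theorem sub_ne_zero_of_notMem_image {W E : Type*} [AddGroup E] {τ : W → E} {A : Set W} {r : E}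
    (hr : r ∉ τ '' A) {q : W} (hq : q ∈ A) : r - τ q ≠ 0 :=
  fun h => hr ⟨q, hq, (sub_eq_zero.1 h).symm⟩

variable {W E : Type*} [TopologicalSpace W] [NormedAddCommGroup E] {τ : W → E} {K : E → ℂ}
  {G : W → ℂ} {r : E}

theorem isOpen_compl_image_tsupport (hτ : Continuous τ) (hGc : HasCompactSupport G) :
    IsOpen (τ '' tsupport G)ᶜ :=
  (hGc.isCompact.image hτ).isClosed.isOpen_compl

theorem exists_bound_kernel [ProperSpace E] {F : Type*} [NormedAddCommGroup F] {K : E → F}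
    (hτ : Continuous τ) (hGc : HasCompactSupport G) (hK : ContinuousOn K {0}ᶜ) {ε : ℝ}
    (hε : Metric.closedBall r ε ⊆ (τ '' tsupport G)ᶜ) :
    ∃ B, ∀ r' ∈ Metric.closedBall r ε, ∀ q ∈ tsupport G, ‖K (r' - τ q)‖ ≤ B := by
  have hcomp : IsCompact
      ((fun v : E × W => v.1 - τ v.2) '' (Metric.closedBall r ε ×ˢ tsupport G)) :=
    ((isCompact_closedBall r ε).prod hGc.isCompact).image (by fun_prop)
  obtain ⟨B, hB⟩ := hcomp.exists_bound_of_continuousOn (hK.mono (by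
    rintro _ ⟨v, ⟨h1, h2⟩, rfl⟩
    exact sub_ne_zero_of_notMem_image (hε h1) h2))
  exact ⟨B, fun r' hr' q hq => hB _ ⟨(r', q), ⟨hr', hq⟩, rfl⟩⟩

variable [NormedSpace ℝ E]

theorem differentiableAt_of_contDiffOn_compl_zero (hK : ContDiffOn ℝ ∞ K {0}ᶜ) {v : E}
    (hv : v ≠ 0) : DifferentiableAt ℝ K v :=
  (hK.differentiableOn (by simp)).differentiableAt (isOpen_compl_singleton.mem_nhds hv)

theorem contDiffOn_dirDeriv_compl_zero (hK : ContDiffOn ℝ ∞ K {0}ᶜ) (v : E) :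
    ContDiffOn ℝ ∞ (dirDeriv v K) {0}ᶜ :=
  (hK.fderiv_of_isOpen isOpen_compl_singleton (m := ∞) (by simp)).clm_apply contDiffOn_const

theorem continuousOn_fderiv_compl_zero (hK : ContDiffOn ℝ ∞ K {0}ᶜ) :
    ContinuousOn (fderiv ℝ K) {0}ᶜ :=
  hK.continuousOn_fderiv_of_isOpen isOpen_compl_singleton (by simp)

theorem hasFDerivAt_mul_kernel (hK : ContDiffOn ℝ ∞ K {0}ᶜ) (hr : r ∉ τ '' tsupport G) (q : W) :
    HasFDerivAt (fun r => G q * K (r - τ q)) (G q • fderiv ℝ K (r - τ q)) r := by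
  by_cases hq : q ∈ tsupport G
  · exact ((differentiableAt_of_contDiffOn_compl_zero hK
      (sub_ne_zero_of_notMem_image hr hq)).hasFDerivAt.comp r
        ((hasFDerivAt_id r).sub_const (τ q))).const_mul (G q)
  · simp only [image_eq_zero_of_notMem_tsupport hq, zero_mul]
    refine (hasFDerivAt_const (0 : ℂ) r).congr_fderiv ?_
    ext
    simp

end PuncturedKernels

section Layer

/-- The potential with kernel `K` and density `G` on the image of `τ`. -/
def layer {W E : Type*} [MeasureSpace W] [AddGroup E] (τ : W → E) (K : E → ℂ) (G : W → ℂ)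
    (r : E) : ℂ := ∫ q, G q * K (r - τ q)

variable {W E : Type*} [TopologicalSpace W] [MeasureSpace W] [OpensMeasurableSpace W]
  [IsFiniteMeasureOnCompacts (volume : Measure W)] [NormedAddCommGroup E] {τ : W → E}
  {G : W → ℂ} {r : E}

theorem integrable_smul_kernel {F : Type*} [NormedAddCommGroup F] [NormedSpace ℂ F] {K : E → F}
    (hτ : Continuous τ) (hG : Continuous G) (hGc : HasCompactSupport G)
    (hK : ContinuousOn K {0}ᶜ) (hr : r ∉ τ '' tsupport G) :
    Integrable fun q => G q • K (r - τ q) := by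
  have hcont : Continuous fun q => G q • K (r - τ q) := by
    refine continuous_of_tsupport fun q hq => hG.continuousAt.smul ?_
    have hne := sub_ne_zero_of_notMem_image hr (tsupport_smul_subset_left G _ hq)
    exact (hK.continuousAt (isOpen_compl_singleton.mem_nhds hne)).comp_of_eq
      (continuousAt_const.sub hτ.continuousAt) rfl
  exact hcont.integrable_of_hasCompactSupport (hGc.smul_right)

variable [NormedSpace ℝ E] [ProperSpace E] {K : E → ℂ}

theorem hasFDerivAt_layer (hτ : Continuous τ) (hG : Continuous G)
    (hGc : HasCompactSupport G) (hK : ContDiffOn ℝ ∞ K {0}ᶜ) (hr : r ∉ τ '' tsupport G) :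
    HasFDerivAt (layer τ K G) (∫ q, G q • fderiv ℝ K (r - τ q)) r := by
  have hK' := continuousOn_fderiv_compl_zero hK
  have hnhds := (isOpen_compl_image_tsupport hτ hGc).mem_nhds hr
  obtain ⟨ε, hε, hball⟩ := Metric.nhds_basis_closedBall.mem_iff.1 hnhds
  obtain ⟨B, hB⟩ := exists_bound_kernel hτ hGc hK' hball
  refine hasFDerivAt_integral_of_dominated_of_fderiv_le (bound := fun q => ‖G q‖ * B)
    (F := fun r q => G q * K (r - τ q)) (F' := fun r q => G q • fderiv ℝ K (r - τ q))
    (Metric.ball_mem_nhds r hε) ?_ (integrable_smul_kernel hτ hG hGc hK.continuousOn hr)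
    (integrable_smul_kernel hτ hG hGc hK' hr).aestronglyMeasurable
    (.of_forall fun q r' hr' => ?_)
    ((hG.norm.integrable_of_hasCompactSupport hGc.norm).mul_const B)
    (.of_forall fun q r' hr' =>
      hasFDerivAt_mul_kernel hK (hball (Metric.ball_subset_closedBall hr')) q)
  · filter_upwards [hnhds] with r' hr'
    exact (integrable_smul_kernel hτ hG hGc hK.continuousOn hr').aestronglyMeasurable
  · rw [norm_smul]
    by_cases hq : q ∈ tsupport G
    · have := hB r' (Metric.ball_subset_closedBall hr') q hq
      gcongr
    · simp [image_eq_zero_of_notMem_tsupport hq]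

theorem fderiv_layer_apply (hτ : Continuous τ) (hG : Continuous G)
    (hGc : HasCompactSupport G) (hK : ContDiffOn ℝ ∞ K {0}ᶜ) (hr : r ∉ τ '' tsupport G) (v : E) :
    fderiv ℝ (layer τ K G) r v = layer τ (dirDeriv v K) G r := by
  rw [(hasFDerivAt_layer hτ hG hGc hK hr).fderiv, ContinuousLinearMap.integral_apply
    (integrable_smul_kernel hτ hG hGc (continuousOn_fderiv_compl_zero hK) hr)]
  rfl

end Layer

theorem layer_dirDeriv_tangent {W E : Type*} [NormedAddCommGroup W] [NormedSpace ℝ W]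
    [FiniteDimensional ℝ W] [MeasureSpace W] [BorelSpace W]
    [(volume : Measure W).IsAddHaarMeasure] [NormedAddCommGroup E] [NormedSpace ℝ E]
    (τ : W →ᴬ[ℝ] E) {K : E → ℂ} {G : W → ℂ} {r : E} (hG : ContDiff ℝ ∞ G)
    (hGc : HasCompactSupport G) (hK : ContDiffOn ℝ ∞ K {0}ᶜ) (hr : r ∉ τ '' tsupport G) (e : W) :
    layer τ (dirDeriv (τ.contLinear e) K) G r = layer τ K (dirDeriv e G) r := by
  have hd : ∀ q ∈ tsupport G, HasFDerivAt (fun q => K (r - τ q))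
      ((fderiv ℝ K (r - τ q)).comp (-τ.contLinear)) q := fun q hq =>
    (differentiableAt_of_contDiffOn_compl_zero hK
      (sub_ne_zero_of_notMem_image hr hq)).hasFDerivAt.comp q (τ.hasFDerivAt.const_sub r)
  have hkernel : ∀ q, G q * fderiv ℝ (fun q => K (r - τ q)) q e =
      -(G q * dirDeriv (τ.contLinear e) K (r - τ q)) := fun q => by
    by_cases hq : q ∈ tsupport G
    · rw [(hd q hq).fderiv]
      simp [dirDeriv]
    · simp [image_eq_zero_of_notMem_tsupport hq]
  have hsub : tsupport (dirDeriv e G) ⊆ tsupport G := tsupport_fderiv_apply_subset ℝ e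
  have hint : Integrable fun q => G q * dirDeriv (τ.contLinear e) K (r - τ q) :=
    integrable_smul_kernel τ.cont hG.continuous hGc
      (contDiffOn_dirDeriv_compl_zero hK _).continuousOn hr
  have hparts := integral_mul_fderiv_eq_neg_fderiv_mul_of_integrable (μ := volume) (f := G)
    (g := fun q => K (r - τ q)) (v := e)
    (integrable_smul_kernel τ.cont (contDiff_dirDeriv hG e).continuous (hGc.fderiv_apply ℝ e)
      hK.continuousOn fun h => hr (Set.image_mono hsub h))
    (by simp only [hkernel]; exact hint.neg)
    (integrable_smul_kernel τ.cont hG.continuous hGc hK.continuousOn hr)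
    (fun q _ => hG.differentiable (by simp) q) (fun q hq => (hd q hq).differentiableAt)
  simp only [hkernel, integral_neg, neg_inj] at hparts
  exact hparts

section SphericalKernel

/-- The outgoing spherical wave with source at the origin. -/
def sphericalKernel {E : Type*} [NormedAddCommGroup E] (k : ℝ) (v : E) : ℂ :=
  expI (k * ‖v‖) / (‖v‖ : ℝ)

theorem contDiffOn_sphericalKernel {E : Type*} [NormedAddCommGroup E] [InnerProductSpace ℝ E]
    (k : ℝ) : ContDiffOn ℝ ∞ (sphericalKernel k : E → ℂ) {0}ᶜ := fun v hv => by
  have hnorm : ContDiffAt ℝ ∞ (fun v : E => ‖v‖) v := contDiffAt_norm ℝ hv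
  have hnum : ContDiffAt ℝ ∞ (fun v : E => expI (k * ‖v‖)) v :=
    contDiff_expI.contDiffAt.comp v (contDiffAt_const.mul hnorm)
  have hden : ContDiffAt ℝ ∞ (fun v : E => ((‖v‖ : ℝ) : ℂ)⁻¹) v :=
    (Complex.ofRealCLM.contDiff.contDiffAt.comp v hnorm).inv
      (Complex.ofReal_ne_zero.2 (norm_ne_zero_iff.2 hv))
  exact (hnum.mul hden).contDiffWithinAt

theorem fderiv_sphericalWave (k : ℝ) (r p n : E3) :
    fderiv ℝ (sphericalWave k r) p n = -dirDeriv n (sphericalKernel k) (r - p) := by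
  have hneg := (ContinuousLinearEquiv.neg ℝ (M := E3)).comp_right_fderiv
    (f := sphericalKernel k) (x := p - r)
  have h : sphericalWave k r = fun p =>
      (sphericalKernel k ∘ ContinuousLinearEquiv.neg ℝ) (p - r) := by
    ext1 p
    simp only [Function.comp_apply, ContinuousLinearEquiv.neg_apply, neg_sub]
    rfl
  rw [h, fderiv_comp_sub, hneg]
  simp [dirDeriv]

end SphericalKernel

section OrthonormalBasis

variable {ι E F : Type*} [Fintype ι] [NormedAddCommGroup E] [InnerProductSpace ℝ E]
  [NormedAddCommGroup F] [NormedSpace ℝ F]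

theorem opNorm_le_sum_orthonormalBasis (b : OrthonormalBasis ι ℝ E) (U : E →L[ℝ] F) :
    ‖U‖ ≤ ∑ i, ‖U (b i)‖ := by
  refine U.opNorm_le_bound (by positivity) fun v => ?_
  conv_lhs => rw [← b.sum_repr' v]
  rw [map_sum, Finset.sum_mul]
  refine (norm_sum_le _ _).trans (Finset.sum_le_sum fun i _ => ?_)
  have hcoord : ‖inner ℝ (b i) v‖ ≤ ‖v‖ := by simpa using norm_inner_le_norm (𝕜 := ℝ) (b i) v
  rw [map_smul, norm_smul, mul_comm]
  gcongr

theorem exists_tendsto_of_orthonormalBasis (b : OrthonormalBasis ι ℝ E) {X : Type*}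
    {f : X → E →L[ℝ] F} {l : Filter X} (h : ∀ i, ∃ u, Tendsto (fun x => f x (b i)) l (𝓝 u)) :
    ∃ U, Tendsto f l (𝓝 U) := by
  choose u hu using h
  have hf : ∀ x, f x = ∑ i, (innerSL ℝ (b i)).smulRight (f x (b i)) := fun x => by
    ext v
    conv_lhs => rw [← b.sum_repr' v]
    simp
  refine ⟨∑ i, (innerSL ℝ (b i)).smulRight (u i), Tendsto.congr (fun x => (hf x).symm) ?_⟩
  exact tendsto_finsetSum _ fun i _ =>
    ((ContinuousLinearMap.smulRightL ℝ E F (innerSL ℝ (b i))).continuous.tendsto _).comp (hu i)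

end OrthonormalBasis

section Frame

/-- The tangential part of a vector, in the coordinates of the plane of `τ`. -/
def tangentPart (τ : E2 →ᵃⁱ[ℝ] E3) : E3 →L[ℝ] E2 :=
  ContinuousLinearMap.adjoint τ.linearIsometry.toContinuousLinearMap

/-- The foot in the plane of `τ` of the perpendicular from `r`, in the coordinates of `τ`. -/
def foot (τ : E2 →ᵃⁱ[ℝ] E3) (r : E3) : E2 := tangentPart τ (r - τ 0)

/-- The signed height of `r` over the plane of `τ` with unit normal `ν`. -/
def height (τ : E2 →ᵃⁱ[ℝ] E3) (ν r : E3) : ℝ := inner ℝ ν (r - τ 0)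

/-- `ν` is a unit normal of the plane of `τ`. -/
structure IsUnitNormal (τ : E2 →ᵃⁱ[ℝ] E3) (ν : E3) : Prop where
  norm_eq_one : ‖ν‖ = 1
  inner_linear : ∀ v : E2, inner ℝ ν (τ.linearIsometry v) = 0

variable {τ : E2 →ᵃⁱ[ℝ] E3} {ν : E3}

theorem affineIsometry_apply (τ : E2 →ᵃⁱ[ℝ] E3) (q : E2) : τ q = τ.linearIsometry q + τ 0 := by
  simpa using τ.map_vadd 0 q

theorem inner_tangentPart (τ : E2 →ᵃⁱ[ℝ] E3) (w : E3) (v : E2) :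
    inner ℝ (tangentPart τ w) v = inner ℝ w (τ.linearIsometry v) :=
  ContinuousLinearMap.adjoint_inner_left _ _ _

theorem continuous_foot (τ : E2 →ᵃⁱ[ℝ] E3) : Continuous (foot τ) := by
  unfold foot
  fun_prop

theorem continuous_height (τ : E2 →ᵃⁱ[ℝ] E3) (ν : E3) : Continuous (height τ ν) := by
  unfold height
  fun_prop

namespace IsUnitNormal

variable (h : IsUnitNormal τ ν)
include h

protected theorem neg : IsUnitNormal τ (-ν) where
  norm_eq_one := by rw [norm_neg, h.norm_eq_one]
  inner_linear v := by rw [inner_neg_left, h.inner_linear, neg_zero]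

theorem orthonormal : Orthonormal ℝ
    ![τ.linearIsometry (EuclideanSpace.single 0 1), τ.linearIsometry (EuclideanSpace.single 1 1),
      ν] := by
  have hsymm : ∀ v : E2, inner ℝ (τ.linearIsometry v) ν = 0 := fun v => by
    rw [real_inner_comm, h.inner_linear]
  rw [orthonormal_iff_ite]
  intro i j
  fin_cases i <;> fin_cases j <;>
    simp [h.inner_linear, hsymm, h.norm_eq_one, EuclideanSpace.inner_single_left]

/-- An orthonormal basis of the space that consists of two tangent vectors of the plane of `τ`
and its unit normal `ν`. -/
def basis : OrthonormalBasis (Fin 3) ℝ E3 :=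
  (basisOfOrthonormalOfCardEqFinrank h.orthonormal (by simp)).toOrthonormalBasis
    (by simpa using h.orthonormal)

theorem basis_induction {P : E3 → Prop} (tangent : ∀ e : E2, P (τ.linearIsometry e))
    (normal : P ν) (i : Fin 3) : P (h.basis i) := by
  fin_cases i <;> simp [basis, tangent, normal]

theorem foot_apply (x : E2) (z : ℝ) : foot τ (τ x + z • ν) = x := by
  refine ext_inner_right ℝ fun v => ?_
  rw [foot, inner_tangentPart, affineIsometry_apply τ x, add_right_comm,
    add_sub_cancel_right, inner_add_left, inner_smul_left, h.inner_linear,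
    τ.linearIsometry.inner_map_map, mul_zero, add_zero]

theorem height_apply (x : E2) (z : ℝ) : height τ ν (τ x + z • ν) = z := by
  rw [height, affineIsometry_apply τ x, add_right_comm, add_sub_cancel_right, inner_add_right,
    h.inner_linear, inner_smul_right, real_inner_self_eq_norm_sq, h.norm_eq_one]
  ring

theorem linear_tangentPart_add (w : E3) :
    τ.linearIsometry (tangentPart τ w) + inner ℝ ν w • ν = w := by
  refine InnerProductSpace.ext_inner_left_basis h.basis.toBasis fun i => ?_
  rw [OrthonormalBasis.coe_toBasis]
  refine h.basis_induction (P := fun b => inner ℝ b (_ + _) = inner ℝ b w) (fun e => ?_) ?_ i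
  · rw [inner_add_right, τ.linearIsometry.inner_map_map, real_inner_comm, inner_tangentPart,
      inner_smul_right, real_inner_comm ν, h.inner_linear, mul_zero, add_zero, real_inner_comm]
  · rw [inner_add_right, h.inner_linear, inner_smul_right, real_inner_self_eq_norm_sq,
      h.norm_eq_one]
    ring

theorem norm_tangentPart_sq_add (w : E3) :
    ‖tangentPart τ w‖ ^ 2 + inner ℝ ν w ^ 2 = ‖w‖ ^ 2 := by
  conv_rhs => rw [← h.linear_tangentPart_add w]
  rw [norm_add_sq_real, inner_smul_right, real_inner_comm ν (τ.linearIsometry _), h.inner_linear,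
    norm_smul, h.norm_eq_one, τ.linearIsometry.norm_map, mul_one, Real.norm_eq_abs, sq_abs]
  ring

theorem foot_add_height (r : E3) : τ (foot τ r) + height τ ν r • ν = r := by
  rw [affineIsometry_apply, add_right_comm, foot, height, h.linear_tangentPart_add, sub_add_cancel]

theorem notMem_image {x : E2} {z : ℝ} (hz : z ≠ 0) (A : Set E2) : τ x + z • ν ∉ τ '' A := by
  rintro ⟨q, -, hq⟩
  have hheight := congrArg (height τ ν) hq
  rw [h.height_apply, ← add_zero (τ q), ← zero_smul ℝ ν, h.height_apply] at hheight
  exact hz hheight.symm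

theorem norm_sub_eq_slant (x q : E2) (z : ℝ) : ‖τ x + z • ν - τ q‖ = slant z (x - q) := by
  have hsplit : τ x + z • ν - τ q = τ.linearIsometry (x - q) + z • ν := by
    rw [affineIsometry_apply τ q, affineIsometry_apply τ x, map_sub]
    abel
  rw [hsplit, slant, ← Real.sqrt_sq (norm_nonneg (_ + _)), norm_add_sq_real, inner_smul_right,
    real_inner_comm, h.inner_linear, norm_smul, h.norm_eq_one, τ.linearIsometry.norm_map]
  simp

end IsUnitNormal

end Frame

section PhasedWave

/-- The plane wave with direction `d` and phase shift `t`. -/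
def phasedWave {E : Type*} [NormedAddCommGroup E] [InnerProductSpace ℝ E] (k : ℝ) (d : E) (t : ℝ)
    (r : E) : ℂ := expI (k * (inner ℝ d r + t))

variable {E : Type*} [NormedAddCommGroup E] [InnerProductSpace ℝ E]

theorem norm_phasedWave (k : ℝ) (d : E) (t : ℝ) (r : E) : ‖phasedWave k d t r‖ = 1 := norm_expI _

theorem phasedWave_add (k : ℝ) (d : E) (t : ℝ) (r v : E) :
    phasedWave k d t (r + v) = phasedWave k d t r * expI (k * inner ℝ d v) := by
  rw [phasedWave, phasedWave, ← expI_add, inner_add_right]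
  ring_nf

theorem contDiff_phasedWave (k : ℝ) (d : E) (t : ℝ) : ContDiff ℝ ∞ (phasedWave k d t) :=
  contDiff_expI.comp (contDiff_const.mul ((innerSL ℝ d).contDiff.add contDiff_const))

theorem fderiv_phasedWave_apply (k : ℝ) (d : E) (t : ℝ) (r v : E) :
    fderiv ℝ (phasedWave k d t) r v =
      Complex.I * (k * inner ℝ d v : ℝ) * phasedWave k d t r := by
  have hphase : HasDerivAt (fun s : ℝ => k * (inner ℝ d (r + s • v) + t)) (k * inner ℝ d v) 0 := by
    simp only [inner_add_right, inner_smul_right]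
    simpa using ((((hasDerivAt_id (0 : ℝ)).mul_const (inner ℝ d v)).const_add
      (inner ℝ d r)).add_const t).const_mul k
  have hline : HasDerivAt (fun s : ℝ => r + s • v) v 0 := by
    simpa using ((hasDerivAt_id (0 : ℝ)).smul_const v).const_add r
  have hd : DifferentiableAt ℝ (phasedWave k d t) r :=
    (contDiff_phasedWave k d t).differentiable (by simp) r
  have := (hd.hasFDerivAt.comp_hasDerivAt_of_eq 0 hline (by simp)).unique
    (hasDerivAt_expI_comp hphase)
  simpa [phasedWave] using this

end PhasedWave

section PlaneSymbols

/-- A symbol on the plane with support in the ball of radius `Q`. -/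
structure IsPlaneSymbol (δ Q N : ℝ) (g : ℝ → E2 → ℂ) : Prop where
  symbol : IsSymbol δ Set.univ N g
  radius_nonneg : 0 ≤ Q
  eq_zero : ∀ k : ℝ, 1 < k → ∀ q, Q < ‖q‖ → g k q = 0

theorem hasCompactSupport_of_eq_zero {Q : ℝ} {g : E2 → ℂ} (hQ : ∀ q, Q < ‖q‖ → g q = 0) :
    HasCompactSupport g :=
  .of_support_subset_isCompact (isCompact_closedBall (0 : E2) Q) fun q hq => by
    rw [mem_closedBall_zero_iff]
    exact not_lt.1 fun h => hq (hQ q h)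

theorem IsSymbol.const_mul {E : Type*} [NormedAddCommGroup E] [NormedSpace ℝ E] {δ N M : ℝ}
    {Ω : Set E} {p : ℝ → E → ℂ} (hp : IsSymbol δ Ω N p) {a : ℝ → ℂ}
    (ha : IsUnifBigO (fun _ => Ω) (δ * M) fun k _ => a k) :
    IsSymbol δ Ω (N + M) fun k v => a k * p k v where
  smooth k hk := contDiff_const.mul (hp.smooth k hk)
  bound m := by
    obtain ⟨A, hA₀, hA⟩ := ha.exists_bound
    obtain ⟨C, -, hC⟩ := (hp.bound m).exists_bound
    refine .of_bound (A * C) fun k hk v hv => ?_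
    have hk₀ : 0 < k := one_pos.trans hk
    have hsmul : iteratedFDeriv ℝ m (fun v => a k * p k v) v = a k • iteratedFDeriv ℝ m (p k) v :=
      iteratedFDeriv_const_smul_apply (f := p k) (a := a k)
        ((hp.smooth k hk).of_le (by norm_cast; exact le_top)).contDiffAt
    rw [hsmul, norm_smul, show δ * (N + M + m) = δ * M + δ * (N + m) by ring,
      Real.rpow_add hk₀, mul_mul_mul_comm]
    exact mul_le_mul (hA k hk v hv) (hC k hk v hv) (norm_nonneg _) (by positivity)

namespace IsPlaneSymbol

variable {δ Q N : ℝ} {g : ℝ → E2 → ℂ}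

theorem hasCompactSupport (hg : IsPlaneSymbol δ Q N g) {k : ℝ} (hk : 1 < k) :
    HasCompactSupport (g k) :=
  hasCompactSupport_of_eq_zero (hg.eq_zero k hk)

theorem ringMean {a : E2} {c : ℝ} (hg : IsPlaneSymbol δ Q N g) (hc : 0 < c)
    (hac : ‖a‖ ^ 2 + c ^ 2 = 1) (ρ : ℝ) :
    IsRaySymbol δ (c⁻¹ • a) ρ (ringLength c Q ρ) (Metric.ball 0 ρ) N
      (fun k => ringMean a c (g k)) where
  symbol := hg.symbol.ringMean a c _
  even k _ := isEven_ringMean a c (g k)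
  vanish k hk _ hx _ hz _ hσ := ringMean_ringPoint_eq_zero hc hac hg.radius_nonneg
    (hg.eq_zero k hk) (mem_ball_zero_iff.1 hx) hz hσ

end IsPlaneSymbol

end PlaneSymbols

section WaveDensity

variable {τ : E2 →ᵃⁱ[ℝ] E3} {d : E3} {t k : ℝ} {g : E2 → ℂ}

/-- The density `g e^{ik (d · q + t)}` on the plane of `τ`. -/
def waveDensity (τ : E2 →ᵃⁱ[ℝ] E3) (d : E3) (t k : ℝ) (g : E2 → ℂ) (q : E2) : ℂ :=
  g q * phasedWave k d t (τ q)

theorem contDiff_waveDensity (hg : ContDiff ℝ ∞ g) : ContDiff ℝ ∞ (waveDensity τ d t k g) :=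
  hg.mul ((contDiff_phasedWave k d t).comp τ.toContinuousAffineMap.contDiff)

theorem tsupport_waveDensity_subset (g : E2 → ℂ) :
    tsupport (waveDensity τ d t k g) ⊆ tsupport g :=
  tsupport_mul_subset_left

theorem hasCompactSupport_waveDensity (hg : HasCompactSupport g) :
    HasCompactSupport (waveDensity τ d t k g) :=
  hg.mul_right

/-- The amplitude of the derivative in the direction `e` of the density with amplitude `g`. -/
def modulatedDeriv (τ : E2 →ᵃⁱ[ℝ] E3) (d : E3) (e : E2) (k : ℝ) (g : E2 → ℂ) (q : E2) : ℂ :=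
  dirDeriv e g q + Complex.I * (k * inner ℝ d (τ.linearIsometry e) : ℝ) * g q

theorem dirDeriv_waveDensity (hg : ContDiff ℝ ∞ g) (e : E2) :
    dirDeriv e (waveDensity τ d t k g) = waveDensity τ d t k (modulatedDeriv τ d e k g) := by
  ext1 q
  have hwave := ((contDiff_phasedWave k d t).differentiable (by simp) (τ q)).hasFDerivAt.comp q
    τ.toContinuousAffineMap.hasFDerivAt
  have hprod : HasFDerivAt (waveDensity τ d t k g) _ q :=
    ((hg.differentiable (by simp) q).hasFDerivAt).mul hwave
  have hlin : τ.toContinuousAffineMap.contLinear e = τ.linearIsometry e := rfl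
  rw [dirDeriv, hprod.fderiv]
  simp only [add_apply, smul_apply, ContinuousLinearMap.comp_apply, smul_eq_mul, hlin,
    fderiv_phasedWave_apply, waveDensity, modulatedDeriv, dirDeriv]
  ring

theorem contDiff_modulatedDeriv (hg : ContDiff ℝ ∞ g) (d : E3) (e : E2) (k : ℝ) :
    ContDiff ℝ ∞ (modulatedDeriv τ d e k g) :=
  (contDiff_dirDeriv hg e).add (contDiff_const.mul hg)

theorem hasCompactSupport_modulatedDeriv (hg : HasCompactSupport g) {e : E2} :
    HasCompactSupport (modulatedDeriv τ d e k g) :=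
  (hg.fderiv_apply ℝ e).add hg.mul_left

theorem modulatedDeriv_eventuallyEq {q : E2} {u : ℂ} (h : g =ᶠ[𝓝 q] fun _ => u) (d : E3)
    (e : E2) (k : ℝ) : modulatedDeriv τ d e k g =ᶠ[𝓝 q]
      fun _ => Complex.I * (k * inner ℝ d (τ.linearIsometry e) : ℝ) * u := by
  filter_upwards [h, dirDeriv_eventuallyEq_zero h e] with q' hq hd
  rw [modulatedDeriv, hd, hq, zero_add]

theorem IsPlaneSymbol.modulatedDeriv {δ Q N : ℝ} {g : ℝ → E2 → ℂ} (hg : IsPlaneSymbol δ Q N g)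
    (hδ : 0 < δ) (hδ₁ : δ ≤ 1) (τ : E2 →ᵃⁱ[ℝ] E3) (d : E3) (e : E2) :
    IsPlaneSymbol δ Q (N + δ⁻¹) fun k => modulatedDeriv τ d e k (g k) where
  symbol := by
    refine ((hg.symbol.dirDeriv e).mono_order hδ.le ?_).add (hg.symbol.const_mul ?_)
    · gcongr
      exact (one_le_inv₀ hδ).2 hδ₁
    · rw [mul_inv_cancel₀ hδ.ne']
      exact isUnifBigO_I_mul _
  radius_nonneg := hg.radius_nonneg
  eq_zero k hk q hq := by
    have hzero : g k =ᶠ[𝓝 q] fun _ => 0 := by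
      filter_upwards [continuous_norm.continuousAt.eventually (lt_mem_nhds hq)] with q' hq'
        using hg.eq_zero k hk q' hq'
    simpa using (modulatedDeriv_eventuallyEq hzero d e k).eq_of_nhds

end WaveDensity

section LayerFormulas

/-- `d` is a unit vector that points from the plane of `τ` to the side of its unit normal `ν`. -/
structure IsOutgoing (τ : E2 →ᵃⁱ[ℝ] E3) (ν d : E3) : Prop extends IsUnitNormal τ ν where
  norm_dir : ‖d‖ = 1
  inner_pos : 0 < inner ℝ ν d

/-- The displacement in the plane of `τ` of a ray with direction `d` per unit of height. -/
def slope (τ : E2 →ᵃⁱ[ℝ] E3) (ν d : E3) : E2 := (inner ℝ ν d)⁻¹ • tangentPart τ d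

variable {τ : E2 →ᵃⁱ[ℝ] E3} {ν d : E3} {g : E2 → ℂ} {Q ρ z : ℝ} {x : E2}

theorem IsOutgoing.norm_tangentPart_sq_add_inner_sq (h : IsOutgoing τ ν d) :
    ‖tangentPart τ d‖ ^ 2 + inner ℝ ν d ^ 2 = 1 := by
  rw [h.norm_tangentPart_sq_add, h.norm_dir, one_pow]

theorem phasedWave_affineIsometry (τ : E2 →ᵃⁱ[ℝ] E3) (k : ℝ) (d : E3) (t : ℝ) (q : E2) :
    phasedWave k d t (τ q) = phasedWave k d t (τ 0) * expI (k * inner ℝ (tangentPart τ d) q) := by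
  rw [affineIsometry_apply, add_comm, phasedWave_add, inner_tangentPart]

theorem layer_eq_ringIntegral (h : IsOutgoing τ ν d) (hg : Continuous g) (hQ₀ : 0 ≤ Q)
    (hQ : ∀ q, Q < ‖q‖ → g q = 0) (k t : ℝ) (hx : ‖x‖ < ρ) (hz : z ∈ Set.Ioo 0 ρ) :
    layer τ (sphericalKernel k) (waveDensity τ d t k g) (τ x + z • ν) =
      phasedWave k d t (τ x) * ringIntegral (k * inner ℝ ν d) (ringLength (inner ℝ ν d) Q ρ + 1)
        (slope τ ν d) (ringMean (tangentPart τ d) (inner ℝ ν d) g) x z := by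
  have hwave := integral_wave_eq_ringIntegral h.inner_pos h.norm_tangentPart_sq_add_inner_sq hg
    hQ₀ hQ k hx hz
  rw [phasedWave_affineIsometry, mul_assoc, slope, ← hwave, ← integral_const_mul, layer]
  congr 1 with q
  rw [waveDensity, phasedWave_affineIsometry, sphericalKernel, h.norm_sub_eq_slant]
  ring

theorem layer_dirDeriv_normal_eq {K : E3 → ℂ} {G : E2 → ℂ} {V : ℝ → ℂ} {V' w : ℂ}
    (h : IsUnitNormal τ ν) (hG : Continuous G) (hGc : HasCompactSupport G)
    (hK : ContDiffOn ℝ ∞ K {0}ᶜ) (hz : z ∈ Set.Ioo 0 ρ)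
    (hV : ∀ z ∈ Set.Ioo 0 ρ, layer τ K G (τ x + z • ν) = w * V z) (hV' : HasDerivAt V V' z) :
    layer τ (dirDeriv ν K) G (τ x + z • ν) = w * V' := by
  have hr := h.notMem_image (x := x) hz.1.ne' (tsupport G)
  have hline : HasDerivAt (fun z : ℝ => τ x + z • ν) ν z := by
    simpa using ((hasDerivAt_id z).smul_const ν).const_add (τ x)
  have hlayer := (hasFDerivAt_layer τ.continuous hG hGc hK hr).differentiableAt.hasFDerivAt
    |>.comp_hasDerivAt z hline
  rw [fderiv_layer_apply τ.continuous hG hGc hK hr] at hlayer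
  refine hlayer.unique ((hV'.const_mul w).congr_of_eventuallyEq ?_)
  filter_upwards [Ioo_mem_nhds hz.1 hz.2] with z' hz' using hV z' hz'

theorem layer_dirDeriv_eq_ringDeriv (h : IsOutgoing τ ν d) (hg : ContDiff ℝ ∞ g) (hQ₀ : 0 ≤ Q)
    (hQ : ∀ q, Q < ‖q‖ → g q = 0) (k t : ℝ) (hx : ‖x‖ < ρ) (hz : z ∈ Set.Ioo 0 ρ) :
    layer τ (dirDeriv ν (sphericalKernel k)) (waveDensity τ d t k g) (τ x + z • ν) =
      phasedWave k d t (τ x) * ringDeriv (k * inner ℝ ν d) (ringLength (inner ℝ ν d) Q ρ + 1)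
        (slope τ ν d) (ringMean (tangentPart τ d) (inner ℝ ν d) g) x z := by
  have hlen := ringLength_nonneg h.inner_pos hQ₀ (hz.1.trans hz.2).le
  exact layer_dirDeriv_normal_eq h.toIsUnitNormal (contDiff_waveDensity hg).continuous
    (hasCompactSupport_waveDensity (hasCompactSupport_of_eq_zero hQ)) (contDiffOn_sphericalKernel k)
    hz (fun z hz => layer_eq_ringIntegral h hg.continuous hQ₀ hQ k t hx hz)
    (hasDerivAt_ringIntegral (contDiff_ringMean _ _ hg) (isEven_ringMean _ _ _) hz.1
      (by positivity) (ringMean_ringPoint_eq_zero h.inner_pos h.norm_tangentPart_sq_add_inner_sq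
        hQ₀ hQ hx hz (lt_add_one _)))

theorem layer_dirDeriv_dirDeriv_eq_ringDeriv₂ (h : IsOutgoing τ ν d) (hg : ContDiff ℝ ∞ g)
    (hQ₀ : 0 ≤ Q) (hQ : ∀ q, Q < ‖q‖ → g q = 0) (k t : ℝ) (hx : ‖x‖ < ρ) (hz : z ∈ Set.Ioo 0 ρ) :
    layer τ (dirDeriv ν (dirDeriv ν (sphericalKernel k))) (waveDensity τ d t k g) (τ x + z • ν) =
      phasedWave k d t (τ x) * ringDeriv₂ (k * inner ℝ ν d) (ringLength (inner ℝ ν d) Q ρ + 1)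
        (slope τ ν d) (ringMean (tangentPart τ d) (inner ℝ ν d) g) x z := by
  have hlen := ringLength_nonneg h.inner_pos hQ₀ (hz.1.trans hz.2).le
  have hvanish : ∀ z ∈ Set.Ioo 0 ρ, ∀ σ, ringLength (inner ℝ ν d) Q ρ < σ →
      ringMean (tangentPart τ d) (inner ℝ ν d) g (ringPoint (slope τ ν d) x z σ) = 0 :=
    fun z hz σ hσ => ringMean_ringPoint_eq_zero h.inner_pos h.norm_tangentPart_sq_add_inner_sq
      hQ₀ hQ hx hz hσ
  exact layer_dirDeriv_normal_eq h.toIsUnitNormal (contDiff_waveDensity hg).continuous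
    (hasCompactSupport_waveDensity (hasCompactSupport_of_eq_zero hQ))
    (contDiffOn_dirDeriv_compl_zero (contDiffOn_sphericalKernel k) ν) hz
    (fun z hz => layer_dirDeriv_eq_ringDeriv h hg hQ₀ hQ k t hx hz)
    (hasDerivAt_ringDeriv (contDiff_ringMean _ _ hg) (isEven_ringMean _ _ _) hz.1 (by positivity)
      (radialQuot_ringPoint_eq_zero (contDiff_ringMean _ _ hg) (isEven_ringMean _ _ _) hlen hvanish
        hz (lt_add_one _)))

end LayerFormulas

section UpperSide

variable {τ : E2 →ᵃⁱ[ℝ] E3} {ν d : E3} {g : ℝ → E2 → ℂ} {k ρ t : ℝ} {r : E3}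

/-- The open half-space over the plane of `τ`, on the side of its unit normal `ν`. -/
def upperSide (τ : E2 →ᵃⁱ[ℝ] E3) (ν : E3) : Set E3 := {r | 0 < height τ ν r}

/-- The open cylinder of height `ρ` over the disc of radius `ρ` in the plane of `τ`. -/
def upperBox (τ : E2 →ᵃⁱ[ℝ] E3) (ν : E3) (ρ : ℝ) : Set E3 :=
  {r | foot τ r ∈ Metric.ball 0 ρ ∧ height τ ν r ∈ Set.Ioo 0 ρ}

/-- The point of the plane of `τ` on the line through `r` with direction `d`. -/
def rayBase (τ : E2 →ᵃⁱ[ℝ] E3) (ν d r : E3) : E2 := foot τ r - height τ ν r • slope τ ν d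

/-- The plane wave that carries the amplitude `g` along the rays with direction `d`. -/
def rayWave (τ : E2 →ᵃⁱ[ℝ] E3) (ν d : E3) (t k : ℝ) (g : E2 → ℂ) (r : E3) : ℂ :=
  g (rayBase τ ν d r) * phasedWave k d t r

/-- The points of the cylinder whose ray starts at a point where `g k` is locally constant. -/
def flatPoints (τ : E2 →ᵃⁱ[ℝ] E3) (ν d : E3) (ρ : ℝ) (g : ℝ → E2 → ℂ) (k : ℝ) : Set E3 :=
  {r ∈ upperBox τ ν ρ | ∃ u, g k =ᶠ[𝓝 (rayBase τ ν d r)] fun _ => u}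

theorem isOpen_upperSide (τ : E2 →ᵃⁱ[ℝ] E3) (ν : E3) : IsOpen (upperSide τ ν) :=
  isOpen_lt continuous_const (continuous_height τ ν)

theorem IsUnitNormal.notMem_image_of_mem_upperSide (h : IsUnitNormal τ ν)
    (hr : r ∈ upperSide τ ν) (A : Set E2) : r ∉ τ '' A := by
  rw [← h.foot_add_height r]
  exact h.notMem_image hr.ne' A

theorem IsUnitNormal.phasedWave_eq (h : IsUnitNormal τ ν) (k : ℝ) (d : E3) (t : ℝ) (r : E3) :
    phasedWave k d t r =
      phasedWave k d t (τ (foot τ r)) * expI (k * inner ℝ ν d * height τ ν r) := by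
  conv_lhs => rw [← h.foot_add_height r, phasedWave_add, inner_smul_right, real_inner_comm]
  ring_nf

theorem IsUnifBigO.of_phasedWave_mul {s : ℝ} {I : ℝ → Set (E2 × ℝ)} {V : ℝ → E2 × ℝ → ℂ}
    {J : ℝ → Set E3} {f : ℝ → E3 → ℂ} (hV : IsUnifBigO I s V)
    (hJ : ∀ k, 1 < k → ∀ r ∈ J k, (foot τ r, height τ ν r) ∈ I k)
    (hf : ∀ k, 1 < k → ∀ r ∈ J k,
      f k r = phasedWave k d t (τ (foot τ r)) * V k (foot τ r, height τ ν r)) :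
    IsUnifBigO J s f :=
  (hV.comp _ hJ).of_norm_le fun k hk r hr => by
    rw [hf k hk r hr, norm_mul, norm_phasedWave, one_mul]

theorem mem_flatRays_of_mem_flatPoints (hr : r ∈ flatPoints τ ν d ρ g k) :
    (foot τ r, height τ ν r) ∈ flatRays (slope τ ν d) ρ (Metric.ball 0 ρ)
      (fun k => ringMean (tangentPart τ d) (inner ℝ ν d) (g k)) k := by
  obtain ⟨hbox, u, hu⟩ := hr
  exact ⟨hbox, _, ringMean_eventuallyEq_const hu⟩

theorem IsUnitNormal.phasedWave_mul_ringStart (h : IsUnitNormal τ ν)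
    (hr : r ∈ flatPoints τ ν d ρ g k) :
    phasedWave k d t (τ (foot τ r)) * ringStart (k * inner ℝ ν d) (slope τ ν d)
      (ringMean (tangentPart τ d) (inner ℝ ν d) (g k)) (foot τ r) (height τ ν r) =
      2 * Real.pi * rayWave τ ν d t k (g k) r := by
  obtain ⟨-, u, hu⟩ := hr
  have hmean := (ringMean_eventuallyEq_const (a := tangentPart τ d) (c := inner ℝ ν d)
    (y := (height τ ν r, rayBase τ ν d r)) hu).eq_of_nhds
  rw [rayBase] at hmean
  rw [ringStart, hmean, rayWave, hu.eq_of_nhds, h.phasedWave_eq k d t r]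
  ring

end UpperSide

section LayerBounds

variable {τ : E2 →ᵃⁱ[ℝ] E3} {ν d : E3} {δ Q N ρ : ℝ} {g : ℝ → E2 → ℂ}

theorem IsPlaneSymbol.isRaySymbol (h : IsOutgoing τ ν d) (hg : IsPlaneSymbol δ Q N g) (ρ : ℝ) :
    IsRaySymbol δ (slope τ ν d) ρ (ringLength (inner ℝ ν d) Q ρ) (Metric.ball 0 ρ) N
      fun k => KirchhoffPolygon.ringMean (tangentPart τ d) (inner ℝ ν d) (g k) :=
  hg.ringMean h.inner_pos h.norm_tangentPart_sq_add_inner_sq ρ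

namespace IsOutgoing

variable (h : IsOutgoing τ ν d) (hg : IsPlaneSymbol δ Q N g) (hδ : 0 ≤ δ) (hδ₁ : δ < 1 / 2)
  (hρ : 0 ≤ ρ)
include h hg hδ hδ₁ hρ

theorem isUnifBigO_layer (t : ℝ) :
    IsUnifBigO (fun _ => upperBox τ ν ρ) (δ * N - 1)
      fun k => layer τ (sphericalKernel k) (waveDensity τ d t k (g k)) := by
  refine ((hg.isRaySymbol h ρ).isUnifBigO_ringIntegral hδ hδ₁
    (ringLength_nonneg h.inner_pos hg.radius_nonneg hρ) h.inner_pos).of_phasedWave_mul (d := d)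
    (t := t) (fun k _ r hr => hr) fun k hk r hr => ?_
  rw [← layer_eq_ringIntegral h (hg.symbol.smooth k hk).continuous hg.radius_nonneg
    (hg.eq_zero k hk) k t (mem_ball_zero_iff.1 hr.1) hr.2, h.foot_add_height]

theorem isUnifBigO_layer_dirDeriv (t : ℝ) :
    IsUnifBigO (fun _ => upperBox τ ν ρ) (δ * N)
      fun k => layer τ (dirDeriv ν (sphericalKernel k)) (waveDensity τ d t k (g k)) := by
  refine ((hg.isRaySymbol h ρ).isUnifBigO_ringDeriv hδ hδ₁
    (ringLength_nonneg h.inner_pos hg.radius_nonneg hρ) h.inner_pos).of_phasedWave_mul (d := d)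
    (t := t) (fun k _ r hr => hr) fun k hk r hr => ?_
  rw [← layer_dirDeriv_eq_ringDeriv h (hg.symbol.smooth k hk) hg.radius_nonneg
    (hg.eq_zero k hk) k t (mem_ball_zero_iff.1 hr.1) hr.2, h.foot_add_height]

theorem isUnifBigO_layer_dirDeriv_dirDeriv (t : ℝ) :
    IsUnifBigO (fun _ => upperBox τ ν ρ) (δ * N + 1)
      fun k => layer τ (dirDeriv ν (dirDeriv ν (sphericalKernel k)))
        (waveDensity τ d t k (g k)) := by
  refine ((hg.isRaySymbol h ρ).isUnifBigO_ringDeriv₂ hδ hδ₁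
    (ringLength_nonneg h.inner_pos hg.radius_nonneg hρ) h.inner_pos).of_phasedWave_mul (d := d)
    (t := t) (fun k _ r hr => hr) fun k hk r hr => ?_
  rw [← layer_dirDeriv_dirDeriv_eq_ringDeriv₂ h (hg.symbol.smooth k hk) hg.radius_nonneg
    (hg.eq_zero k hk) k t (mem_ball_zero_iff.1 hr.1) hr.2, h.foot_add_height]

theorem isUnifBigO_layer_sub_rayWave (t B : ℝ) :
    IsUnifBigO (flatPoints τ ν d ρ g) (-B) fun k r =>
      layer τ (sphericalKernel k) (waveDensity τ d t k (g k)) r -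
        Complex.I / (k * inner ℝ ν d : ℝ) * (2 * Real.pi * rayWave τ ν d t k (g k) r) := by
  refine ((hg.isRaySymbol h ρ).isUnifBigO_ringIntegral_sub_ringStart hδ hδ₁
    (ringLength_nonneg h.inner_pos hg.radius_nonneg hρ) h.inner_pos B).of_phasedWave_mul (d := d)
    (t := t) (fun k _ r hr => mem_flatRays_of_mem_flatPoints hr) fun k hk r hr => ?_
  rw [mul_sub, ← layer_eq_ringIntegral h (hg.symbol.smooth k hk).continuous hg.radius_nonneg
    (hg.eq_zero k hk) k t (mem_ball_zero_iff.1 hr.1.1) hr.1.2, h.foot_add_height,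
    ← h.phasedWave_mul_ringStart hr, mul_left_comm]

theorem isUnifBigO_layer_dirDeriv_add_rayWave (t B : ℝ) :
    IsUnifBigO (flatPoints τ ν d ρ g) (-B) fun k r =>
      layer τ (dirDeriv ν (sphericalKernel k)) (waveDensity τ d t k (g k)) r +
        2 * Real.pi * rayWave τ ν d t k (g k) r := by
  refine ((hg.isRaySymbol h ρ).isUnifBigO_ringDeriv_add_ringStart hδ hδ₁
    (ringLength_nonneg h.inner_pos hg.radius_nonneg hρ) h.inner_pos B).of_phasedWave_mul (d := d)
    (t := t) (fun k _ r hr => mem_flatRays_of_mem_flatPoints hr) fun k hk r hr => ?_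
  rw [mul_add, ← layer_dirDeriv_eq_ringDeriv h (hg.symbol.smooth k hk) hg.radius_nonneg
    (hg.eq_zero k hk) k t (mem_ball_zero_iff.1 hr.1.1) hr.1.2, h.foot_add_height,
    h.phasedWave_mul_ringStart hr]

theorem isUnifBigO_layer_dirDeriv_dirDeriv_add_rayWave (t B : ℝ) :
    IsUnifBigO (flatPoints τ ν d ρ g) (-B) fun k r =>
      layer τ (dirDeriv ν (dirDeriv ν (sphericalKernel k))) (waveDensity τ d t k (g k)) r +
        Complex.I * (k * inner ℝ ν d : ℝ) * (2 * Real.pi * rayWave τ ν d t k (g k) r) := by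
  refine ((hg.isRaySymbol h ρ).isUnifBigO_ringDeriv₂_add_ringStart hδ hδ₁
    (ringLength_nonneg h.inner_pos hg.radius_nonneg hρ) h.inner_pos B).of_phasedWave_mul (d := d)
    (t := t) (fun k _ r hr => mem_flatRays_of_mem_flatPoints hr) fun k hk r hr => ?_
  rw [mul_add, ← layer_dirDeriv_dirDeriv_eq_ringDeriv₂ h (hg.symbol.smooth k hk) hg.radius_nonneg
    (hg.eq_zero k hk) k t (mem_ball_zero_iff.1 hr.1.1) hr.1.2, h.foot_add_height,
    ← h.phasedWave_mul_ringStart hr, mul_left_comm]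

end IsOutgoing

end LayerBounds

section LinearCombination

variable {ι κ E F : Type*} {I : ℝ → Set ι} {s : ℝ}

theorem IsUnifBigO.linearCombination {f₀ f₁ : ℝ → ι → ℂ} (h₀ : IsUnifBigO I (s - 1) f₀)
    (h₁ : IsUnifBigO I s f₁) (β γ : ℂ) :
    IsUnifBigO I s fun k i => k * β * f₀ k i + γ * f₁ k i := by
  refine .add ?_ (((isUnifBigO_const γ).mul_left h₁).mono_exponent (by linarith))
  simp only [mul_assoc]
  exact (isUnifBigO_ofReal.mul_left ((isUnifBigO_const β).mul_left h₀)).mono_exponent (by linarith)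

theorem IsUnifBigO.of_orthonormalBasis [Fintype κ] [NormedAddCommGroup E] [InnerProductSpace ℝ E]
    [NormedAddCommGroup F] [NormedSpace ℝ F] (b : OrthonormalBasis κ ℝ E)
    {f : ℝ → ι → E →L[ℝ] F} (h : ∀ j, IsUnifBigO I s fun k i => f k i (b j)) :
    IsUnifBigO I s f := by
  have hsum : IsUnifBigO I s fun k i => ∑ j, ‖f k i (b j)‖ :=
    .sum fun j _ => (h j).of_norm_le fun k _ i _ => (norm_norm _).le
  exact hsum.of_norm_le fun k _ i _ =>
    (opNorm_le_sum_orthonormalBasis b (f k i)).trans (le_abs_self _)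

end LinearCombination

section CombinedLayer

/-- The linear combination of the single and double layer potentials with density
`g e^{ik (d · q + t)}`. The factor `k` of the single layer makes the two terms of the same order. -/
def combinedLayer (τ : E2 →ᵃⁱ[ℝ] E3) (ν d : E3) (t : ℝ) (β γ : ℂ) (k : ℝ) (g : E2 → ℂ)
    (r : E3) : ℂ :=
  k * β * layer τ (sphericalKernel k) (waveDensity τ d t k g) r +
    γ * layer τ (dirDeriv ν (sphericalKernel k)) (waveDensity τ d t k g) r

/-- The amplitude of the wave that a combined layer with density `e^{ik (d · q + t)}` emits. -/
def rayAmplitude (ν d : E3) (β γ : ℂ) : ℂ := 2 * Real.pi * (Complex.I * β / (inner ℝ ν d : ℝ) - γ)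

variable {τ : E2 →ᵃⁱ[ℝ] E3} {ν d : E3} {t k : ℝ} {β γ : ℂ} {g : E2 → ℂ} {r : E3}

theorem notMem_image_tsupport_waveDensity (hr : r ∉ τ '' tsupport g) :
    r ∉ τ '' tsupport (waveDensity τ d t k g) :=
  fun h => hr (Set.image_mono (tsupport_waveDensity_subset g) h)

theorem hasFDerivAt_layer_waveDensity {K : E3 → ℂ} (hg : ContDiff ℝ ∞ g)
    (hgc : HasCompactSupport g) (hK : ContDiffOn ℝ ∞ K {0}ᶜ) (hr : r ∉ τ '' tsupport g) :
    HasFDerivAt (layer τ K (waveDensity τ d t k g))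
      (fderiv ℝ (layer τ K (waveDensity τ d t k g)) r) r :=
  (hasFDerivAt_layer τ.continuous (contDiff_waveDensity hg).continuous
    (hasCompactSupport_waveDensity hgc) hK
    (notMem_image_tsupport_waveDensity hr)).differentiableAt.hasFDerivAt

theorem hasFDerivAt_combinedLayer (hg : ContDiff ℝ ∞ g) (hgc : HasCompactSupport g)
    (hr : r ∉ τ '' tsupport g) : HasFDerivAt (combinedLayer τ ν d t β γ k g)
      ((k * β) • fderiv ℝ (layer τ (sphericalKernel k) (waveDensity τ d t k g)) r +
        γ • fderiv ℝ (layer τ (dirDeriv ν (sphericalKernel k)) (waveDensity τ d t k g)) r) r :=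
  have hK : ContDiffOn ℝ ∞ (sphericalKernel k : E3 → ℂ) {0}ᶜ := contDiffOn_sphericalKernel k
  ((hasFDerivAt_layer_waveDensity hg hgc hK hr).const_mul _).add
    ((hasFDerivAt_layer_waveDensity hg hgc (contDiffOn_dirDeriv_compl_zero hK ν) hr).const_mul _)

theorem fderiv_combinedLayer_apply (hg : ContDiff ℝ ∞ g) (hgc : HasCompactSupport g)
    (hr : r ∉ τ '' tsupport g) (v : E3) : fderiv ℝ (combinedLayer τ ν d t β γ k g) r v =
      k * β * layer τ (dirDeriv v (sphericalKernel k)) (waveDensity τ d t k g) r +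
        γ * layer τ (dirDeriv v (dirDeriv ν (sphericalKernel k))) (waveDensity τ d t k g) r := by
  have hK : ContDiffOn ℝ ∞ (sphericalKernel k : E3 → ℂ) {0}ᶜ := contDiffOn_sphericalKernel k
  have hG := (contDiff_waveDensity (τ := τ) (d := d) (t := t) (k := k) hg).continuous
  have hGc := hasCompactSupport_waveDensity (τ := τ) (d := d) (t := t) (k := k) hgc
  have hr' := notMem_image_tsupport_waveDensity (d := d) (t := t) (k := k) hr
  rw [(hasFDerivAt_combinedLayer hg hgc hr).fderiv,
    ← fderiv_layer_apply τ.continuous hG hGc hK hr',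
    ← fderiv_layer_apply τ.continuous hG hGc (contDiffOn_dirDeriv_compl_zero hK ν) hr']
  rfl

theorem fderiv_combinedLayer_tangent (hg : ContDiff ℝ ∞ g) (hgc : HasCompactSupport g)
    (hr : r ∉ τ '' tsupport g) (e : E2) :
    fderiv ℝ (combinedLayer τ ν d t β γ k g) r (τ.linearIsometry e) =
      combinedLayer τ ν d t β γ k (modulatedDeriv τ d e k g) r := by
  have hK : ContDiffOn ℝ ∞ (sphericalKernel k : E3 → ℂ) {0}ᶜ := contDiffOn_sphericalKernel k
  have htangent {K : E3 → ℂ} (hK : ContDiffOn ℝ ∞ K {0}ᶜ) :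
      layer τ (dirDeriv (τ.linearIsometry e) K) (waveDensity τ d t k g) r =
        layer τ K (waveDensity τ d t k (modulatedDeriv τ d e k g)) r := by
    rw [← dirDeriv_waveDensity hg]
    exact layer_dirDeriv_tangent τ.toContinuousAffineMap (contDiff_waveDensity hg)
      (hasCompactSupport_waveDensity hgc) hK (notMem_image_tsupport_waveDensity hr) e
  rw [fderiv_combinedLayer_apply hg hgc hr, htangent hK,
    htangent (contDiffOn_dirDeriv_compl_zero hK ν), combinedLayer]

end CombinedLayer

section CombinedLayerBounds

variable {τ : E2 →ᵃⁱ[ℝ] E3} {ν d : E3} {δ Q N ρ : ℝ} {g : ℝ → E2 → ℂ}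

theorem flatPoints_subset_modulatedDeriv (e : E2) (k : ℝ) : flatPoints τ ν d ρ g k ⊆
    flatPoints τ ν d ρ (fun k => modulatedDeriv τ d e k (g k)) k :=
  fun _ ⟨hr, _, hu⟩ => ⟨hr, _, modulatedDeriv_eventuallyEq hu d e k⟩

theorem rayWave_modulatedDeriv {k : ℝ} {r : E3} (hr : r ∈ flatPoints τ ν d ρ g k) (t : ℝ)
    (e : E2) : rayWave τ ν d t k (modulatedDeriv τ d e k (g k)) r =
      g k (rayBase τ ν d r) * fderiv ℝ (phasedWave k d t) r (τ.linearIsometry e) := by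
  obtain ⟨-, u, hu⟩ := hr
  rw [rayWave, (modulatedDeriv_eventuallyEq hu d e k).eq_of_nhds, hu.eq_of_nhds,
    fderiv_phasedWave_apply]
  ring

namespace IsOutgoing

variable (h : IsOutgoing τ ν d) (hg : IsPlaneSymbol δ Q N g) (hδ₁ : δ < 1 / 2) (hρ : 0 ≤ ρ)
include h hg hδ₁ hρ

theorem isUnifBigO_combinedLayer (hδ : 0 ≤ δ) (t : ℝ) (β γ : ℂ) :
    IsUnifBigO (fun _ => upperBox τ ν ρ) (δ * N)
      fun k => combinedLayer τ ν d t β γ k (g k) :=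
  (h.isUnifBigO_layer hg hδ hδ₁ hρ t).linearCombination
    (h.isUnifBigO_layer_dirDeriv hg hδ hδ₁ hρ t) β γ

theorem isUnifBigO_fderiv_combinedLayer (hδ : 0 < δ) (t : ℝ) (β γ : ℂ) :
    IsUnifBigO (fun _ => upperBox τ ν ρ) (δ * N + 1)
      fun k => fderiv ℝ (combinedLayer τ ν d t β γ k (g k)) := by
  have hnotMem {r : E3} (hr : r ∈ upperBox τ ν ρ) (k : ℝ) : r ∉ τ '' tsupport (g k) :=
    h.notMem_image_of_mem_upperSide hr.2.1 _
  refine .of_orthonormalBasis h.basis fun i => ?_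
  refine h.basis_induction (P := fun b => IsUnifBigO _ _ fun k r =>
    fderiv ℝ (combinedLayer τ ν d t β γ k (g k)) r b) (fun e => ?_) ?_ i
  · refine ((h.isUnifBigO_combinedLayer (hg.modulatedDeriv hδ (by linarith) τ d e) hδ₁ hρ hδ.le
      t β γ).mono_exponent ?_).congr fun k hk r hr => fderiv_combinedLayer_tangent
        (hg.symbol.smooth k hk) (hg.hasCompactSupport hk) (hnotMem hr k) e
    rw [mul_add, mul_inv_cancel₀ hδ.ne']
  · refine ((h.isUnifBigO_layer_dirDeriv hg hδ.le hδ₁ hρ t).mono_exponent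
      (by linarith)).linearCombination (h.isUnifBigO_layer_dirDeriv_dirDeriv hg hδ.le hδ₁ hρ t)
      β γ |>.congr fun k hk r hr => fderiv_combinedLayer_apply (hg.symbol.smooth k hk)
        (hg.hasCompactSupport hk) (hnotMem hr k) ν

theorem isUnifBigO_combinedLayer_sub_rayWave (hδ : 0 ≤ δ) (t : ℝ) (β γ : ℂ) (B : ℝ) :
    IsUnifBigO (flatPoints τ ν d ρ g) (-B) fun k r =>
      combinedLayer τ ν d t β γ k (g k) r -
        rayAmplitude ν d β γ * rayWave τ ν d t k (g k) r := by
  refine (((h.isUnifBigO_layer_sub_rayWave hg hδ hδ₁ hρ t (B + 1)).mono_exponent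
    (by linarith)).linearCombination (h.isUnifBigO_layer_dirDeriv_add_rayWave hg hδ hδ₁ hρ t B)
    β γ).congr fun k hk r _ => ?_
  have hk₀ : (k : ℂ) ≠ 0 := Complex.ofReal_ne_zero.2 (one_pos.trans hk).ne'
  have hc : ((inner ℝ ν d : ℝ) : ℂ) ≠ 0 := Complex.ofReal_ne_zero.2 h.inner_pos.ne'
  rw [combinedLayer, rayAmplitude, Complex.ofReal_mul]
  field_simp
  ring

theorem isUnifBigO_fderiv_combinedLayer_normal_sub (hδ : 0 ≤ δ) (t : ℝ) (β γ : ℂ) (B : ℝ) :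
    IsUnifBigO (flatPoints τ ν d ρ g) (-B) fun k r =>
      fderiv ℝ (combinedLayer τ ν d t β γ k (g k)) r ν -
        rayAmplitude ν d β γ * g k (rayBase τ ν d r) * fderiv ℝ (phasedWave k d t) r ν := by
  refine (((h.isUnifBigO_layer_dirDeriv_add_rayWave hg hδ hδ₁ hρ t (B + 1)).mono_exponent
    (by linarith)).linearCombination
    (h.isUnifBigO_layer_dirDeriv_dirDeriv_add_rayWave hg hδ hδ₁ hρ t B) β γ).congr
    fun k hk r hr => ?_
  have hc : ((inner ℝ ν d : ℝ) : ℂ) ≠ 0 := Complex.ofReal_ne_zero.2 h.inner_pos.ne'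
  rw [fderiv_combinedLayer_apply (hg.symbol.smooth k hk) (hg.hasCompactSupport hk)
    (h.notMem_image_of_mem_upperSide hr.1.2.1 _), fderiv_phasedWave_apply, rayAmplitude, rayWave,
    real_inner_comm ν d, Complex.ofReal_mul]
  field_simp
  linear_combination -2 * Real.pi * k * β * g k (rayBase τ ν d r) * phasedWave k d t r *
    Complex.I_sq

theorem isUnifBigO_fderiv_combinedLayer_sub (hδ : 0 < δ) (t : ℝ) (β γ : ℂ) (B : ℝ) :
    IsUnifBigO (flatPoints τ ν d ρ g) (-B) fun k r =>
      fderiv ℝ (combinedLayer τ ν d t β γ k (g k)) r -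
        (rayAmplitude ν d β γ * g k (rayBase τ ν d r)) • fderiv ℝ (phasedWave k d t) r := by
  refine .of_orthonormalBasis h.basis fun i => ?_
  refine h.basis_induction (P := fun b => IsUnifBigO _ _ fun k r =>
    (fderiv ℝ (combinedLayer τ ν d t β γ k (g k)) r -
      (rayAmplitude ν d β γ * g k (rayBase τ ν d r)) • fderiv ℝ (phasedWave k d t) r) b)
    (fun e => ?_) ?_ i
  · refine ((h.isUnifBigO_combinedLayer_sub_rayWave (hg.modulatedDeriv hδ (by linarith) τ d e)
      hδ₁ hρ hδ.le t β γ B).mono_set fun k _ => flatPoints_subset_modulatedDeriv e k).congr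
      fun k hk r hr => ?_
    rw [← fderiv_combinedLayer_tangent (hg.symbol.smooth k hk) (hg.hasCompactSupport hk)
      (h.notMem_image_of_mem_upperSide hr.1.2.1 _), rayWave_modulatedDeriv hr, ← mul_assoc]
    rfl
  · exact h.isUnifBigO_fderiv_combinedLayer_normal_sub hg hδ₁ hρ hδ.le t β γ B

end IsOutgoing

end CombinedLayerBounds

section CombinedLayerLimits

variable {τ : E2 →ᵃⁱ[ℝ] E3} {ν d : E3} {k : ℝ} {g : E2 → ℂ} {r₀ : E3}

theorem IsUnitNormal.exists_tendsto_of_eq_phasedWave_mul (h : IsUnitNormal τ ν) {t : ℝ}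
    {f : E3 → ℂ} (h₀ : 0 ≤ height τ ν r₀)
    (hf : ∀ ρ > 0, ∃ V : E2 × ℝ → ℂ, Continuous V ∧ ∀ x : E2, ‖x‖ < ρ → ∀ z ∈ Set.Ioo 0 ρ,
      f (τ x + z • ν) = phasedWave k d t (τ x) * V (x, z)) :
    ∃ u, Tendsto f (𝓝[upperSide τ ν] r₀) (𝓝 u) := by
  have hfoot := continuous_foot τ
  have hheight := continuous_height τ ν
  obtain ⟨V, hV, hfV⟩ := hf (‖foot τ r₀‖ + height τ ν r₀ + 1) (by positivity)
  have hwave : Continuous fun r => phasedWave k d t (τ (foot τ r)) :=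
    (contDiff_phasedWave k d t).continuous.comp (τ.continuous.comp hfoot)
  have hcont : Continuous fun r => phasedWave k d t (τ (foot τ r)) * V (foot τ r, height τ ν r) :=
    hwave.mul (hV.comp (hfoot.prodMk hheight))
  refine ⟨_, ((hcont.tendsto r₀).mono_left nhdsWithin_le_nhds).congr' ?_⟩
  have hfoot_lt := hfoot.norm.continuousAt.eventually
    (gt_mem_nhds (by linarith : ‖foot τ r₀‖ < ‖foot τ r₀‖ + height τ ν r₀ + 1))
  have hheight_lt := hheight.continuousAt.eventually (gt_mem_nhds
    (by linarith [norm_nonneg (foot τ r₀)] : height τ ν r₀ < ‖foot τ r₀‖ + height τ ν r₀ + 1))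
  filter_upwards [hfoot_lt.filter_mono nhdsWithin_le_nhds,
    hheight_lt.filter_mono nhdsWithin_le_nhds, self_mem_nhdsWithin] with r h₁ h₂ h₃
  rw [← hfV _ h₁ _ ⟨h₃, h₂⟩, h.foot_add_height]

theorem exists_radius_of_hasCompactSupport {E F : Type*} [NormedAddCommGroup E] [Zero F]
    {g : E → F} (hgc : HasCompactSupport g) : ∃ Q, 0 ≤ Q ∧ ∀ q, Q < ‖q‖ → g q = 0 := by
  obtain ⟨Q, hQ₀, hQ⟩ := hgc.isCompact.isBounded.exists_pos_norm_le
  exact ⟨Q, hQ₀.le, fun q hq => image_eq_zero_of_notMem_tsupport fun h => (hQ q h).not_gt hq⟩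

namespace IsOutgoing

variable (h : IsOutgoing τ ν d) (hg : ContDiff ℝ ∞ g) (hgc : HasCompactSupport g)
  (h₀ : 0 ≤ height τ ν r₀)
include h hg hgc h₀

theorem exists_tendsto_layer (t : ℝ) :
    ∃ u, Tendsto (layer τ (sphericalKernel k) (waveDensity τ d t k g))
      (𝓝[upperSide τ ν] r₀) (𝓝 u) := by
  obtain ⟨Q, hQ₀, hQ⟩ := exists_radius_of_hasCompactSupport hgc
  exact h.exists_tendsto_of_eq_phasedWave_mul h₀ fun ρ _ =>
    ⟨_, continuous_ringIntegral _ _ _ (continuous_ringMean _ _ hg.continuous), fun x hx z hz =>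
      layer_eq_ringIntegral h hg.continuous hQ₀ hQ k t hx hz⟩

theorem exists_tendsto_layer_dirDeriv (t : ℝ) :
    ∃ u, Tendsto (layer τ (dirDeriv ν (sphericalKernel k)) (waveDensity τ d t k g))
      (𝓝[upperSide τ ν] r₀) (𝓝 u) := by
  obtain ⟨Q, hQ₀, hQ⟩ := exists_radius_of_hasCompactSupport hgc
  exact h.exists_tendsto_of_eq_phasedWave_mul h₀ fun ρ _ =>
    ⟨_, continuous_ringDeriv _ _ _ (contDiff_ringMean _ _ hg), fun x hx z hz =>
      layer_dirDeriv_eq_ringDeriv h hg hQ₀ hQ k t hx hz⟩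

theorem exists_tendsto_layer_dirDeriv_dirDeriv (t : ℝ) :
    ∃ u, Tendsto (layer τ (dirDeriv ν (dirDeriv ν (sphericalKernel k))) (waveDensity τ d t k g))
      (𝓝[upperSide τ ν] r₀) (𝓝 u) := by
  obtain ⟨Q, hQ₀, hQ⟩ := exists_radius_of_hasCompactSupport hgc
  exact h.exists_tendsto_of_eq_phasedWave_mul h₀ fun ρ _ =>
    ⟨_, continuous_ringDeriv₂ _ _ _ (contDiff_ringMean _ _ hg), fun x hx z hz =>
      layer_dirDeriv_dirDeriv_eq_ringDeriv₂ h hg hQ₀ hQ k t hx hz⟩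

theorem exists_tendsto_combinedLayer (t : ℝ) (β γ : ℂ) :
    ∃ u, Tendsto (combinedLayer τ ν d t β γ k g) (𝓝[upperSide τ ν] r₀) (𝓝 u) := by
  obtain ⟨u₀, hu₀⟩ := h.exists_tendsto_layer hg hgc h₀ (k := k) t
  obtain ⟨u₁, hu₁⟩ := h.exists_tendsto_layer_dirDeriv hg hgc h₀ (k := k) t
  exact ⟨_, (hu₀.const_mul (k * β)).add (hu₁.const_mul γ)⟩

theorem exists_tendsto_fderiv_combinedLayer (t : ℝ) (β γ : ℂ) :
    ∃ U, Tendsto (fderiv ℝ (combinedLayer τ ν d t β γ k g)) (𝓝[upperSide τ ν] r₀) (𝓝 U) := by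
  have hnotMem {r : E3} (hr : r ∈ upperSide τ ν) : r ∉ τ '' tsupport g :=
    h.notMem_image_of_mem_upperSide hr _
  refine exists_tendsto_of_orthonormalBasis h.basis (h.basis_induction
    (P := fun b => ∃ u, Tendsto (fun r => fderiv ℝ (combinedLayer τ ν d t β γ k g) r b)
      (𝓝[upperSide τ ν] r₀) (𝓝 u)) (fun e => ?_) ?_)
  · obtain ⟨u, hu⟩ := h.exists_tendsto_combinedLayer (k := k)
      (contDiff_modulatedDeriv (τ := τ) hg d e k) (hasCompactSupport_modulatedDeriv hgc) h₀ t β γ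
    refine ⟨u, hu.congr' ?_⟩
    filter_upwards [self_mem_nhdsWithin] with r hr
    exact (fderiv_combinedLayer_tangent hg hgc (hnotMem hr) e).symm
  · obtain ⟨u₁, hu₁⟩ := h.exists_tendsto_layer_dirDeriv hg hgc h₀ (k := k) t
    obtain ⟨u₂, hu₂⟩ := h.exists_tendsto_layer_dirDeriv_dirDeriv hg hgc h₀ (k := k) t
    refine ⟨_, ((hu₁.const_mul (k * β)).add (hu₂.const_mul γ)).congr' ?_⟩
    filter_upwards [self_mem_nhdsWithin] with r hr
    exact (fderiv_combinedLayer_apply hg hgc (hnotMem hr) ν).symm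

end IsOutgoing

theorem IsUnitNormal.exists_tendsto_fderiv_combinedLayer_of_notMem (h : IsUnitNormal τ ν)
    (hg : ContDiff ℝ ∞ g) (hgc : HasCompactSupport g) (hr₀ : r₀ ∉ τ '' tsupport g) (t : ℝ)
    (β γ : ℂ) : ∃ U, Tendsto (fderiv ℝ (combinedLayer τ ν d t β γ k g)) (𝓝 r₀) (𝓝 U) := by
  have hK : ContDiffOn ℝ ∞ (sphericalKernel k : E3 → ℂ) {0}ᶜ := contDiffOn_sphericalKernel k
  refine exists_tendsto_of_orthonormalBasis h.basis fun i => ?_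
  have hlayer {K : E3 → ℂ} (hK : ContDiffOn ℝ ∞ K {0}ᶜ) :
      ContinuousAt (layer τ (dirDeriv (h.basis i) K) (waveDensity τ d t k g)) r₀ :=
    (hasFDerivAt_layer_waveDensity hg hgc (contDiffOn_dirDeriv_compl_zero hK _) hr₀).continuousAt
  refine ⟨_, ((hlayer hK).const_mul (k * β)).add
    ((hlayer (contDiffOn_dirDeriv_compl_zero hK ν)).const_mul γ) |>.tendsto.congr' ?_⟩
  filter_upwards [(isOpen_compl_image_tsupport τ.continuous hgc).mem_nhds hr₀] with r hr
  exact (fderiv_combinedLayer_apply hg hgc hr _).symm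

end CombinedLayerLimits

section Cutoff

/-- The cut-off function on `M₀`, extended by zero. -/
def cutoffExt (M₀ : Set E2) (η : ℝ → E2 → ℝ) (k : ℝ) (q : E2) : ℂ := (M₀.indicator (η k) q : ℝ)

variable {δ k : ℝ} {M₀ : Set E2} {η : ℝ → E2 → ℝ} {q : E2}

theorem infDist_frontier_le_dist {E : Type*} [NormedAddCommGroup E] [NormedSpace ℝ E]
    [FiniteDimensional ℝ E] {s : Set E} {x y : E} (hx : x ∈ s) (hy : y ∉ s) :
    Metric.infDist x (frontier s) ≤ dist x y := by
  obtain ⟨z, hz, hxz⟩ := exists_mem_frontier_infDist_compl_eq_dist hx fun h => hy (h ▸ trivial)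
  exact (Metric.infDist_le_dist_of_mem hz).trans (hxz ▸ Metric.infDist_le_dist_of_mem hy)

theorem cutoffExt_eventuallyEq_comp (hM : IsOpen M₀) (hq : q ∈ M₀) :
    cutoffExt M₀ η k =ᶠ[𝓝 q] Complex.ofRealLI ∘ η k := by
  filter_upwards [hM.mem_nhds hq] with q' hq'
  rw [cutoffExt, Set.indicator_of_mem hq']
  rfl

namespace IsCutoff

variable (hη : IsCutoff δ M₀ η)
include hη

theorem cutoffExt_eventuallyEq_zero (hk : 1 < k) (hq : q ∉ M₀) :
    cutoffExt M₀ η k =ᶠ[𝓝 q] fun _ => 0 := by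
  have hk' : 0 < k ^ (-δ) := Real.rpow_pos_of_pos (one_pos.trans hk) _
  filter_upwards [Metric.ball_mem_nhds q hk'] with q' hq'
  by_cases hmem : q' ∈ M₀
  · rw [cutoffExt, Set.indicator_of_mem hmem, hη.eq_zero k hk q' hmem
      ((infDist_frontier_le_dist hmem hq).trans_lt hq'), Complex.ofReal_zero]
  · rw [cutoffExt, Set.indicator_of_notMem hmem, Complex.ofReal_zero]

theorem cutoffExt_eventuallyEq_one (hM : IsOpen M₀) (hk : 1 < k) (hq : q ∈ M₀)
    (hdist : 2 * k ^ (-δ) < Metric.infDist q (frontier M₀)) :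
    cutoffExt M₀ η k =ᶠ[𝓝 q] fun _ => 1 := by
  filter_upwards [hM.mem_nhds hq,
    (Metric.continuous_infDist_pt (frontier M₀)).continuousAt.eventually (lt_mem_nhds hdist)]
    with q' hq' hdist'
  rw [cutoffExt, Set.indicator_of_mem hq', hη.eq_one k hk q' hq' hdist', Complex.ofReal_one]

theorem tsupport_cutoffExt_subset (hk : 1 < k) : tsupport (cutoffExt M₀ η k) ⊆ M₀ := by
  intro q hq
  by_contra hmem
  exact notMem_tsupport_iff_eventuallyEq.2 (hη.cutoffExt_eventuallyEq_zero hk hmem) hq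

theorem contDiff_cutoffExt (hM : IsOpen M₀) (hk : 1 < k) : ContDiff ℝ ∞ (cutoffExt M₀ η k) := by
  refine contDiff_iff_contDiffAt.2 fun q => ?_
  by_cases hq : q ∈ M₀
  · exact (Complex.ofRealLI.contDiff.contDiffAt.comp q
      ((hη.smooth k hk).contDiffAt (hM.mem_nhds hq))).congr_of_eventuallyEq
        (cutoffExt_eventuallyEq_comp hM hq)
  · exact contDiffAt_const.congr_of_eventuallyEq (hη.cutoffExt_eventuallyEq_zero hk hq)

theorem isSymbol_cutoffExt (hM : IsOpen M₀) : IsSymbol δ Set.univ 0 (cutoffExt M₀ η) where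
  smooth _ hk := hη.contDiff_cutoffExt hM hk
  bound m := by
    obtain ⟨C, hC⟩ := hη.deriv_bound m
    refine .of_bound (max C 0) fun k hk q _ => ?_
    have hk' : 0 ≤ k ^ (δ * m) := Real.rpow_nonneg (one_pos.trans hk).le _
    rw [zero_add]
    by_cases hq : q ∈ M₀
    · rw [((cutoffExt_eventuallyEq_comp hM hq).iteratedFDeriv ℝ m).eq_of_nhds,
        LinearIsometry.norm_iteratedFDeriv_comp_left _
          ((hη.smooth k hk).contDiffAt (hM.mem_nhds hq)) (by exact_mod_cast le_top)]
      exact (hC k hk q hq).trans (mul_le_mul_of_nonneg_right (le_max_left _ _) hk')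
    · rw [((hη.cutoffExt_eventuallyEq_zero hk hq).iteratedFDeriv ℝ m).eq_of_nhds,
        iteratedFDeriv_fun_zero, Pi.zero_apply, norm_zero]
      positivity

theorem exists_isPlaneSymbol_cutoffExt (hM : IsOpen M₀) (hbdd : Bornology.IsBounded M₀) :
    ∃ Q, IsPlaneSymbol δ Q 0 (cutoffExt M₀ η) := by
  obtain ⟨Q, hQ₀, hQ⟩ := hbdd.subset_ball_lt 0 0
  refine ⟨Q, hη.isSymbol_cutoffExt hM, hQ₀.le, fun k _ q hq => ?_⟩
  have hmem : q ∉ M₀ := fun hmem => hq.not_gt (mem_ball_zero_iff.1 (hQ hmem))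
  rw [cutoffExt, Set.indicator_of_notMem hmem, Complex.ofReal_zero]

end IsCutoff

end Cutoff

section Kirchhoff

variable {τ : E2 →ᵃⁱ[ℝ] E3} {M₀ : Set E2} {η : ℝ → E2 → ℝ} {ν α n d : E3} {Λ : ℂ} {k t : ℝ}

theorem IsUnitNormal.height_affineIsometry (h : IsUnitNormal τ ν) (q : E2) :
    height τ ν (τ q) = 0 := by
  simpa using h.height_apply q 0

theorem IsUnitNormal.foot_affineIsometry (h : IsUnitNormal τ ν) (q : E2) : foot τ (τ q) = q := by
  simpa using h.foot_apply q 0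

theorem singleLayer_eq_layer (hM : IsOpen M₀)
    (hwave : ∀ q, phasedWave k d t (τ q) = planeWave k α (τ q)) (r : E3) :
    singleLayer τ M₀ η α k r =
      layer τ (sphericalKernel k) (waveDensity τ d t k (cutoffExt M₀ η k)) r := by
  rw [singleLayer, layer, ← integral_indicator hM.measurableSet]
  congr 1 with q
  by_cases hq : q ∈ M₀ <;>
    simp [hq, waveDensity, hwave, cutoffExt, sphericalWave, sphericalKernel, expI]

theorem doubleLayer_eq_layer (hM : IsOpen M₀)
    (hwave : ∀ q, phasedWave k d t (τ q) = planeWave k α (τ q)) (r : E3) :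
    doubleLayer τ M₀ η α n k r =
      -layer τ (dirDeriv n (sphericalKernel k)) (waveDensity τ d t k (cutoffExt M₀ η k)) r := by
  rw [doubleLayer, layer, ← integral_indicator hM.measurableSet, ← integral_neg]
  congr 1 with q
  by_cases hq : q ∈ M₀ <;> simp [hq, waveDensity, hwave, cutoffExt, fderiv_sphericalWave]

/-- The factor of the single layer potential in the Kirchhoff approximation, divided by `k`. -/
def singleCoeff (α n : E3) (Λ : ℂ) : ℂ :=
  Complex.I / (4 * Real.pi) * (reflCoeff α n Λ - 1) * (inner ℝ n α : ℝ)

/-- The factor of the double layer potential in the Kirchhoff approximation. -/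
def doubleCoeff (α n : E3) (Λ : ℂ) : ℂ := (reflCoeff α n Λ + 1) / (4 * Real.pi)

theorem kirchhoff_eq_combinedLayer (hM : IsOpen M₀)
    (hwave : ∀ q, phasedWave k d t (τ q) = planeWave k α (τ q)) :
    kirchhoff τ M₀ η α n Λ k = combinedLayer τ n d t (singleCoeff α n Λ) (-doubleCoeff α n Λ) k
      (cutoffExt M₀ η k) := by
  ext1 r
  rw [kirchhoff, combinedLayer, singleLayer_eq_layer hM hwave, doubleLayer_eq_layer hM hwave,
    singleCoeff, doubleCoeff]
  ring

theorem combinedLayer_neg_normal (β γ : ℂ) (g : E2 → ℂ) :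
    combinedLayer τ (-n) d t β (-γ) k g = combinedLayer τ n d t β γ k g := by
  ext1 r
  have hneg : dirDeriv (-n) (sphericalKernel k) = fun v => -dirDeriv n (sphericalKernel k) v := by
    ext1 v
    simp [dirDeriv]
  simp only [combinedLayer, hneg, layer, mul_neg, integral_neg, neg_mul, neg_neg]

theorem inner_reflDir (hn : ‖n‖ = 1) : inner ℝ n (reflDir α n) = -inner ℝ n α := by
  rw [reflDir, inner_sub_right, real_inner_smul_right, real_inner_self_eq_norm_sq, hn,
    real_inner_comm n α]
  ring

theorem norm_reflDir (hn : ‖n‖ = 1) : ‖reflDir α n‖ = ‖α‖ := by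
  rw [← sq_eq_sq₀ (norm_nonneg _) (norm_nonneg _), reflDir, norm_sub_sq_real, norm_smul,
    real_inner_smul_right, hn, mul_one, Real.norm_eq_abs, sq_abs]
  ring

theorem isOutgoing_reflDir (h : IsUnitNormal τ n) (hα : ‖α‖ = 1) (hnα : inner ℝ n α < 0) :
    IsOutgoing τ n (reflDir α n) :=
  ⟨h, by rw [norm_reflDir h.norm_eq_one, hα], by rw [inner_reflDir h.norm_eq_one]; linarith⟩

theorem isOutgoing_neg (h : IsUnitNormal τ n) (hα : ‖α‖ = 1) (hnα : inner ℝ n α < 0) :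
    IsOutgoing τ (-n) α :=
  ⟨h.neg, hα, by rw [inner_neg_left]; linarith⟩

theorem phasedWave_reflDir (h : IsUnitNormal τ n) (k : ℝ) (q : E2) :
    phasedWave k (reflDir α n) (phaseShift τ α n) (τ q) = planeWave k α (τ q) := by
  have hheight := h.height_affineIsometry q
  rw [height, inner_sub_right, sub_eq_zero] at hheight
  rw [phasedWave, planeWave, expI, phaseShift, reflDir, inner_sub_left, real_inner_smul_left,
    hheight, sub_add_cancel]

theorem phasedWave_zero_eq_planeWave (k : ℝ) (α r : E3) :
    phasedWave k α 0 r = planeWave k α r := by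
  rw [phasedWave, planeWave, expI, add_zero]

theorem rayAmplitude_reflDir (hn : ‖n‖ = 1) (hnα : inner ℝ n α < 0) :
    rayAmplitude n (reflDir α n) (singleCoeff α n Λ) (-doubleCoeff α n Λ) = reflCoeff α n Λ := by
  have hnα' : ((inner ℝ n α : ℝ) : ℂ) ≠ 0 := by exact_mod_cast hnα.ne
  have hpi : (Real.pi : ℂ) ≠ 0 := by exact_mod_cast Real.pi_ne_zero
  rw [rayAmplitude, inner_reflDir hn, singleCoeff, doubleCoeff]
  push_cast
  field_simp
  ring_nf
  simp only [Complex.I_sq]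
  ring

theorem rayAmplitude_neg_normal (hnα : inner ℝ n α < 0) :
    rayAmplitude (-n) α (singleCoeff α n Λ) (doubleCoeff α n Λ) = -1 := by
  have hnα' : ((inner ℝ n α : ℝ) : ℂ) ≠ 0 := by exact_mod_cast hnα.ne
  have hpi : (Real.pi : ℂ) ≠ 0 := by exact_mod_cast Real.pi_ne_zero
  rw [rayAmplitude, inner_neg_left, singleCoeff, doubleCoeff]
  push_cast
  field_simp
  ring_nf
  simp only [Complex.I_sq]
  ring

end Kirchhoff

section Zones

variable {τ : E2 →ᵃⁱ[ℝ] E3} {ν d : E3} {M₀ : Set E2} {ρ : ℝ} {r : E3}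

theorem continuous_rayBase (τ : E2 →ᵃⁱ[ℝ] E3) (ν d : E3) : Continuous (rayBase τ ν d) :=
  (continuous_foot τ).sub ((continuous_height τ ν).smul continuous_const)

theorem height_neg (τ : E2 →ᵃⁱ[ℝ] E3) (ν r : E3) : height τ (-ν) r = -height τ ν r :=
  inner_neg_left _ _

theorem upperSide_union_upperSide_neg (τ : E2 →ᵃⁱ[ℝ] E3) (ν : E3) :
    upperSide τ ν ∪ upperSide τ (-ν) = {r | height τ ν r ≠ 0} := by
  ext r
  simp [upperSide, height_neg, or_comm]

theorem notMem_upperSide_neg (hr : r ∈ upperSide τ ν) : r ∉ upperSide τ (-ν) := fun hr' => by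
  have hpos : 0 < height τ ν r := hr
  have hneg : 0 < height τ (-ν) r := hr'
  rw [height_neg] at hneg
  linarith

namespace IsUnitNormal

variable (h : IsUnitNormal τ ν)
include h

theorem rayBase_affineIsometry (d : E3) (q : E2) : rayBase τ ν d (τ q) = q := by
  rw [rayBase, h.height_affineIsometry, h.foot_affineIsometry, zero_smul, sub_zero]

theorem add_smul_mem_upperSide (x : E2) {z : ℝ} (hz : 0 < z) : τ x + z • ν ∈ upperSide τ ν :=
  hz.trans_eq (h.height_apply x z).symm

theorem mem_closure_upperSide (hr : 0 ≤ height τ ν r) : r ∈ closure (upperSide τ ν) := by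
  have hcont : Continuous fun s : ℝ => τ (foot τ r) + s • ν := by fun_prop
  have hmem : height τ ν r ∈ closure (Set.Ioi 0) := by rwa [closure_Ioi]
  have := map_mem_closure hcont hmem fun s hs => h.add_smul_mem_upperSide (foot τ r) hs
  rwa [h.foot_add_height] at this

theorem dense_height_ne_zero : Dense {r | height τ ν r ≠ 0} := fun r => by
  rw [← upperSide_union_upperSide_neg, closure_union]
  rcases le_total 0 (height τ ν r) with hr | hr
  · exact Or.inl (h.mem_closure_upperSide hr)
  · exact Or.inr (h.neg.mem_closure_upperSide (by rw [height_neg]; linarith))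

theorem mem_upperBox (hr : r ∈ upperSide τ ν) (hrρ : ‖r‖ < ρ) :
    r ∈ upperBox τ ν (ρ + ‖τ 0‖) := by
  have hpyth := h.norm_tangentPart_sq_add (r - τ 0)
  have hnorm : ‖r - τ 0‖ < ρ + ‖τ 0‖ :=
    (norm_sub_le r (τ 0)).trans_lt (add_lt_add_left hrρ _)
  have hfoot : ‖foot τ r‖ ≤ ‖r - τ 0‖ := by
    refine (sq_le_sq₀ (norm_nonneg _) (norm_nonneg _)).1 ?_
    rw [← hpyth, foot]
    exact le_add_of_nonneg_right (sq_nonneg _)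
  have hheight : height τ ν r ≤ ‖r - τ 0‖ := by
    refine (le_abs_self _).trans (abs_le_of_sq_le_sq ?_ (norm_nonneg _))
    rw [← hpyth, height]
    exact le_add_of_nonneg_left (sq_nonneg _)
  exact ⟨mem_ball_zero_iff.2 (hfoot.trans_lt hnorm), hr, hheight.trans_lt hnorm⟩

end IsUnitNormal

namespace IsOutgoing

variable (h : IsOutgoing τ ν d)
include h

theorem add_smul_dir (q : E2) (s : ℝ) :
    τ q + s • d = τ (q + (s * inner ℝ ν d) • slope τ ν d) + (s * inner ℝ ν d) • ν := by
  conv_lhs => rw [← h.linear_tangentPart_add d]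
  rw [slope, smul_smul, mul_assoc, mul_inv_cancel₀ h.inner_pos.ne', mul_one,
    affineIsometry_apply τ q, affineIsometry_apply τ (q + _), map_add, map_smul, smul_add,
    smul_smul]
  abel

theorem rayBase_add_smul (q : E2) (z : ℝ) :
    rayBase τ ν d (τ (q + z • slope τ ν d) + z • ν) = q := by
  rw [rayBase, h.height_apply, h.foot_apply, add_sub_cancel_right]

theorem rayBase_add_smul_height (r : E3) :
    τ (rayBase τ ν d r + height τ ν r • slope τ ν d) + height τ ν r • ν = r := by
  rw [rayBase, sub_add_cancel, h.foot_add_height]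

theorem rayZone_eq (M₀ : Set E2) :
    rayZone (τ '' M₀) d = upperSide τ ν ∩ rayBase τ ν d ⁻¹' M₀ := by
  ext r
  constructor
  · rintro ⟨-, ⟨q, hq, rfl⟩, s, hs, rfl⟩
    rw [h.add_smul_dir]
    refine ⟨h.add_smul_mem_upperSide _ (mul_pos hs h.inner_pos), ?_⟩
    rwa [Set.mem_preimage, h.rayBase_add_smul]
  · rintro ⟨hr, hbase⟩
    refine ⟨_, ⟨_, hbase, rfl⟩, height τ ν r / inner ℝ ν d, div_pos hr h.inner_pos, ?_⟩
    rw [h.add_smul_dir, div_mul_cancel₀ _ h.inner_pos.ne', h.rayBase_add_smul_height]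

theorem rayZone_subset_upperSide (M₀ : Set E2) : rayZone (τ '' M₀) d ⊆ upperSide τ ν :=
  h.rayZone_eq M₀ ▸ Set.inter_subset_left

theorem isOpen_rayZone (hM : IsOpen M₀) : IsOpen (rayZone (τ '' M₀) d) := by
  rw [h.rayZone_eq]
  exact (isOpen_upperSide τ ν).inter (hM.preimage (continuous_rayBase τ ν d))

theorem closure_rayZone (M₀ : Set E2) : closure (rayZone (τ '' M₀) d) =
    {r | 0 ≤ height τ ν r} ∩ rayBase τ ν d ⁻¹' closure M₀ := by
  refine subset_antisymm (closure_minimal ?_ ?_) ?_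
  · rw [h.rayZone_eq]
    exact Set.inter_subset_inter (fun r (hr : 0 < height τ ν r) => hr.le)
      (Set.preimage_mono subset_closure)
  · exact (isClosed_le continuous_const (continuous_height τ ν)).inter
      (isClosed_closure.preimage (continuous_rayBase τ ν d))
  · rintro r ⟨hr, hbase⟩
    have hcont : Continuous fun p : E2 × ℝ => τ (p.1 + p.2 • slope τ ν d) + p.2 • ν := by
      have := τ.continuous
      fun_prop
    have hmem : (rayBase τ ν d r, height τ ν r) ∈ closure (M₀ ×ˢ Set.Ioi (0 : ℝ)) := by
      rw [closure_prod_eq, closure_Ioi]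
      exact ⟨hbase, hr⟩
    have := map_mem_closure (t := rayZone (τ '' M₀) d) hcont hmem fun p hp => by
      rw [h.rayZone_eq]
      refine ⟨h.add_smul_mem_upperSide _ hp.2, ?_⟩
      rw [Set.mem_preimage, h.rayBase_add_smul]
      exact hp.1
    rwa [h.rayBase_add_smul_height] at this

theorem mem_frontier_rayZone (hM : IsOpen M₀) (hr : 0 ≤ height τ ν r)
    (hbase : rayBase τ ν d r ∈ frontier M₀) : r ∈ frontier (rayZone (τ '' M₀) d) := by
  rw [hM.frontier_eq] at hbase
  rw [(h.isOpen_rayZone hM).frontier_eq, h.closure_rayZone, h.rayZone_eq]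
  exact ⟨⟨hr, hbase.1⟩, fun hmem => hbase.2 hmem.2⟩

theorem image_subset_frontier_rayZone (hM : IsOpen M₀) :
    τ '' M₀ ⊆ frontier (rayZone (τ '' M₀) d) := by
  rintro - ⟨q, hq, rfl⟩
  rw [(h.isOpen_rayZone hM).frontier_eq, h.closure_rayZone, h.rayZone_eq]
  refine ⟨⟨(h.height_affineIsometry q).ge, ?_⟩, fun hmem => ?_⟩
  · rw [Set.mem_preimage, h.rayBase_affineIsometry]
    exact subset_closure hq
  · exact hmem.1.ne' (h.height_affineIsometry q)

end IsOutgoing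

end Zones

section Eikonal

variable {τ : E2 →ᵃⁱ[ℝ] E3} {M₀ : Set E2} {α n r : E3} {Λ : ℂ} {k : ℝ}

theorem eikonal_of_mem_shadowZone (hr : r ∈ rayZone (τ '' M₀) α) :
    eikonal τ M₀ α n Λ k r = -1 * phasedWave k α 0 r := by
  rw [eikonal, shadowZone, if_pos hr, phasedWave_zero_eq_planeWave, neg_one_mul]

theorem eikonal_of_mem_reflectedZone (hr : r ∈ rayZone (τ '' M₀) (reflDir α n))
    (hr' : r ∉ rayZone (τ '' M₀) α) :
    eikonal τ M₀ α n Λ k r =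
      reflCoeff α n Λ * phasedWave k (reflDir α n) (phaseShift τ α n) r := by
  rw [eikonal, shadowZone, reflectedZone, if_neg hr', if_pos hr, phasedWave, expI]

theorem eikonal_of_notMem (hr : r ∉ rayZone (τ '' M₀) (reflDir α n))
    (hr' : r ∉ rayZone (τ '' M₀) α) : eikonal τ M₀ α n Λ k r = 0 := by
  rw [eikonal, shadowZone, reflectedZone, if_neg hr', if_neg hr]

theorem eikonal_eventuallyEq_zero (hr : r ∈ outerZone (τ '' M₀) α n) :
    eikonal τ M₀ α n Λ k =ᶠ[𝓝 r] fun _ => 0 := by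
  filter_upwards [isClosed_closure.isOpen_compl.mem_nhds hr] with s hs
  exact eikonal_of_notMem (fun hs' => hs (subset_closure (Or.inl hs')))
    fun hs' => hs (subset_closure (Or.inr hs'))

end Eikonal

section FirstOrderLimits

/-- `f` and its gradient have limits at `r` from within `Z`. -/
def HasC1Limit (Z : Set E3) (f : E3 → ℂ) (r : E3) : Prop :=
  (∃ u, Tendsto f (𝓝[Z] r) (𝓝 u)) ∧ ∃ U, Tendsto (fderiv ℝ f) (𝓝[Z] r) (𝓝 U)

variable {Y Z : Set E3} {f g : E3 → ℂ} {r : E3} {a b : ℝ}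

theorem HasC1Limit.mono (hf : HasC1Limit Z f r) (hYZ : Y ⊆ Z) : HasC1Limit Y f r :=
  ⟨hf.1.imp fun _ h => h.mono_left (nhdsWithin_mono r hYZ),
    hf.2.imp fun _ h => h.mono_left (nhdsWithin_mono r hYZ)⟩

theorem HasC1Limit.congr (hg : HasC1Limit Z g r) (hfg : ∀ s ∈ Z, f =ᶠ[𝓝 s] g) :
    HasC1Limit Z f r :=
  ⟨hg.1.imp fun _ h => h.congr' (eventually_nhdsWithin_of_forall fun s hs =>
      (hfg s hs).eq_of_nhds.symm),
    hg.2.imp fun _ h => h.congr' (eventually_nhdsWithin_of_forall fun s hs =>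
      (hfg s hs).fderiv_eq.symm)⟩

theorem hasC1Limit_of_contDiffAt (hf : ContDiffAt ℝ 1 f r) (Z : Set E3) : HasC1Limit Z f r :=
  ⟨⟨_, hf.continuousAt.continuousWithinAt⟩,
    ⟨_, (hf.fderiv_right (m := 0) le_rfl).continuousAt.continuousWithinAt⟩⟩

theorem OneSidedClose.of_frequently (hf : HasC1Limit Z f r) (hg : HasC1Limit Z g r)
    (h : ∃ᶠ s in 𝓝[Z] r, ‖f s - g s‖ ≤ a ∧ ‖fderiv ℝ f s - fderiv ℝ g s‖ ≤ b) :
    OneSidedClose Z f g r a b := by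
  obtain ⟨⟨u, hu⟩, U, hU⟩ := hf
  obtain ⟨⟨v, hv⟩, V, hV⟩ := hg
  exact ⟨u, v, U, V, hu, hv, hU, hV,
    le_of_tendsto_of_frequently (hu.sub hv).norm (h.mono fun s hs => hs.1),
    le_of_tendsto_of_frequently (hU.sub hV).norm (h.mono fun s hs => hs.2)⟩

theorem norm_sub_le_of_frequently (hf : ContDiffAt ℝ 1 f r) (hg : ContDiffAt ℝ 1 g r)
    (h : ∃ᶠ s in 𝓝 r, ‖f s - g s‖ ≤ a ∧ ‖fderiv ℝ f s - fderiv ℝ g s‖ ≤ b) :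
    ‖f r - g r‖ ≤ a ∧ ‖fderiv ℝ f r - fderiv ℝ g r‖ ≤ b :=
  have hderiv := (hf.fderiv_right (m := 0) le_rfl).continuousAt.sub
    (hg.fderiv_right (m := 0) le_rfl).continuousAt
  ⟨le_of_tendsto_of_frequently (hf.continuousAt.sub hg.continuousAt).norm
      (h.mono fun _ hs => hs.1),
    le_of_tendsto_of_frequently hderiv.norm (h.mono fun _ hs => hs.2)⟩

/-- Uniformly on the sets `I k`, the difference of `Φ k` and `ψ k` is `O(k ^ a)` and that of their
gradients is `O(k ^ b)`. -/
structure IsUnifC1Close (I : ℝ → Set E3) (a b : ℝ) (Φ ψ : ℝ → E3 → ℂ) : Prop where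
  value : IsUnifBigO I a fun k r => Φ k r - ψ k r
  gradient : IsUnifBigO I b fun k r => fderiv ℝ (Φ k) r - fderiv ℝ (ψ k) r

variable {I J : ℝ → Set E3} {Φ ψ : ℝ → E3 → ℂ}

theorem IsUnifC1Close.union (hI : IsUnifC1Close I a b Φ ψ) (hJ : IsUnifC1Close J a b Φ ψ) :
    IsUnifC1Close (fun k => I k ∪ J k) a b Φ ψ :=
  ⟨hI.value.union hJ.value, hI.gradient.union hJ.gradient⟩

theorem IsUnifC1Close.exists_bound (h : IsUnifC1Close I a b Φ ψ) :
    ∃ C, ∀ k, 1 < k → ∀ r ∈ I k,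
      ‖Φ k r - ψ k r‖ ≤ C * k ^ a ∧ ‖fderiv ℝ (Φ k) r - fderiv ℝ (ψ k) r‖ ≤ C * k ^ b := by
  obtain ⟨C₁, -, hC₁⟩ := h.value.exists_bound
  obtain ⟨C₂, -, hC₂⟩ := h.gradient.exists_bound
  refine ⟨max C₁ C₂, fun k hk r hr => ⟨(hC₁ k hk r hr).trans ?_, (hC₂ k hk r hr).trans ?_⟩⟩
  all_goals
    have : 0 < k := one_pos.trans hk
    gcongr
  exacts [le_max_left _ _, le_max_right _ _]

end FirstOrderLimits

section RadiatingSide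

/-- On the side of the plane of `M = τ(M₀)` that `ν` points to, `Φ` is a layer potential with the
density `η e^{ik (d · q + t)}`, and `ψ` is the wave `B e^{ik (d · r + t)}` in the zone covered by
the rays of direction `d` from `M`, and zero elsewhere. Both the reflected and the shadow side of
the plane are of this form. -/
structure IsRadiatingSide (δ : ℝ) (τ : E2 →ᵃⁱ[ℝ] E3) (M₀ : Set E2) (η : ℝ → E2 → ℝ) (ν d : E3)
    (t : ℝ) (B : ℂ) (Φ ψ : ℝ → E3 → ℂ) : Prop where
  isOpen : IsOpen M₀
  isBounded : Bornology.IsBounded M₀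
  cutoff : IsCutoff δ M₀ η
  outgoing : IsOutgoing τ ν d
  exists_combinedLayer : ∃ β γ, rayAmplitude ν d β γ = B ∧
    ∀ k, Φ k = combinedLayer τ ν d t β γ k (cutoffExt M₀ η k)
  eq_wave : ∀ k, ∀ r ∈ rayZone (τ '' M₀) d, ψ k r = B * phasedWave k d t r
  eq_zero : ∀ k, ∀ r ∈ upperSide τ ν, r ∉ rayZone (τ '' M₀) d → ψ k r = 0

/-- The points on the side of `ν` in the ball of radius `ρ` whose rays of direction `d` start from
points where a cut-off function of `M₀` is locally constant. -/
def clearPoints (τ : E2 →ᵃⁱ[ℝ] E3) (ν d : E3) (M₀ : Set E2) (δ ρ k : ℝ) : Set E3 :=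
  {r | r ∈ upperSide τ ν ∧ ‖r‖ < ρ ∧ 2 * k ^ (-δ) < Metric.infDist (rayBase τ ν d r) (frontier M₀)}

theorem fderiv_const_mul_phasedWave (B : ℂ) (k : ℝ) (d : E3) (t : ℝ) (r : E3) :
    fderiv ℝ (fun r => B * phasedWave k d t r) r = B • fderiv ℝ (phasedWave k d t) r :=
  fderiv_const_mul ((contDiff_phasedWave k d t).differentiable (by simp) r) B

theorem norm_fderiv_phasedWave_le {k : ℝ} (hk : 0 ≤ k) (d : E3) (t : ℝ) (r : E3) :
    ‖fderiv ℝ (phasedWave k d t) r‖ ≤ k * ‖d‖ := by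
  refine ContinuousLinearMap.opNorm_le_bound _ (by positivity) fun v => ?_
  rw [fderiv_phasedWave_apply, norm_mul, norm_mul, Complex.norm_I, Complex.norm_real,
    norm_phasedWave, one_mul, mul_one, norm_mul, Real.norm_of_nonneg hk, mul_assoc]
  exact mul_le_mul_of_nonneg_left (norm_inner_le_norm d v) hk

variable {δ t : ℝ} {τ : E2 →ᵃⁱ[ℝ] E3} {M₀ : Set E2} {η : ℝ → E2 → ℝ} {ν d r : E3} {B : ℂ}
  {Φ ψ : ℝ → E3 → ℂ} {k ρ : ℝ}

theorem eventually_two_mul_rpow_neg_lt {ε : ℝ} (hδ : 0 < δ) (hε : 0 < ε) :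
    ∀ᶠ k : ℝ in atTop, 2 * k ^ (-δ) < ε := by
  have h := (tendsto_rpow_neg_atTop hδ).const_mul 2
  rw [mul_zero] at h
  exact h.eventually (gt_mem_nhds hε)

theorem eventually_mem_clearPoints (hδ : 0 < δ) (hfr : (frontier M₀).Nonempty) {K : Set E3}
    (hK : IsCompact K) (hKρ : K ⊆ Metric.ball 0 ρ)
    (hbase : ∀ r ∈ K, 0 ≤ height τ ν r → rayBase τ ν d r ∉ frontier M₀) :
    ∀ᶠ k in atTop, ∀ r ∈ K, ∀ᶠ s in 𝓝[upperSide τ ν] r, s ∈ clearPoints τ ν d M₀ δ ρ k := by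
  have hcont : Continuous fun r => Metric.infDist (rayBase τ ν d r) (frontier M₀) :=
    (Metric.continuous_infDist_pt _).comp (continuous_rayBase τ ν d)
  have hclosed : IsClosed {r | 0 ≤ height τ ν r} :=
    isClosed_le continuous_const (continuous_height τ ν)
  obtain ⟨ε, hε, hKε⟩ := (hK.inter_right hclosed).exists_forall_le' hcont.continuousOn (a := 0)
    fun r hr => (isClosed_frontier.notMem_iff_infDist_pos hfr).1 (hbase r hr.1 hr.2)
  filter_upwards [eventually_two_mul_rpow_neg_lt hδ hε] with k hk r hr
  by_cases hheight : 0 ≤ height τ ν r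
  · filter_upwards [self_mem_nhdsWithin,
      mem_nhdsWithin_of_mem_nhds (Metric.isOpen_ball.mem_nhds (hKρ hr)),
      mem_nhdsWithin_of_mem_nhds (hcont.continuousAt.eventually
        (lt_mem_nhds (hk.trans_le (hKε r ⟨hr, hheight⟩))))] with s hs hsρ hsd
    exact ⟨hs, mem_ball_zero_iff.1 hsρ, hsd⟩
  · filter_upwards [self_mem_nhdsWithin,
      mem_nhdsWithin_of_mem_nhds (hclosed.isOpen_compl.mem_nhds hheight)] with s hs hs'
    exact (hs' (show 0 < height τ ν s from hs).le).elim

end RadiatingSide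

namespace IsRadiatingSide

variable {δ t : ℝ} {τ : E2 →ᵃⁱ[ℝ] E3} {M₀ : Set E2} {η : ℝ → E2 → ℝ} {ν d r : E3} {B : ℂ}
  {Φ ψ : ℝ → E3 → ℂ} {k ρ : ℝ} (h : IsRadiatingSide δ τ M₀ η ν d t B Φ ψ)
include h

theorem eventuallyEq_wave (k : ℝ) (hr : r ∈ rayZone (τ '' M₀) d) :
    ψ k =ᶠ[𝓝 r] fun r => B * phasedWave k d t r := by
  filter_upwards [(h.outgoing.isOpen_rayZone h.isOpen).mem_nhds hr] with s hs
    using h.eq_wave k s hs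

theorem eventuallyEq_zero (k : ℝ) (hr : r ∈ upperSide τ ν)
    (hr' : r ∉ closure (rayZone (τ '' M₀) d)) : ψ k =ᶠ[𝓝 r] fun _ => 0 := by
  filter_upwards [(isOpen_upperSide τ ν).mem_nhds hr,
    isClosed_closure.isOpen_compl.mem_nhds hr'] with s hs hs'
    using h.eq_zero k s hs fun hmem => hs' (subset_closure hmem)

theorem exists_eventuallyEq_of_mem_clearPoints (hk : 1 < k)
    (hr : r ∈ clearPoints τ ν d M₀ δ ρ k) :
    ∃ u : ℂ, cutoffExt M₀ η k =ᶠ[𝓝 (rayBase τ ν d r)] (fun _ => u) ∧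
      ψ k =ᶠ[𝓝 r] fun r => B * u * phasedWave k d t r := by
  obtain ⟨hr, -, hdist⟩ := hr
  by_cases hbase : rayBase τ ν d r ∈ M₀
  · refine ⟨1, h.cutoff.cutoffExt_eventuallyEq_one h.isOpen hk hbase hdist, ?_⟩
    rw [mul_one]
    exact h.eventuallyEq_wave k (h.outgoing.rayZone_eq M₀ ▸ ⟨hr, hbase⟩)
  · refine ⟨0, h.cutoff.cutoffExt_eventuallyEq_zero hk hbase, ?_⟩
    simp only [mul_zero, zero_mul]
    refine h.eventuallyEq_zero k hr fun hmem => ?_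
    rw [h.outgoing.closure_rayZone] at hmem
    have hfr : rayBase τ ν d r ∈ frontier M₀ := h.isOpen.frontier_eq ▸ ⟨hmem.2, hbase⟩
    rw [Metric.infDist_zero_of_mem hfr] at hdist
    have : 0 < k ^ (-δ) := Real.rpow_pos_of_pos (one_pos.trans hk) _
    linarith

theorem clearPoints_subset_flatPoints (hk : 1 < k) : clearPoints τ ν d M₀ δ ρ k ⊆
    flatPoints τ ν d (ρ + ‖τ 0‖) (cutoffExt M₀ η) k := by
  intro r hr
  obtain ⟨u, hu, -⟩ := h.exists_eventuallyEq_of_mem_clearPoints hk hr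
  exact ⟨h.outgoing.mem_upperBox hr.1 hr.2.1, u, hu⟩

theorem norm_wave_le (hr : r ∈ upperSide τ ν) : ‖ψ k r‖ ≤ ‖B‖ := by
  by_cases hmem : r ∈ rayZone (τ '' M₀) d
  · rw [h.eq_wave k r hmem, norm_mul, norm_phasedWave, mul_one]
  · rw [h.eq_zero k r hr hmem, norm_zero]
    exact norm_nonneg B

theorem norm_fderiv_wave_le (hk : 0 ≤ k) (hr : r ∈ upperSide τ ν)
    (hr' : r ∉ frontier (rayZone (τ '' M₀) d)) : ‖fderiv ℝ (ψ k) r‖ ≤ ‖B‖ * k := by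
  by_cases hmem : r ∈ rayZone (τ '' M₀) d
  · rw [(h.eventuallyEq_wave k hmem).fderiv_eq, fderiv_const_mul_phasedWave, norm_smul]
    gcongr
    simpa [h.outgoing.norm_dir] using norm_fderiv_phasedWave_le hk d t r
  · rw [(h.outgoing.isOpen_rayZone h.isOpen).frontier_eq] at hr'
    rw [(h.eventuallyEq_zero k hr fun hcl => hr' ⟨hcl, hmem⟩).fderiv_eq, fderiv_fun_const,
      Pi.zero_apply, norm_zero]
    positivity

theorem hasC1Limit_wave (k : ℝ) (r : E3) : HasC1Limit (rayZone (τ '' M₀) d) (ψ k) r :=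
  (hasC1Limit_of_contDiffAt (contDiff_const.mul ((contDiff_phasedWave k d t).of_le
    (by exact_mod_cast le_top))).contDiffAt _).congr fun _ hs => h.eventuallyEq_wave k hs

theorem contDiffAt_field (hk : 1 < k) (hr : r ∉ τ '' M₀) : ContDiffAt ℝ 1 (Φ k) r := by
  obtain ⟨β, γ, -, hΦ⟩ := h.exists_combinedLayer
  obtain ⟨Q, hg⟩ := h.cutoff.exists_isPlaneSymbol_cutoffExt h.isOpen h.isBounded
  have hsmooth := hg.symbol.smooth k hk
  have hcompact := hg.hasCompactSupport hk
  have hmem : r ∈ (τ '' tsupport (cutoffExt M₀ η k))ᶜ := fun hmem =>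
    hr (Set.image_mono (h.cutoff.tsupport_cutoffExt_subset hk) hmem)
  rw [hΦ k, contDiffAt_one_iff]
  refine ⟨fderiv ℝ _, _, (isOpen_compl_image_tsupport τ.continuous hcompact).mem_nhds hmem,
    fun s hs => ?_, fun s hs =>
      (hasFDerivAt_combinedLayer hsmooth hcompact hs).differentiableAt.hasFDerivAt⟩
  obtain ⟨U, hU⟩ := h.outgoing.exists_tendsto_fderiv_combinedLayer_of_notMem hsmooth hcompact hs
    t β γ
  exact (continuousAt_of_tendsto_nhds hU).continuousWithinAt

theorem hasC1Limit_field (hk : 1 < k) (hr : 0 ≤ height τ ν r) :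
    HasC1Limit (upperSide τ ν) (Φ k) r := by
  obtain ⟨β, γ, -, hΦ⟩ := h.exists_combinedLayer
  obtain ⟨Q, hg⟩ := h.cutoff.exists_isPlaneSymbol_cutoffExt h.isOpen h.isBounded
  rw [hΦ k]
  have hsmooth := hg.symbol.smooth k hk
  have hcompact := hg.hasCompactSupport hk
  exact ⟨h.outgoing.exists_tendsto_combinedLayer hsmooth hcompact hr t β γ,
    h.outgoing.exists_tendsto_fderiv_combinedLayer hsmooth hcompact hr t β γ⟩

theorem oneSidedClose (hk : 1 < k) (hr : r ∈ closure (rayZone (τ '' M₀) d)) {a b : ℝ}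
    (hclose : ∀ᶠ s in 𝓝[rayZone (τ '' M₀) d] r,
      ‖Φ k s - ψ k s‖ ≤ a ∧ ‖fderiv ℝ (Φ k) s - fderiv ℝ (ψ k) s‖ ≤ b) :
    OneSidedClose (rayZone (τ '' M₀) d) (Φ k) (ψ k) r a b := by
  have := mem_closure_iff_nhdsWithin_neBot.1 hr
  rw [h.outgoing.closure_rayZone] at hr
  exact .of_frequently ((h.hasC1Limit_field hk hr.1).mono (h.outgoing.rayZone_subset_upperSide M₀))
    (h.hasC1Limit_wave k r) hclose.frequently

theorem isUnifC1Close_clearPoints (hδ : 0 < δ) (hδ₁ : δ < 1 / 2) (hρ : 0 ≤ ρ) (a b : ℝ) :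
    IsUnifC1Close (clearPoints τ ν d M₀ δ ρ) a b Φ ψ := by
  obtain ⟨β, γ, hB, hΦ⟩ := h.exists_combinedLayer
  obtain ⟨Q, hg⟩ := h.cutoff.exists_isPlaneSymbol_cutoffExt h.isOpen h.isBounded
  have hρ' : 0 ≤ ρ + ‖τ 0‖ := by positivity
  constructor
  · refine ((h.outgoing.isUnifBigO_combinedLayer_sub_rayWave hg hδ₁ hρ' hδ.le t β γ
      (-a)).mono_exponent (neg_neg a).le).mono_set (J := clearPoints τ ν d M₀ δ ρ)
      (fun k hk => h.clearPoints_subset_flatPoints hk) |>.congr fun k hk r hr => ?_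
    obtain ⟨u, hu, hψ⟩ := h.exists_eventuallyEq_of_mem_clearPoints hk hr
    rw [hΦ, hψ.eq_of_nhds, hB, rayWave, hu.eq_of_nhds, mul_assoc]
  · refine ((h.outgoing.isUnifBigO_fderiv_combinedLayer_sub hg hδ₁ hρ' hδ t β γ
      (-b)).mono_exponent (neg_neg b).le).mono_set (J := clearPoints τ ν d M₀ δ ρ)
      (fun k hk => h.clearPoints_subset_flatPoints hk) |>.congr fun k hk r hr => ?_
    obtain ⟨u, hu, hψ⟩ := h.exists_eventuallyEq_of_mem_clearPoints hk hr
    rw [hΦ, hψ.fderiv_eq, hB, hu.eq_of_nhds, fderiv_const_mul_phasedWave]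

theorem isUnifC1Close_upperSide (hδ : 0 < δ) (hδ₁ : δ < 1 / 2) (hρ : 0 ≤ ρ) :
    IsUnifC1Close (fun _ => (upperSide τ ν ∩ Metric.ball 0 ρ) \ frontier (rayZone (τ '' M₀) d))
      0 1 Φ ψ := by
  obtain ⟨β, γ, -, hΦ⟩ := h.exists_combinedLayer
  obtain ⟨Q, hg⟩ := h.cutoff.exists_isPlaneSymbol_cutoffExt h.isOpen h.isBounded
  have hρ' : 0 ≤ ρ + ‖τ 0‖ := by positivity
  have hsub : (upperSide τ ν ∩ Metric.ball 0 ρ) \ frontier (rayZone (τ '' M₀) d) ⊆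
      upperBox τ ν (ρ + ‖τ 0‖) := fun r hr =>
    h.outgoing.mem_upperBox hr.1.1 (mem_ball_zero_iff.1 hr.1.2)
  refine ⟨.sub ?_ (.of_bound ‖B‖ fun k _ r hr => ?_),
    .sub ?_ (.of_bound ‖B‖ fun k hk r hr => ?_)⟩
  · refine (((h.outgoing.isUnifBigO_combinedLayer hg hδ₁ hρ' hδ.le t β γ).mono_exponent
      (mul_zero δ).le).mono_set fun _ _ => hsub).congr fun k _ r _ => by rw [hΦ]
  · rw [Real.rpow_zero, mul_one]
    exact h.norm_wave_le hr.1.1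
  · refine (((h.outgoing.isUnifBigO_fderiv_combinedLayer hg hδ₁ hρ' hδ t β γ).mono_exponent
      (by simp)).mono_set fun _ _ => hsub).congr fun k _ r _ => by rw [hΦ]
  · rw [Real.rpow_one]
    exact h.norm_fderiv_wave_le (one_pos.trans hk).le hr.1.1 hr.2

end IsRadiatingSide

section Screen

/-- A plane wave of direction `α` falls on the bounded screen `M = τ(M₀)` against its unit normal
`n`, and `η` is an admissible cut-off function for the exponent `δ`. -/
structure IsIlluminatedScreen (δ : ℝ) (τ : E2 →ᵃⁱ[ℝ] E3) (M₀ : Set E2) (η : ℝ → E2 → ℝ)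
    (α n : E3) : Prop where
  isOpen : IsOpen M₀
  isBounded : Bornology.IsBounded M₀
  nonempty : M₀.Nonempty
  exponent_pos : 0 < δ
  exponent_lt : δ < 1 / 2
  cutoff : IsCutoff δ M₀ η
  isUnitNormal : IsUnitNormal τ n
  norm_dir : ‖α‖ = 1
  inner_neg : inner ℝ n α < 0

namespace IsIlluminatedScreen

variable {δ : ℝ} {τ : E2 →ᵃⁱ[ℝ] E3} {M₀ : Set E2} {η : ℝ → E2 → ℝ} {α n r : E3} {K : Set E3}
  {k ρ : ℝ} (h : IsIlluminatedScreen δ τ M₀ η α n)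
include h

theorem nonempty_frontier : (frontier M₀).Nonempty :=
  nonempty_frontier_iff.2
    ⟨h.nonempty, fun huniv => NormedSpace.unbounded_univ ℝ E2 (huniv ▸ h.isBounded)⟩

theorem isOutgoing_reflDir : IsOutgoing τ n (reflDir α n) :=
  KirchhoffPolygon.isOutgoing_reflDir h.isUnitNormal h.norm_dir h.inner_neg

theorem isOutgoing_neg : IsOutgoing τ (-n) α :=
  KirchhoffPolygon.isOutgoing_neg h.isUnitNormal h.norm_dir h.inner_neg

theorem reflectedZone_subset : reflectedZone (τ '' M₀) α n ⊆ upperSide τ n :=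
  h.isOutgoing_reflDir.rayZone_subset_upperSide M₀

theorem shadowZone_subset : shadowZone (τ '' M₀) α ⊆ upperSide τ (-n) :=
  h.isOutgoing_neg.rayZone_subset_upperSide M₀

theorem isOpen_reflectedZone : IsOpen (reflectedZone (τ '' M₀) α n) :=
  h.isOutgoing_reflDir.isOpen_rayZone h.isOpen

theorem isOpen_shadowZone : IsOpen (shadowZone (τ '' M₀) α) :=
  h.isOutgoing_neg.isOpen_rayZone h.isOpen

theorem isRadiatingSide_reflected (Λ : ℂ) :
    IsRadiatingSide δ τ M₀ η n (reflDir α n) (phaseShift τ α n) (reflCoeff α n Λ)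
      (kirchhoff τ M₀ η α n Λ) (eikonal τ M₀ α n Λ) where
  isOpen := h.isOpen
  isBounded := h.isBounded
  cutoff := h.cutoff
  outgoing := h.isOutgoing_reflDir
  exists_combinedLayer :=
    ⟨_, _, rayAmplitude_reflDir h.isUnitNormal.norm_eq_one h.inner_neg, fun k =>
      kirchhoff_eq_combinedLayer h.isOpen (phasedWave_reflDir h.isUnitNormal k)⟩
  eq_wave _ _ hr := eikonal_of_mem_reflectedZone hr fun hr' =>
    notMem_upperSide_neg (h.reflectedZone_subset hr) (h.shadowZone_subset hr')
  eq_zero _ _ hr hr' := eikonal_of_notMem hr' fun hr'' =>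
    notMem_upperSide_neg hr (h.shadowZone_subset hr'')

theorem isRadiatingSide_shadow (Λ : ℂ) :
    IsRadiatingSide δ τ M₀ η (-n) α 0 (-1) (kirchhoff τ M₀ η α n Λ) (eikonal τ M₀ α n Λ) where
  isOpen := h.isOpen
  isBounded := h.isBounded
  cutoff := h.cutoff
  outgoing := h.isOutgoing_neg
  exists_combinedLayer :=
    ⟨singleCoeff α n Λ, doubleCoeff α n Λ, rayAmplitude_neg_normal h.inner_neg, fun k => by
      rw [kirchhoff_eq_combinedLayer h.isOpen fun q => phasedWave_zero_eq_planeWave k α (τ q),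
        ← combinedLayer_neg_normal, neg_neg]⟩
  eq_wave _ _ hr := eikonal_of_mem_shadowZone hr
  eq_zero _ _ hr hr' := eikonal_of_notMem (fun hr'' =>
    notMem_upperSide_neg (h.reflectedZone_subset hr'') hr) hr'

theorem contDiffAt_kirchhoff (Λ : ℂ) (hk : 1 < k) (hr : r ∉ τ '' M₀) :
    ContDiffAt ℝ 1 (kirchhoff τ M₀ η α n Λ k) r :=
  (h.isRadiatingSide_reflected Λ).contDiffAt_field hk hr

theorem contDiffAt_eikonal (Λ : ℂ) (k : ℝ)
    (hr : r ∈ (frontier (reflectedZone (τ '' M₀) α n) ∪ frontier (shadowZone (τ '' M₀) α))ᶜ) :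
    ContDiffAt ℝ 1 (eikonal τ M₀ α n Λ k) r := by
  have hwave (B : ℂ) (d : E3) (t : ℝ) : ContDiffAt ℝ 1 (fun r => B * phasedWave k d t r) r :=
    contDiffAt_const.mul ((contDiff_phasedWave k d t).of_le (by exact_mod_cast le_top)).contDiffAt
  rw [Set.mem_compl_iff, h.isOpen_reflectedZone.frontier_eq, h.isOpen_shadowZone.frontier_eq] at hr
  by_cases hR : r ∈ reflectedZone (τ '' M₀) α n
  · exact (hwave _ _ _).congr_of_eventuallyEq
      ((h.isRadiatingSide_reflected Λ).eventuallyEq_wave k hR)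
  by_cases hS : r ∈ shadowZone (τ '' M₀) α
  · exact (hwave _ _ _).congr_of_eventuallyEq
      ((h.isRadiatingSide_shadow Λ).eventuallyEq_wave k hS)
  refine contDiffAt_const.congr_of_eventuallyEq (eikonal_eventuallyEq_zero ?_)
  rw [outerZone, closure_union]
  exact fun hmem => hr (hmem.imp (⟨·, hR⟩) (⟨·, hS⟩))

theorem notMem_image_of_notMem_frontier (hr : r ∉ frontier (reflectedZone (τ '' M₀) α n)) :
    r ∉ τ '' M₀ :=
  fun hmem => hr (h.isOutgoing_reflDir.image_subset_frontier_rayZone h.isOpen hmem)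

theorem notMem_image_of_mem_closure_outerZone (hr : r ∈ closure (outerZone (τ '' M₀) α n)) :
    r ∉ τ '' M₀ := by
  rintro ⟨q, hq, rfl⟩
  have hbase (ν d : E3) (hν : IsUnitNormal τ ν) : ∀ᶠ s in 𝓝 (τ q), rayBase τ ν d s ∈ M₀ :=
    (continuous_rayBase τ ν d).continuousAt.eventually
      (h.isOpen.mem_nhds (by rwa [hν.rayBase_affineIsometry]))
  obtain ⟨s, hs, hsR, hsS⟩ := ((mem_closure_iff_frequently.1 hr).and_eventually
    ((hbase n (reflDir α n) h.isUnitNormal).and (hbase (-n) α h.isUnitNormal.neg))).exists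
  refine hs ?_
  rw [closure_union, reflectedZone, shadowZone, h.isOutgoing_reflDir.closure_rayZone,
    h.isOutgoing_neg.closure_rayZone]
  rcases le_total 0 (height τ n s) with hheight | hheight
  · exact Or.inl ⟨hheight, subset_closure hsR⟩
  · refine Or.inr ⟨?_, subset_closure hsS⟩
    rw [Set.mem_ofPred_eq, height_neg]
    exact neg_nonneg.2 hheight

end IsIlluminatedScreen

end Screen

section Asymptotics

namespace IsIlluminatedScreen

variable {δ : ℝ} {τ : E2 →ᵃⁱ[ℝ] E3} {M₀ : Set E2} {η : ℝ → E2 → ℝ} {α n r : E3} {K : Set E3}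
  {k ρ a b : ℝ} {Λ : ℂ} (h : IsIlluminatedScreen δ τ M₀ η α n)
include h

theorem isUnifC1Close_clearPoints (Λ : ℂ) (hρ : 0 ≤ ρ) (a b : ℝ) :
    IsUnifC1Close
      (fun k => clearPoints τ n (reflDir α n) M₀ δ ρ k ∪ clearPoints τ (-n) α M₀ δ ρ k) a b
      (kirchhoff τ M₀ η α n Λ) (eikonal τ M₀ α n Λ) :=
  ((h.isRadiatingSide_reflected Λ).isUnifC1Close_clearPoints h.exponent_pos h.exponent_lt hρ a
    b).union
    ((h.isRadiatingSide_shadow Λ).isUnifC1Close_clearPoints h.exponent_pos h.exponent_lt hρ a b)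

theorem exists_eventually_oneSidedClose (Λ : ℂ) (hKM : K ⊆ τ '' M₀) (hK : IsCompact K) (a b : ℝ) :
    ∃ C : ℝ, ∀ᶠ k : ℝ in atTop, ∀ r ∈ K,
      OneSidedClose (reflectedZone (τ '' M₀) α n) (kirchhoff τ M₀ η α n Λ k)
        (eikonal τ M₀ α n Λ k) r (C * k ^ a) (C * k ^ b) ∧
      OneSidedClose (shadowZone (τ '' M₀) α) (kirchhoff τ M₀ η α n Λ k)
        (eikonal τ M₀ α n Λ k) r (C * k ^ a) (C * k ^ b) := by
  obtain ⟨ρ, hρ, hKρ⟩ := hK.isBounded.subset_ball_lt 0 0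
  obtain ⟨C, hC⟩ := (h.isUnifC1Close_clearPoints Λ hρ.le a b).exists_bound
  have hbase (ν d : E3) (hν : IsUnitNormal τ ν) :
      ∀ r ∈ K, 0 ≤ height τ ν r → rayBase τ ν d r ∉ frontier M₀ := by
    intro r hr _
    obtain ⟨q, hq, rfl⟩ := hKM hr
    rw [hν.rayBase_affineIsometry, h.isOpen.frontier_eq]
    exact fun hfr => hfr.2 hq
  refine ⟨C, ?_⟩
  filter_upwards [eventually_gt_atTop 1,
    eventually_mem_clearPoints h.exponent_pos h.nonempty_frontier hK hKρ
      (hbase n (reflDir α n) h.isUnitNormal),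
    eventually_mem_clearPoints h.exponent_pos h.nonempty_frontier hK hKρ
      (hbase (-n) α h.isUnitNormal.neg)] with k hk hclear hclear' r hr
  exact ⟨(h.isRadiatingSide_reflected Λ).oneSidedClose hk
      (h.isOutgoing_reflDir.image_subset_frontier_rayZone h.isOpen (hKM hr)).1
      (((hclear r hr).filter_mono (nhdsWithin_mono r h.reflectedZone_subset)).mono
        fun s hs => hC k hk s (Or.inl hs)),
    (h.isRadiatingSide_shadow Λ).oneSidedClose hk
      (h.isOutgoing_neg.image_subset_frontier_rayZone h.isOpen (hKM hr)).1
      (((hclear' r hr).filter_mono (nhdsWithin_mono r h.shadowZone_subset)).mono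
        fun s hs => hC k hk s (Or.inr hs))⟩

theorem norm_sub_le_of_eventually_upperSide (hk : 1 < k)
    (hr : r ∈ (frontier (reflectedZone (τ '' M₀) α n) ∪ frontier (shadowZone (τ '' M₀) α))ᶜ)
    (hclose : ∀ ν ∈ ({n, -n} : Set E3), ∀ᶠ s in 𝓝[upperSide τ ν] r,
      ‖kirchhoff τ M₀ η α n Λ k s - eikonal τ M₀ α n Λ k s‖ ≤ a ∧
        ‖fderiv ℝ (kirchhoff τ M₀ η α n Λ k) s - fderiv ℝ (eikonal τ M₀ α n Λ k) s‖ ≤ b) :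
    ‖kirchhoff τ M₀ η α n Λ k r - eikonal τ M₀ α n Λ k r‖ ≤ a ∧
      ‖fderiv ℝ (kirchhoff τ M₀ η α n Λ k) r - fderiv ℝ (eikonal τ M₀ α n Λ k) r‖ ≤ b := by
  have hsides := eventually_sup.2 ⟨hclose n (by simp), hclose (-n) (by simp)⟩
  rw [← nhdsWithin_union, upperSide_union_upperSide_neg] at hsides
  have := mem_closure_iff_nhdsWithin_neBot.1 (h.isUnitNormal.dense_height_ne_zero r)
  exact norm_sub_le_of_frequently
    (h.contDiffAt_kirchhoff Λ hk (h.notMem_image_of_notMem_frontier fun hfr => hr (Or.inl hfr)))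
    (h.contDiffAt_eikonal Λ k hr) (hsides.frequently.filter_mono nhdsWithin_le_nhds)

theorem exists_eventually_norm_sub_le (Λ : ℂ) (hK : IsCompact K)
    (hKfr : K ⊆ (frontier (reflectedZone (τ '' M₀) α n) ∪ frontier (shadowZone (τ '' M₀) α))ᶜ)
    (a b : ℝ) :
    ∃ C : ℝ, ∀ᶠ k : ℝ in atTop, ∀ r ∈ K,
      ‖kirchhoff τ M₀ η α n Λ k r - eikonal τ M₀ α n Λ k r‖ ≤ C * k ^ a ∧
        ‖fderiv ℝ (kirchhoff τ M₀ η α n Λ k) r - fderiv ℝ (eikonal τ M₀ α n Λ k) r‖ ≤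
          C * k ^ b := by
  obtain ⟨ρ, hρ, hKρ⟩ := hK.isBounded.subset_ball_lt 0 0
  obtain ⟨C, hC⟩ := (h.isUnifC1Close_clearPoints Λ hρ.le a b).exists_bound
  refine ⟨C, ?_⟩
  filter_upwards [eventually_gt_atTop 1,
    eventually_mem_clearPoints h.exponent_pos h.nonempty_frontier hK hKρ fun r hr hheight hbase =>
      hKfr hr (Or.inl (h.isOutgoing_reflDir.mem_frontier_rayZone h.isOpen hheight
        hbase)),
    eventually_mem_clearPoints h.exponent_pos h.nonempty_frontier hK hKρ fun r hr hheight hbase =>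
      hKfr hr (Or.inr (h.isOutgoing_neg.mem_frontier_rayZone h.isOpen hheight
        hbase))] with k hk hclear hclear' r hr
  refine h.norm_sub_le_of_eventually_upperSide hk (hKfr hr) ?_
  rintro ν (rfl | rfl)
  exacts [(hclear r hr).mono fun s hs => hC k hk s (Or.inl hs),
    (hclear' r hr).mono fun s hs => hC k hk s (Or.inr hs)]

theorem exists_norm_sub_le (Λ : ℂ) (hρ : 0 ≤ ρ) :
    ∃ C : ℝ, ∀ k : ℝ, 1 < k → ∀ r ∈ Metric.ball 0 ρ \
        (frontier (reflectedZone (τ '' M₀) α n) ∪ frontier (shadowZone (τ '' M₀) α)),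
      ‖kirchhoff τ M₀ η α n Λ k r - eikonal τ M₀ α n Λ k r‖ ≤ C ∧
        ‖fderiv ℝ (kirchhoff τ M₀ η α n Λ k) r - fderiv ℝ (eikonal τ M₀ α n Λ k) r‖ ≤ k * C := by
  obtain ⟨C, hC⟩ := (((h.isRadiatingSide_reflected Λ).isUnifC1Close_upperSide h.exponent_pos
    h.exponent_lt hρ).union ((h.isRadiatingSide_shadow Λ).isUnifC1Close_upperSide h.exponent_pos
    h.exponent_lt hρ)).exists_bound
  refine ⟨C, fun k hk r hr => ?_⟩
  simp only [Real.rpow_zero, Real.rpow_one, mul_comm C, one_mul] at hC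
  refine h.norm_sub_le_of_eventually_upperSide hk hr.2 ?_
  have hnhds : ∀ᶠ s in 𝓝 r, s ∈ Metric.ball 0 ρ \
      (frontier (reflectedZone (τ '' M₀) α n) ∪ frontier (shadowZone (τ '' M₀) α)) :=
    (Metric.isOpen_ball.sdiff (isClosed_frontier.union isClosed_frontier)).mem_nhds hr
  rintro ν (rfl | rfl)
  all_goals filter_upwards [self_mem_nhdsWithin, nhdsWithin_le_nhds hnhds] with s hs hs'
  exacts [hC k hk s (Or.inl ⟨⟨hs, hs'.1⟩, fun hfr => hs'.2 (Or.inl hfr)⟩),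
    hC k hk s (Or.inr ⟨⟨hs, hs'.1⟩, fun hfr => hs'.2 (Or.inr hfr)⟩)]

theorem disjoint_frontier_of_mem_zones {Z : Set E3}
    (hZ : Z ∈ ({reflectedZone (τ '' M₀) α n, shadowZone (τ '' M₀) α, outerZone (τ '' M₀) α n} :
      Set (Set E3))) :
    Disjoint Z (frontier (reflectedZone (τ '' M₀) α n) ∪ frontier (shadowZone (τ '' M₀) α)) := by
  have hRS : Disjoint (reflectedZone (τ '' M₀) α n) (shadowZone (τ '' M₀) α) :=
    Set.disjoint_left.2 fun r hr hr' =>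
      notMem_upperSide_neg (h.reflectedZone_subset hr) (h.shadowZone_subset hr')
  rw [Set.disjoint_union_right]
  rcases hZ with rfl | rfl | rfl
  · exact ⟨(disjoint_frontier_iff_isOpen.2 h.isOpen_reflectedZone).symm,
      (hRS.closure_right h.isOpen_reflectedZone).mono_right frontier_subset_closure⟩
  · exact ⟨(hRS.symm.closure_right h.isOpen_shadowZone).mono_right frontier_subset_closure,
      (disjoint_frontier_iff_isOpen.2 h.isOpen_shadowZone).symm⟩
  · rw [outerZone, closure_union]
    exact ⟨disjoint_compl_left.mono_right (frontier_subset_closure.trans Set.subset_union_left),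
      disjoint_compl_left.mono_right (frontier_subset_closure.trans Set.subset_union_right)⟩

theorem oneSidedClose_outerZone (hk : 1 < k) (hr : r ∈ closure (outerZone (τ '' M₀) α n))
    (hclose : ∀ᶠ s in 𝓝[outerZone (τ '' M₀) α n] r,
      ‖kirchhoff τ M₀ η α n Λ k s - eikonal τ M₀ α n Λ k s‖ ≤ a ∧
        ‖fderiv ℝ (kirchhoff τ M₀ η α n Λ k) s - fderiv ℝ (eikonal τ M₀ α n Λ k) s‖ ≤ b) :
    OneSidedClose (outerZone (τ '' M₀) α n) (kirchhoff τ M₀ η α n Λ k) (eikonal τ M₀ α n Λ k) r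
      a b := by
  have := mem_closure_iff_nhdsWithin_neBot.1 hr
  exact .of_frequently
    (hasC1Limit_of_contDiffAt
      (h.contDiffAt_kirchhoff Λ hk (h.notMem_image_of_mem_closure_outerZone hr)) _)
    ((hasC1Limit_of_contDiffAt contDiffAt_const _).congr fun _ hs => eikonal_eventuallyEq_zero hs)
    hclose.frequently

theorem exists_oneSidedClose (Λ : ℂ) (hρ : 0 ≤ ρ) :
    ∃ C : ℝ, ∀ k : ℝ, 1 < k → ∀ r : E3, ‖r‖ < ρ →
      ∀ Z ∈ ({reflectedZone (τ '' M₀) α n, shadowZone (τ '' M₀) α, outerZone (τ '' M₀) α n} :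
        Set (Set E3)), r ∈ closure Z →
      OneSidedClose Z (kirchhoff τ M₀ η α n Λ k) (eikonal τ M₀ α n Λ k) r C (k * C) := by
  obtain ⟨C, hC⟩ := h.exists_norm_sub_le Λ hρ
  refine ⟨C, fun k hk r hrρ Z hZ hr => ?_⟩
  have hclose : ∀ᶠ s in 𝓝[Z] r, ‖kirchhoff τ M₀ η α n Λ k s - eikonal τ M₀ α n Λ k s‖ ≤ C ∧
      ‖fderiv ℝ (kirchhoff τ M₀ η α n Λ k) s - fderiv ℝ (eikonal τ M₀ α n Λ k) s‖ ≤ k * C := by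
    filter_upwards [self_mem_nhdsWithin,
      mem_nhdsWithin_of_mem_nhds (Metric.isOpen_ball.mem_nhds (mem_ball_zero_iff.2 hrρ))]
      with s hs hsρ
    exact hC k hk s ⟨hsρ, Set.disjoint_left.1 (h.disjoint_frontier_of_mem_zones hZ) hs⟩
  rcases hZ with rfl | rfl | rfl
  · exact (h.isRadiatingSide_reflected Λ).oneSidedClose hk hr hclose
  · exact (h.isRadiatingSide_shadow Λ).oneSidedClose hk hr hclose
  · exact h.oneSidedClose_outerZone hk hr hclose

end IsIlluminatedScreen

end Asymptotics

end KirchhoffPolygon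

end

open KirchhoffPolygon in
theorem mainTheorem5_general {τ : E2 →ᵃⁱ[ℝ] E3} {M₀ : Set E2} {α n : E3} {δ : ℝ} {η : ℝ → E2 → ℝ}
    (h : IsIlluminatedScreen δ τ M₀ η α n) (Λ : ℂ) (_hΛ : Λ ≠ Complex.I * (inner ℝ n α : ℝ))
    {M S R : Set E3} {Φ ψ : ℝ → E3 → ℂ} (hM : M = τ '' M₀) (hS : S = shadowZone M α)
    (hR : R = reflectedZone M α n) (hΦ : Φ = kirchhoff τ M₀ η α n Λ)
    (hψ : ψ = eikonal τ M₀ α n Λ) :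
    (∀ k : ℝ, 1 < k → ∀ r ∈ (frontier R ∪ frontier S)ᶜ,
      DifferentiableAt ℝ (Φ k) r ∧ DifferentiableAt ℝ (ψ k) r) ∧
    (∀ K ⊆ M, IsCompact K → ∀ a b : ℝ, ∃ C : ℝ, ∀ᶠ k : ℝ in atTop, ∀ r ∈ K,
      OneSidedClose R (Φ k) (ψ k) r (C * k ^ a) (C * k ^ b) ∧
      OneSidedClose S (Φ k) (ψ k) r (C * k ^ a) (C * k ^ b)) ∧
    (∀ K ⊆ (frontier R ∪ frontier S)ᶜ, IsCompact K → ∀ a b : ℝ,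
      ∃ C : ℝ, ∀ᶠ k : ℝ in atTop, ∀ r ∈ K,
        ‖Φ k r - ψ k r‖ ≤ C * k ^ a ∧ ‖fderiv ℝ (Φ k) r - fderiv ℝ (ψ k) r‖ ≤ C * k ^ b) ∧
    (∀ ρ : ℝ, 0 < ρ → ∃ C : ℝ, ∀ k : ℝ, 1 < k → ∀ r : E3, ‖r‖ < ρ →
      ∀ Z ∈ ({R, S, outerZone M α n} : Set (Set E3)),
        r ∈ closure Z → OneSidedClose Z (Φ k) (ψ k) r C (k * C)) := by
  subst hM hS hR hΦ hψ
  exact ⟨fun k hk r hr =>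
      ⟨(h.contDiffAt_kirchhoff Λ hk
          (h.notMem_image_of_notMem_frontier fun hfr => hr (Or.inl hfr))).differentiableAt
          one_ne_zero,
        (h.contDiffAt_eikonal Λ k hr).differentiableAt one_ne_zero⟩,
    fun _ hKM hK => h.exists_eventually_oneSidedClose Λ hKM hK,
    fun _ hKfr hK => h.exists_eventually_norm_sub_le Λ hK hKfr,
    fun _ hρ => h.exists_oneSidedClose Λ hρ.le⟩

theorem mainTheorem5
    (τ : KirchhoffPolygon.E2 →ᵃⁱ[ℝ] KirchhoffPolygon.E3)
    (V : Finset KirchhoffPolygon.E2) (hV : (KirchhoffPolygon.polygon V).Nonempty)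
    (α n : KirchhoffPolygon.E3) (hα : ‖α‖ = 1) (hn : ‖n‖ = 1)
    (hnorm : ∀ v : KirchhoffPolygon.E2, inner ℝ n (τ.linear v) = 0)
    (hnα : inner ℝ n α < 0)
    (Λ : ℂ) (hΛ : 0 ≤ Λ.im)
    (δ : ℝ) (hδ₀ : 0 < δ) (hδ₁ : δ < 1 / 2)
    (η : ℝ → KirchhoffPolygon.E2 → ℝ)
    (hη : KirchhoffPolygon.IsCutoff δ (KirchhoffPolygon.polygon V) η)
    (M S R : Set KirchhoffPolygon.E3) (Φ ψ : ℝ → KirchhoffPolygon.E3 → ℂ)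
    (hM : M = τ '' KirchhoffPolygon.polygon V)
    (hS : S = KirchhoffPolygon.shadowZone M α)
    (hR : R = KirchhoffPolygon.reflectedZone M α n)
    (hΦ : Φ = KirchhoffPolygon.kirchhoff τ (KirchhoffPolygon.polygon V) η α n Λ)
    (hψ : ψ = KirchhoffPolygon.eikonal τ (KirchhoffPolygon.polygon V) α n Λ) :
    -- away from the boundaries of the zones both functions are differentiable
    (∀ k : ℝ, 1 < k → ∀ r ∈ (frontier R ∪ frontier S)ᶜ,
      DifferentiableAt ℝ (Φ k) r ∧ DifferentiableAt ℝ (ψ k) r) ∧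
    -- uniform asymptotics on compact subsets of `M`, from both sides of `M`
    (∀ K ⊆ M, IsCompact K → ∃ C : ℝ, ∀ᶠ k : ℝ in atTop, ∀ r ∈ K,
      KirchhoffPolygon.OneSidedClose R (Φ k) (ψ k) r (C / √k) (C * √k) ∧
      KirchhoffPolygon.OneSidedClose S (Φ k) (ψ k) r (C / √k) (C * √k)) ∧
    -- uniform asymptotics on compact sets that avoid the boundaries of the zones
    (∀ K ⊆ (frontier R ∪ frontier S)ᶜ, IsCompact K →
      ∃ C : ℝ, ∀ᶠ k : ℝ in atTop, ∀ r ∈ K,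
        ‖Φ k r - ψ k r‖ ≤ C / √k ∧ ‖fderiv ℝ (Φ k) r - fderiv ℝ (ψ k) r‖ ≤ C * √k) ∧
    -- uniform bounds on bounded sets, with one-sided limits on the boundaries of the zones
    (∀ ρ : ℝ, 0 < ρ → ∃ C₁ C₂ : ℝ, ∀ᶠ k : ℝ in atTop, ∀ r : KirchhoffPolygon.E3, ‖r‖ < ρ →
      ∀ Z ∈ ({R, S, KirchhoffPolygon.outerZone M α n} : Set (Set KirchhoffPolygon.E3)),
        r ∈ closure Z → KirchhoffPolygon.OneSidedClose Z (Φ k) (ψ k) r C₁ (k * C₂)) := by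
  have h : KirchhoffPolygon.IsIlluminatedScreen δ τ (KirchhoffPolygon.polygon V) η α n :=
    ⟨isOpen_interior,
      (isBounded_convexHull.2 V.finite_toSet.isBounded).subset interior_subset,
      hV, hδ₀, hδ₁, hη, ⟨hn, hnorm⟩, hα, hnα⟩
  have hΛ' : Λ ≠ Complex.I * (inner ℝ n α : ℝ) := by
    rintro rfl
    simp only [Complex.I_mul_im, Complex.ofReal_re] at hΛ
    exact hΛ.not_gt hnα
  obtain ⟨hdiff, hscreen, hcompact, hball⟩ := mainTheorem5_general h Λ hΛ' hM hS hR hΦ hψ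
  have hrate {C k : ℝ} (hk : 0 < k) : C * k ^ (-(1 / 2) : ℝ) = C / √k := by
    rw [Real.rpow_neg hk.le, ← Real.sqrt_eq_rpow, div_eq_mul_inv]
  refine ⟨hdiff, fun K hKM hK => (hscreen K hKM hK (-(1 / 2)) (1 / 2)).imp fun C hC => ?_,
    fun K hKfr hK => (hcompact K hKfr hK (-(1 / 2)) (1 / 2)).imp fun C hC => ?_,
    fun ρ hρ => (hball ρ hρ).elim fun C hC => ⟨C, C, (eventually_gt_atTop 1).mono hC⟩⟩
  all_goals
    filter_upwards [eventually_gt_atTop 0, hC] with k hk hCk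
    simpa only [hrate hk, ← Real.sqrt_eq_rpow] using hCk
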